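/- Let $q>0$ be real and let $n,\ell$ be integers with $1\le \ell\le n-1$. Let $H_n(q)$ be the Hecke algebra over $\mathbb C$: the unital associative algebra generated by $g_1,\dots,g_{n-1}$ with relations $g_i^2=(q-1)g_i+q$, $g_ig_{i+1}g_i=g_{i+1}g_ig_{i+1}$, and $g_ig_j=g_jg_i$ for $|i-j|\ge 2$. Write $[k]_q=\frac{q^k-1}{q-1}$ (equal to $k$ if $q=1$) and $[[k]]_q=q^{-(k-1)/2}[k]_q$. For $i\ge 1$, $j\ge 2$ with $i+j\le n+1$ let $$L_j^{(i)}=\sum_{k=0}^{j-2} q^{-k}\, g_{j+i-2-k}\cdots g_{j+i-3}\,g_{j+i-2}\,g_{j+i-3}\cdots g_{j+i-2-k}$$ be the Murphy operators of the subalgebra generated by $g_i,g_{i+1},\dots$, and for $1\le i\le n-\ell$ put $$e_i^{(\ell)}=[[\ell+1]]_q\prod_{j=2}^{\ell+1}\frac{L_j^{(i)}+1}{[j]_q},\qquad f_i^{(\ell)}=[[\ell+1]]_{\sqrt q}\prod_{j=2}^{\ell+1}\frac{L_j^{(i)}-q}{(-q)[j]_{q^{-1}}}.$$ For a Young diagram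 $\mu$ with $n$ boxes, a representation of $H_n(q)$ is said to be labelled by $\mu$ if it is isomorphic to Young's seminormal representation attached to $\mu$. This has a basis $(v_T)$ indexed by the standard tableaux $T$ of shape $\mu$, with $$g_i v_T=\frac{q^{d}}{[d]_q}\,v_T+\frac{[d+1]_q}{[d]_q}\,v_{s_iT},$$ where $d$ is the content (column index minus row index) of the box containing $i+1$ minus the content of the box containing $i$ in $T$, $s_iT$ is $T$ with $i$ and $i+1$ exchanged, and $v_{s_iT}=0$ if $s_iT$ is not standard. Let $A$ be any quotient algebra of $H_n(q)$. Then the following are equivalent: 1. $e_i^{(\ell)}=0$ in $A$ for all $i=1,\dots,n-\ell$; 2. every irreducible representation of $A$, regarded as a representation of $H_n(q)$, is labelled by a Young diagram with at most $\ell$ columns. Likewise, the following are equivalent: 1. $f_i^{(\ell)}=0$ in $A$ for all $i=1,\dots,n-\ell$; 2. every irreducible representation of $A$, regarded as a representation of $H_n(q)$, is labelled by a Young diagram with at most $\ell$ rows. -/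

import Mathlib

/-- The `q`-integer `[k]_q = (q^k - 1)/(q - 1)`, read as `k` at `q = 1`. -/
noncomputable def qInt (q : ℝ) (k : ℤ) : ℝ :=
  open Classical in if q = 1 then (k : ℝ) else (q ^ k - 1) / (q - 1)

/-- The symmetric `q`-integer `[[k]]_q = q^{-(k-1)/2} [k]_q`. -/
noncomputable def qIntSymm (q : ℝ) (k : ℕ) : ℝ :=
  q ^ (-((k : ℝ) - 1) / 2) * qInt q k

/-- The defining relations of the Hecke algebra on generators `g_1, …, g_{n-1}`. -/
inductive HeckeRel (n : ℕ) (q : ℝ) :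
    FreeAlgebra ℂ (Set.Ico 1 n) → FreeAlgebra ℂ (Set.Ico 1 n) → Prop
  | quadratic (i : Set.Ico 1 n) :
      HeckeRel n q (FreeAlgebra.ι ℂ i * FreeAlgebra.ι ℂ i)
        (((q : ℂ) - 1) • FreeAlgebra.ι ℂ i + algebraMap ℂ _ (q : ℂ))
  | braid (i j : Set.Ico 1 n) (h : (j : ℕ) = i + 1) :
      HeckeRel n q (FreeAlgebra.ι ℂ i * FreeAlgebra.ι ℂ j * FreeAlgebra.ι ℂ i)
        (FreeAlgebra.ι ℂ j * FreeAlgebra.ι ℂ i * FreeAlgebra.ι ℂ j)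
  | comm (i j : Set.Ico 1 n) (h : (i : ℕ) + 2 ≤ j) :
      HeckeRel n q (FreeAlgebra.ι ℂ i * FreeAlgebra.ι ℂ j)
        (FreeAlgebra.ι ℂ j * FreeAlgebra.ι ℂ i)

/-- The Hecke algebra `H_n(q)` over `ℂ`. -/
abbrev HeckeAlgebra (n : ℕ) (q : ℝ) : Type := RingQuot (HeckeRel n q)

namespace HeckeAlgebra

variable (n : ℕ) (q : ℝ)

/-- The generator `g_i` for `1 ≤ i < n` (and `0` for indices out of range, which are never used). -/
noncomputable def g (i : ℕ) : HeckeAlgebra n q :=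
  open Classical in
  if h : i ∈ Set.Ico 1 n then RingQuot.mkAlgHom ℂ (HeckeRel n q) (FreeAlgebra.ι ℂ ⟨i, h⟩) else 0

/-- The palindromic word `g_a g_{a+1} ⋯ g_{a+k} ⋯ g_{a+1} g_a`. -/
noncomputable def palindrome : ℕ → ℕ → HeckeAlgebra n q
  | a, 0 => g n q a
  | a, k + 1 => g n q a * palindrome (a + 1) k * g n q a

/-- The Murphy operator `L_j^{(i)}` (for `i ≥ 1`, `j ≥ 2`) of the subalgebra generated by
`g_i, g_{i+1}, …`:
`L_j^{(i)} = ∑_{k=0}^{j-2} q^{-k} g_{j+i-2-k} ⋯ g_{j+i-2} ⋯ g_{j+i-2-k}`. -/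
noncomputable def murphy (i j : ℕ) : HeckeAlgebra n q :=
  ∑ k ∈ Finset.range (j - 1), ((q : ℂ) ^ k)⁻¹ • palindrome n q (j + i - 2 - k) k

/-- The single-row projector `C_m^{(i)} = ∏_{j=2}^{m} (L_j^{(i)} + 1) / [j]_q`, the factors being
multiplied in the order `j = 2, 3, …, m`. -/
noncomputable def rowProjector (i m : ℕ) : HeckeAlgebra n q :=
  ((List.range' 2 (m - 1)).map fun j : ℕ =>
    ((qInt q j : ℂ))⁻¹ • (murphy n q i j + 1)).prod

/-- The single-column projector `R_m^{(i)} = ∏_{j=2}^{m} (L_j^{(i)} - q) / ((-q) [j]_{q⁻¹})`, the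
factors being multiplied in the order `j = 2, 3, …, m`. -/
noncomputable def colProjector (i m : ℕ) : HeckeAlgebra n q :=
  ((List.range' 2 (m - 1)).map fun j : ℕ =>
    (-(q : ℂ) * (qInt q⁻¹ j : ℂ))⁻¹ • (murphy n q i j - algebraMap ℂ _ (q : ℂ))).prod

/-- `e_i^{(ℓ)} = [[ℓ+1]]_q C_{ℓ+1}^{(i)}`. -/
noncomputable def e (i l : ℕ) : HeckeAlgebra n q :=
  (qIntSymm q (l + 1) : ℂ) • rowProjector n q i (l + 1)

/-- `f_i^{(ℓ)} = [[ℓ+1]]_{√q} R_{ℓ+1}^{(i)}`. -/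
noncomputable def f (i l : ℕ) : HeckeAlgebra n q :=
  (qIntSymm (Real.sqrt q) (l + 1) : ℂ) • colProjector n q i (l + 1)

end HeckeAlgebra

/-- A standard Young tableau with `n` boxes and shape `μ`, given as the chain
`∅ = Γ_0 ⊂ Γ_1 ⊂ ⋯ ⊂ Γ_n = μ` of Young diagrams in which `Γ_p` has `p` boxes: `Γ_p` consists of
the boxes with entries `1, …, p`. The chain is continued by `Γ_p = μ` for `p > n`. -/
@[ext]
structure StandardTableau (n : ℕ) (μ : YoungDiagram) where
  shape : ℕ → YoungDiagram
  mono : Monotone shape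
  card_shape : ∀ p, (shape p).card = min p n
  shape_last : shape n = μ

namespace StandardTableau

variable {n : ℕ} {μ : YoungDiagram}

/-- The content (column index minus row index) of the box with entry `p`, `1 ≤ p ≤ n`, that is, of
the unique box of `Γ_p` outside `Γ_{p-1}`. -/
def content (T : StandardTableau n μ) (p : ℕ) : ℤ :=
  ∑ c ∈ (T.shape p).cells \ (T.shape (p - 1)).cells, ((c.2 : ℤ) - (c.1 : ℤ))

/-- The matrix entries of Young's seminormal representation of the Hecke algebra: the coefficient
of `v_{T'}` in `g_i v_T`. With `d` the content of the box of `i + 1` minus that of the box of `i`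
in `T`,
`g_i v_T = (q^d / [d]_q) v_T + ([d+1]_q / [d]_q) v_{s_i T}`,
where `s_i T` is `T` with `i` and `i + 1` exchanged and `v_{s_i T} = 0` if `s_i T` is not standard.
A tableau `T' ≠ T` is `s_i T` exactly if its chain agrees with that of `T` except at the place `i`.
-/
noncomputable def seminormalEntry (q : ℝ) (i : ℕ) (T' T : StandardTableau n μ) : ℝ :=
  open Classical in
  let d : ℤ := T.content (i + 1) - T.content i
  if T' = T then q ^ d / qInt q d
  else if ∀ p, p ≠ i → T'.shape p = T.shape p then qInt q (d + 1) / qInt q d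
  else 0

end StandardTableau

/-- The representation `ρ` of `H_n(q)` is labelled by the Young diagram `μ` with `n` boxes: it is
isomorphic to Young's seminormal representation attached to `μ`, that is, it has a basis indexed by
the standard tableaux of shape `μ` in which the generators act by the seminormal matrices. -/
def IsLabelledBy {n : ℕ} {q : ℝ} {V : Type*} [AddCommGroup V] [Module ℂ V]
    (ρ : HeckeAlgebra n q →ₐ[ℂ] Module.End ℂ V) (μ : YoungDiagram) : Prop :=
  μ.card = n ∧ ∃ b : Module.Basis (StandardTableau n μ) ℂ V,
    ∀ i ∈ Set.Ico 1 n, ∀ T T' : StandardTableau n μ,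
      b.repr (ρ (HeckeAlgebra.g n q i) (b T)) T' =
        ((StandardTableau.seminormalEntry q i T' T : ℝ) : ℂ)

/-- Every irreducible representation of the quotient `π : H_n(q) → A` is labelled, as a
representation of `H_n(q)`, by a Young diagram satisfying `P`. -/
def OnlyIrrepsLabelled.{u} {n : ℕ} {q : ℝ} {A : Type u} [Ring A] [Algebra ℂ A]
    (π : HeckeAlgebra n q →ₐ[ℂ] A) (P : YoungDiagram → Prop) : Prop :=
  ∀ (M : Type u) [AddCommGroup M] [Module ℂ M] [Module A M] [IsScalarTower ℂ A M]
    [IsSimpleModule A M],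
    ∃ μ : YoungDiagram, IsLabelledBy ((Algebra.lsmul ℂ ℂ M).comp π) μ ∧ P μ

/-! Only `i = 1` matters: the Coxeter element `g_1 ⋯ g_{n-1}` is a unit whose conjugation raises the
index of every generator by one, so a quotient killing `e_1` or `f_1` kills all their shifts
(`map_shift_eq_zero`).

For `i = 1` the Murphy operators are the commuting Jucys–Murphy elements (`murphy_one_eq`). They are
diagonal on the seminormal basis: on `v_T` the eigenvalue of `L_j` is `q[c]`, where `c` is the
content of the box of `j`. The factor `(L_j + 1)/[j]` therefore acts by `[c + 1]/[j]`. If box `(1,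
0)` is among the first `ℓ + 1` entries, some `c` is `-1` and the product vanishes; otherwise these
entries fill a row, `c = j - 1`, and every factor is `1`. So `e_1` is a nonzero multiple of the
projection onto the tableaux starting with a row of `ℓ + 1` boxes, and these exist exactly when the
first row of `μ` is longer than `ℓ`. The column case is the mirror image. Both are instances of
`IsBoxProjector.map_eq_zero_iff`. There an element killed by all simple modules lies in every
maximal left ideal, and idempotency then forces it to be zero, so semisimplicity of `A` is not
needed.

The substantial part is that every irreducible representation is seminormal (`exists_isLabelledBy`).
The Hecke algebra acts on functions on the symmetric group by self-adjoint operators; a cyclic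
vector and the bound `n!` on the dimension identify this module with the regular one
(`orbitMap_bijective`). Hence joint eigenvectors of the Jucys–Murphy elements span it. The
eigenvalues of such a vector are the contents of a standard chain of diagrams
(`exists_addable_of_eigenvalue`), and the vector extends to a family on which the generators act by
the seminormal matrices (`exists_isSeminormal`). A nonzero equivariant map to an irreducible module
does not kill all weight vectors; the image of the family of one that survives is independent,
because the weights differ, and spans by irreducibility. -/

section QInt

/-! ### Arithmetic of q-integers and of the seminormal coefficients. -/

variable {q : ℝ}

/-- A division-free form of the definition, uniform in `q = 1`, so that later identities need no
case split. -/
theorem one_add_mul_qInt (hq : 0 < q) (k : ℤ) : 1 + (q - 1) * qInt q k = q ^ k := by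
  unfold qInt
  split_ifs with h
  · subst h; simp
  · field_simp [sub_ne_zero.2 h]; ring

@[simp] theorem qInt_zero (q : ℝ) : qInt q 0 = 0 := by simp [qInt]

@[simp] theorem qInt_one (q : ℝ) : qInt q 1 = 1 := by
  unfold qInt
  split_ifs with h
  · simp
  · simp [div_self (sub_ne_zero.2 h)]

theorem qInt_add (hq : 0 < q) (k m : ℤ) : qInt q (k + m) = qInt q k + q ^ k * qInt q m := by
  unfold qInt
  split_ifs with h
  · subst h; simp
  · rw [zpow_add₀ hq.ne']; field_simp [sub_ne_zero.2 h]; ring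

theorem qInt_add_one (hq : 0 < q) (k : ℤ) : qInt q (k + 1) = q * qInt q k + 1 := by
  rw [add_comm, qInt_add hq]; simp [add_comm]

theorem qInt_pos (hq : 0 < q) {k : ℤ} (hk : 0 < k) : 0 < qInt q k := by
  unfold qInt
  split_ifs with h
  · exact_mod_cast hk
  · rcases lt_or_gt_of_ne h with h | h
    · exact div_pos_of_neg_of_neg (by linarith [zpow_lt_one₀ hq h hk]) (by linarith)
    · exact div_pos (by linarith [one_lt_zpow₀ h hk]) (by linarith)

theorem qInt_neg (hq : 0 < q) (k : ℤ) : q ^ k * qInt q (-k) = -qInt q k := by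
  have := qInt_add hq k (-k)
  simp at this
  linarith

/-- A positive real `q ≠ 1` is not a root of unity. This keeps the seminormal denominators nonzero
and lets Murphy eigenvalues separate contents. -/
theorem qInt_eq_zero_iff (hq : 0 < q) {k : ℤ} : qInt q k = 0 ↔ k = 0 := by
  refine ⟨fun h => ?_, fun h => by simp [h]⟩
  rcases lt_trichotomy k 0 with hk | hk | hk
  · have := qInt_neg hq k
    have h2 := qInt_pos hq (neg_pos.2 hk)
    rw [h, neg_zero] at this
    have := mul_pos (zpow_pos hq k) h2
    linarith
  · exact hk
  · exact absurd h (qInt_pos hq hk).ne'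

theorem qInt_injective (hq : 0 < q) : Function.Injective (qInt q) := by
  intro k m h
  have := qInt_add hq m (k - m)
  rw [add_sub_cancel, h] at this
  have h2 : q ^ m * qInt q (k - m) = 0 := by linarith
  rcases mul_eq_zero.1 h2 with h3 | h3
  · exact absurd h3 (zpow_pos hq m).ne'
  · have := (qInt_eq_zero_iff hq).1 h3; omega

/-- The diagonal coefficient `q^d / [d]_q` of the seminormal form. -/
noncomputable def diagCoeff (q : ℝ) (d : ℤ) : ℂ := ((q ^ d / qInt q d : ℝ) : ℂ)

/-- The off-diagonal coefficient `[d+1]_q / [d]_q` of the seminormal form. -/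
noncomputable def swapCoeff (q : ℝ) (d : ℤ) : ℂ := ((qInt q (d + 1) / qInt q d : ℝ) : ℂ)

/-- The eigenvalue `q [c]_q` of a Murphy operator belonging to the content `c`. -/
noncomputable def murphyEigenvalue (q : ℝ) (c : ℤ) : ℂ := ((q * qInt q c : ℝ) : ℂ)

theorem murphyEigenvalue_injective (hq : 0 < q) : Function.Injective (murphyEigenvalue q) := by
  intro a b h
  have h1 : q * qInt q a = q * qInt q b := Complex.ofReal_injective h
  exact qInt_injective hq (mul_left_cancel₀ hq.ne' h1)

theorem murphyEigenvalue_zero : murphyEigenvalue q 0 = 0 := by simp [murphyEigenvalue]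

/-- Here and in the next three lemmas the coefficients at `d` and `-d` become affine functions of
`1/[d]`, which turns the relations between them into polynomial identities. -/
theorem diagCoeff_neg (hq : 0 < q) {d : ℤ} (hd : d ≠ 0) :
    diagCoeff q (-d) = -((qInt q d : ℝ) : ℂ)⁻¹ := by
  have h1 := qInt_neg hq d
  have h2 : qInt q d ≠ 0 := mt (qInt_eq_zero_iff hq).1 hd
  have h3 : qInt q (-d) ≠ 0 := mt (qInt_eq_zero_iff hq).1 (by omega)
  have h4 : q ^ d ≠ 0 := (zpow_pos hq d).ne'
  have : q ^ (-d) / qInt q (-d) = -(qInt q d)⁻¹ := by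
    rw [zpow_neg]; field_simp; linarith
  rw [diagCoeff, this]; push_cast; rfl

theorem swapCoeff_neg (hq : 0 < q) {d : ℤ} (hd : d ≠ 0) :
    swapCoeff q (-d) = 1 - ((qInt q d : ℝ) : ℂ)⁻¹ := by
  have h1 := qInt_neg hq d
  have h2 : qInt q d ≠ 0 := mt (qInt_eq_zero_iff hq).1 hd
  have h3 : qInt q (-d) ≠ 0 := mt (qInt_eq_zero_iff hq).1 (by omega)
  have h4 := one_add_mul_qInt hq d
  have : qInt q (-d + 1) / qInt q (-d) = 1 - (qInt q d)⁻¹ := by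
    rw [qInt_add_one hq]; field_simp
    have : (qInt q (-d)) * (1 + (q - 1) * qInt q d) = - qInt q d := by rw [h4]; linarith
    linarith
  rw [swapCoeff, this]; push_cast; rfl

theorem diagCoeff_eq (hq : 0 < q) {d : ℤ} (hd : d ≠ 0) :
    diagCoeff q d = (q : ℂ) - 1 + ((qInt q d : ℝ) : ℂ)⁻¹ := by
  have h2 : qInt q d ≠ 0 := mt (qInt_eq_zero_iff hq).1 hd
  have : q ^ d / qInt q d = q - 1 + (qInt q d)⁻¹ := by
    rw [← one_add_mul_qInt hq]; field_simp; ring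
  rw [diagCoeff, this]; push_cast; rfl

theorem swapCoeff_eq (hq : 0 < q) {d : ℤ} (hd : d ≠ 0) :
    swapCoeff q d = (q : ℂ) + ((qInt q d : ℝ) : ℂ)⁻¹ := by
  have h2 : qInt q d ≠ 0 := mt (qInt_eq_zero_iff hq).1 hd
  have : qInt q (d + 1) / qInt q d = q + (qInt q d)⁻¹ := by
    rw [qInt_add_one hq]; field_simp
  rw [swapCoeff, this]; push_cast; rfl

theorem swapCoeff_ne_zero (hq : 0 < q) {d : ℤ} (hd : d ≠ 0) (hd' : d ≠ -1) :
    swapCoeff q d ≠ 0 := by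
  have h2 : qInt q d ≠ 0 := mt (qInt_eq_zero_iff hq).1 hd
  have h3 : qInt q (d + 1) ≠ 0 := mt (qInt_eq_zero_iff hq).1 (by omega)
  rw [swapCoeff]; exact_mod_cast div_ne_zero h3 h2

theorem diagCoeff_one : diagCoeff q 1 = q := by simp [diagCoeff]

theorem diagCoeff_neg_one (hq : 0 < q) : diagCoeff q (-1) = -1 := by
  rw [diagCoeff_neg hq one_ne_zero]; simp

/-- The quadratic equation satisfied by a `2 × 2` block of the seminormal form. -/
theorem swapCoeff_mul_swapCoeff_neg (hq : 0 < q) {d : ℤ} (hd : d ≠ 0) :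
    swapCoeff q d * swapCoeff q (-d) = diagCoeff q d * diagCoeff q (-d) + q := by
  have h2 : ((qInt q d : ℝ) : ℂ) ≠ 0 := by exact_mod_cast mt (qInt_eq_zero_iff hq).1 hd
  rw [swapCoeff_eq hq hd, swapCoeff_neg hq hd, diagCoeff_eq hq hd, diagCoeff_neg hq hd]
  ring

/-- The trace of the block: its eigenvalues are the roots `q` and `-1` of the quadratic relation. -/
theorem diagCoeff_add_diagCoeff_neg (hq : 0 < q) {d : ℤ} (hd : d ≠ 0) :
    diagCoeff q d + diagCoeff q (-d) = (q : ℂ) - 1 := by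
  rw [diagCoeff_eq hq hd, diagCoeff_neg hq hd]; ring

/-- The defining property of the diagonal coefficient in terms of Murphy eigenvalues. -/
theorem diagCoeff_mul_sub (hq : 0 < q) {a b : ℤ} (hab : a ≠ b) :
    diagCoeff q (b - a) * (murphyEigenvalue q b - murphyEigenvalue q a) =
      ((q : ℂ) - 1) * murphyEigenvalue q b + q := by
  have h0 : b - a ≠ 0 := by omega
  have h2 : qInt q (b - a) ≠ 0 := mt (qInt_eq_zero_iff hq).1 h0
  have h1 := qInt_add hq a (b - a)
  rw [add_sub_cancel] at h1
  have h3 := one_add_mul_qInt hq b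
  have h4 : q ^ b = q ^ a * q ^ (b - a) := by rw [← zpow_add₀ hq.ne']; congr 1; omega
  have : q ^ (b - a) / qInt q (b - a) * (q * qInt q b - q * qInt q a) =
      (q - 1) * (q * qInt q b) + q := by
    have : q * qInt q b - q * qInt q a = q * (q ^ a * qInt q (b - a)) := by rw [h1]; ring
    rw [this]
    field_simp
    linear_combination (-1 : ℝ) * h4 - h3
  rw [diagCoeff, murphyEigenvalue, murphyEigenvalue]
  exact_mod_cast this

/-- The left side is `q^(c+1)`. -/
theorem murphyEigenvalue_nondegenerate (hq : 0 < q) (c : ℤ) :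
    ((q : ℂ) - 1) * murphyEigenvalue q c + q ≠ 0 := by
  have h3 := one_add_mul_qInt hq c
  have : (q - 1) * (q * qInt q c) + q = q * q ^ c := by rw [← h3]; ring
  have h4 : (q - 1) * (q * qInt q c) + q ≠ 0 := by
    rw [this]; exact (mul_pos hq (zpow_pos hq c)).ne'
  rw [murphyEigenvalue]
  exact_mod_cast h4

theorem murphyEigenvalue_add_one (hq : 0 < q) (c : ℤ) :
    murphyEigenvalue q (c + 1) = q * murphyEigenvalue q c + q := by
  rw [murphyEigenvalue, murphyEigenvalue, qInt_add_one hq]; push_cast; ring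

end QInt

/-! ### Hecke relations and Jucys–Murphy elements in an arbitrary algebra. -/

/-- Elements `g 0, …, g (N - 1)` of a `ℂ`-algebra satisfying the Hecke relations. -/
structure IsHeckeFamily (N : ℕ) (q : ℝ) {R : Type*} [Ring R] [Algebra ℂ R] (g : ℕ → R) : Prop where
  quadratic : ∀ i < N, g i * g i = ((q : ℂ) - 1) • g i + (q : ℂ) • (1 : R)
  braid : ∀ i, i + 1 < N → g i * g (i + 1) * g i = g (i + 1) * g i * g (i + 1)
  comm : ∀ i j, i + 2 ≤ j → j < N → g i * g j = g j * g i

/-- The Jucys–Murphy elements of a Hecke family. -/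
noncomputable def jucysMurphy (q : ℝ) {R : Type*} [Ring R] [Algebra ℂ R] (g : ℕ → R) : ℕ → R
  | 0 => 0
  | k + 1 => g k + (q : ℂ)⁻¹ • (g k * jucysMurphy q g k * g k)

theorem map_jucysMurphy {q : ℝ} {R S : Type*} [Ring R] [Algebra ℂ R] [Ring S] [Algebra ℂ S]
    (φ : R →ₐ[ℂ] S) (g : ℕ → R) (k : ℕ) :
    φ (jucysMurphy q g k) = jucysMurphy q (fun i => φ (g i)) k := by
  induction k with
  | zero => simp [jucysMurphy]
  | succ k ih => simp [jucysMurphy, ih]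

namespace IsHeckeFamily

variable {N : ℕ} {q : ℝ} {R : Type*} [Ring R] [Algebra ℂ R] {g : ℕ → R}

theorem map {S : Type*} [Ring S] [Algebra ℂ S] (hg : IsHeckeFamily N q g) (φ : R →ₐ[ℂ] S) :
    IsHeckeFamily N q (fun i => φ (g i)) where
  quadratic i hi := by rw [← map_mul, hg.quadratic i hi, map_add, map_smul, map_smul, map_one]
  braid i hi := by simp [← map_mul, hg.braid i hi]
  comm i j h hj := by simp [← map_mul, hg.comm i j h hj]

/-- The generators are invertible. -/
theorem isUnit (hg : IsHeckeFamily N q g) (hq : 0 < q) {i : ℕ} (hi : i < N) : IsUnit (g i) := by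
  have hq' : (q : ℂ) ≠ 0 := by exact_mod_cast hq.ne'
  have h := hg.quadratic i hi
  refine ⟨⟨g i, (q : ℂ)⁻¹ • (g i - ((q : ℂ) - 1) • 1), ?_, ?_⟩, rfl⟩
  · rw [mul_smul_comm, mul_sub, h, mul_smul_comm, mul_one, add_sub_cancel_left, smul_smul,
      inv_mul_cancel₀ hq', one_smul]
  · rw [smul_mul_assoc, sub_mul, h, smul_mul_assoc, one_mul, add_sub_cancel_left, smul_smul,
      inv_mul_cancel₀ hq', one_smul]

/-- The `k`-th Jucys–Murphy element involves only generators of index below `k`, all at distance at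
least two from `i`. -/
theorem commute_jucysMurphy_of_lt (hg : IsHeckeFamily N q g) {k i : ℕ} (hki : k < i) (hi : i < N) :
    Commute (g i) (jucysMurphy q g k) := by
  induction k with
  | zero => exact Commute.zero_right _
  | succ k ih =>
    have h1 : Commute (g i) (g k) := (hg.comm k i (by omega) hi).symm
    exact h1.add_right (((h1.mul_right (ih (by omega))).mul_right h1).smul_right _)

/-- With `a = g k`, `b = g (k + 1)` and `J` the `k`-th element, the element in question is `b + q⁻¹
bab + q⁻² baJab`. Two braid moves carry `a` through the last term; the quadratic relation balances
the first two against each other. -/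
theorem commute_jucysMurphy_add_two (hg : IsHeckeFamily N q g) (hq : 0 < q) {k : ℕ}
    (hk : k + 1 < N) : Commute (g k) (jucysMurphy q g (k + 2)) := by
  have hq' : (q : ℂ) ≠ 0 := by exact_mod_cast hq.ne'
  have hb := hg.braid k hk
  have hbJ := hg.commute_jucysMurphy_of_lt (k := k) (i := k + 1) (by omega) hk
  have hs := hg.quadratic (k + 1) hk
  simp only [jucysMurphy]
  generalize jucysMurphy q g k = J at *
  generalize g k = a at *
  generalize g (k + 1) = b at *
  have e1 : a * b * a * b = ((q : ℂ) - 1) • (b * a * b) + (q : ℂ) • (b * a) := by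
    rw [hb, mul_assoc, hs, mul_add, mul_smul_comm, mul_smul_comm, mul_one]
  have e2 : b * a * b * a = ((q : ℂ) - 1) • (b * a * b) + (q : ℂ) • (a * b) := by
    rw [mul_assoc, mul_assoc, ← mul_assoc a, hb, ← mul_assoc, ← mul_assoc, hs, add_mul, add_mul,
      smul_mul_assoc, smul_mul_assoc, smul_mul_assoc, smul_mul_assoc, one_mul]
  have e3 : a * (b * (a * J * a) * b) = b * (a * J * a) * b * a := by
    calc a * (b * (a * J * a) * b) = (a * b * a) * J * a * b := by simp only [mul_assoc]
      _ = b * a * (b * J) * a * b := by rw [hb]; simp only [mul_assoc]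
      _ = b * a * J * (b * a * b) := by rw [hbJ.eq]; simp only [mul_assoc]
      _ = b * (a * J * a) * b * a := by rw [← hb]; simp only [mul_assoc]
  have e4 : a * (b * a * b) = a * b * a * b := by simp only [mul_assoc]
  show a * _ = _ * a
  simp only [mul_add, add_mul, mul_smul_comm, smul_mul_assoc, e3, e4, e1, e2, smul_add]
  simp only [smul_smul, inv_mul_cancel₀ hq', one_smul]
  abel

theorem commute_jucysMurphy (hg : IsHeckeFamily N q g) (hq : 0 < q) {i k : ℕ} (hi : i < N)
    (hk : k ≤ N) (h1 : k ≠ i) (h2 : k ≠ i + 1) : Commute (g i) (jucysMurphy q g k) := by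
  rcases lt_or_gt_of_ne h1 with h | h
  · exact hg.commute_jucysMurphy_of_lt h hi
  obtain ⟨m, rfl⟩ := Nat.exists_eq_add_of_le (show i + 2 ≤ k by omega)
  clear h h1 h2
  induction m with
  | zero => exact hg.commute_jucysMurphy_add_two hq (by omega)
  | succ m ih =>
    have h1 : Commute (g i) (g (i + 2 + m)) := hg.comm i _ (by omega) (by omega)
    exact h1.add_right (((h1.mul_right (ih (by omega))).mul_right h1).smul_right _)

/-- For `j + 1 < k` both ingredients of the recursion for the element of index `j + 1` commute with
the `k`-th one. -/
theorem jucysMurphy_commute (hg : IsHeckeFamily N q g) (hq : 0 < q) {j k : ℕ} (hj : j ≤ N)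
    (hk : k ≤ N) : Commute (jucysMurphy q g j) (jucysMurphy q g k) := by
  wlog hjk : j ≤ k
  · exact (this hg hq hk hj (by omega)).symm
  induction j with
  | zero => exact Commute.zero_left _
  | succ j ih =>
    rcases hjk.eq_or_lt with rfl | h
    · exact Commute.refl _
    have h1 := (hg.commute_jucysMurphy hq (i := j) (k := k) (by omega) hk (by omega) (by omega))
    exact h1.add_left (((h1.mul_left (ih (by omega) (by omega))).mul_left h1).smul_left _)

/-- This mixed relation and the next determine how `g k` moves a pair of consecutive Murphy
eigenvalues; they are the quadratic relation applied to the recursion. -/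
theorem mul_jucysMurphy_succ (hg : IsHeckeFamily N q g) (hq : 0 < q) {k : ℕ} (hk : k < N) :
    g k * jucysMurphy q g (k + 1) =
      jucysMurphy q g k * g k + ((q : ℂ) - 1) • jucysMurphy q g (k + 1) + (q : ℂ) • 1 := by
  have hq' : (q : ℂ) ≠ 0 := by exact_mod_cast hq.ne'
  have hs := hg.quadratic k hk
  have e : g k * (g k * jucysMurphy q g k * g k) =
      ((q : ℂ) - 1) • (g k * jucysMurphy q g k * g k) + (q : ℂ) • (jucysMurphy q g k * g k) := by
    rw [← mul_assoc, ← mul_assoc, hs, add_mul, add_mul]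
    simp only [smul_mul_assoc, one_mul]
  simp only [jucysMurphy, mul_add, mul_smul_comm, e, hs, smul_add, smul_smul,
    inv_mul_cancel₀ hq', one_smul]
  rw [mul_comm ((q : ℂ) - 1)]
  abel

theorem jucysMurphy_succ_mul (hg : IsHeckeFamily N q g) (hq : 0 < q) {k : ℕ} (hk : k < N) :
    jucysMurphy q g (k + 1) * g k =
      g k * jucysMurphy q g k + ((q : ℂ) - 1) • jucysMurphy q g (k + 1) + (q : ℂ) • 1 := by
  have hq' : (q : ℂ) ≠ 0 := by exact_mod_cast hq.ne'
  have hs := hg.quadratic k hk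
  have e : g k * jucysMurphy q g k * g k * g k =
      ((q : ℂ) - 1) • (g k * jucysMurphy q g k * g k) + (q : ℂ) • (g k * jucysMurphy q g k) := by
    rw [mul_assoc _ (g k) (g k), hs, mul_add]
    simp only [mul_smul_comm, mul_one]
  simp only [jucysMurphy, add_mul, smul_mul_assoc, e, hs, smul_add, smul_smul,
    inv_mul_cancel₀ hq', one_smul]
  rw [mul_comm ((q : ℂ) - 1)]
  abel

/-- Conjugation by the Coxeter element `g 0 ⋯ g (k - 1)` shifts the generators. -/
theorem prod_mul (hg : IsHeckeFamily N q g) {k i : ℕ} (hk : k ≤ N) (hi : i + 1 < k) :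
    ((List.range k).map g).prod * g i = g (i + 1) * ((List.range k).map g).prod := by
  have hfar : ∀ m j, m + 1 ≤ j → j < N →
      Commute ((List.range m).map g).prod (g j) := by
    intro m j hm hj
    induction m with
    | zero => simp
    | succ m ih =>
      rw [List.range_succ, List.map_append, List.prod_append]
      simp only [List.map_cons, List.map_nil, List.prod_cons, List.prod_nil, mul_one]
      exact (ih (by omega)).mul_left (hg.comm m j (by omega) hj)
  induction k with
  | zero => omega
  | succ k ih =>
    rw [List.range_succ, List.map_append, List.prod_append]
    simp only [List.map_cons, List.map_nil, List.prod_cons, List.prod_nil, mul_one]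
    rcases (show i + 1 < k ∨ i + 1 = k by omega) with h | rfl
    · rw [mul_assoc, ← hg.comm i k (by omega) (by omega), ← mul_assoc, ih (by omega) h, mul_assoc]
    -- The last two letters are now `g i * g (i + 1)`; a braid move creates a `g (i + 1)` on their
    -- left, which commutes with the rest of the product.
    · rw [List.range_succ, List.map_append, List.prod_append]
      simp only [List.map_cons, List.map_nil, List.prod_cons, List.prod_nil, mul_one]
      have h := hfar i (i + 1) le_rfl (by omega)
      rw [mul_assoc, mul_assoc, ← mul_assoc (g i), hg.braid i (by omega), ← mul_assoc,
        ← mul_assoc, h.eq]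
      simp only [mul_assoc]

theorem isUnit_prod (hg : IsHeckeFamily N q g) (hq : 0 < q) {k : ℕ} (hk : k ≤ N) :
    IsUnit ((List.range k).map g).prod := by
  induction k with
  | zero => simp
  | succ k ih =>
    rw [List.range_succ, List.map_append, List.prod_append]
    simpa using (ih (by omega)).mul (hg.isUnit hq (by omega))

end IsHeckeFamily

/-! ### Murphy operators as Jucys–Murphy elements, and conjugation between the shifts. -/

namespace HeckeAlgebra

variable {n : ℕ} {q : ℝ}

theorem isHeckeFamily_g (n : ℕ) (q : ℝ) :
    IsHeckeFamily (n - 1) q (fun k => g n q (k + 1)) where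
  quadratic i hi := by
    have h : i + 1 ∈ Set.Ico 1 n := ⟨by omega, by omega⟩
    simp only [g, h, dif_pos, ← map_mul]
    rw [RingQuot.mkAlgHom_rel ℂ (HeckeRel.quadratic ⟨i + 1, h⟩), map_add, map_smul,
      AlgHom.commutes, Algebra.algebraMap_eq_smul_one]
  braid i hi := by
    have h : i + 1 ∈ Set.Ico 1 n := ⟨by omega, by omega⟩
    have h' : i + 1 + 1 ∈ Set.Ico 1 n := ⟨by omega, by omega⟩
    simp only [g, h, h', dif_pos, ← map_mul]
    exact RingQuot.mkAlgHom_rel ℂ (HeckeRel.braid ⟨i + 1, h⟩ ⟨i + 1 + 1, h'⟩ rfl)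
  comm i j hij hj := by
    have h : i + 1 ∈ Set.Ico 1 n := ⟨by omega, by omega⟩
    have h' : j + 1 ∈ Set.Ico 1 n := ⟨by omega, by omega⟩
    simp only [g, h, h', dif_pos, ← map_mul]
    exact RingQuot.mkAlgHom_rel ℂ (HeckeRel.comm ⟨i + 1, h⟩ ⟨j + 1, h'⟩
      (show i + 1 + 2 ≤ j + 1 by omega))

/-- The definition puts the smallest letter outside, the Jucys–Murphy recursion the largest. The
braid relation is the case of three letters; longer words follow because the two outer letters
commute. -/
theorem palindrome_succ' {a k : ℕ} (ha : 1 ≤ a) (h : a + k + 1 < n) :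
    palindrome n q a (k + 1) = g n q (a + k + 1) * palindrome n q a k * g n q (a + k + 1) := by
  obtain ⟨a, rfl⟩ := Nat.exists_eq_add_of_le' ha
  induction k generalizing a with
  | zero => exact (isHeckeFamily_g n q).braid a (by omega)
  | succ k ih =>
    have hc : g n q (a + 1) * g n q (a + k + 3) = g n q (a + k + 3) * g n q (a + 1) :=
      (isHeckeFamily_g n q).comm a (a + k + 2) (by omega) (by omega)
    have e1 : a + 1 + 1 + k + 1 = a + k + 3 := by omega
    have e2 : a + 1 + (k + 1) + 1 = a + k + 3 := by omega
    have ih := ih (a + 1) (by omega) (by omega)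
    rw [e1] at ih
    rw [e2, palindrome, ih, palindrome, ← mul_assoc, ← mul_assoc, hc]
    simp only [mul_assoc, hc]

theorem murphy_one_eq {j : ℕ} (hj : j < n) :
    murphy n q 1 (j + 1) = jucysMurphy q (fun k => g n q (k + 1)) j := by
  induction j with
  | zero => simp [murphy, jucysMurphy]
  | succ j ih =>
    rw [jucysMurphy, ← ih (by omega), murphy, murphy, Nat.add_sub_cancel, Nat.add_sub_cancel,
      Finset.sum_range_succ', add_comm]
    congr 1
    · simp [palindrome]
    · rw [Finset.mul_sum, Finset.sum_mul, Finset.smul_sum]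
      refine Finset.sum_congr rfl fun k hk => ?_
      have hk := Finset.mem_range.1 hk
      have e1 : j + 1 + 1 + 1 - 2 - (k + 1) = j - k := by omega
      have e2 : j + 1 + 1 - 2 - k = j - k := by omega
      have e3 : j - k + k + 1 = j + 1 := by omega
      rw [e1, e2, palindrome_succ' (by omega) (by omega), e3, mul_smul_comm, smul_mul_assoc,
        smul_smul, pow_succ, mul_inv, mul_comm]

theorem exists_unit_conj (hq : 0 < q) : ∃ h : HeckeAlgebra n q, IsUnit h ∧
    ∀ i, 1 ≤ i → i + 1 < n → h * g n q i = g n q (i + 1) * h := by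
  have H := isHeckeFamily_g n q
  refine ⟨_, H.isUnit_prod hq le_rfl, fun i hi hin => ?_⟩
  obtain ⟨i, rfl⟩ := Nat.exists_eq_add_of_le' hi
  exact H.prod_mul le_rfl (by omega)

theorem semiconj_palindrome {h : HeckeAlgebra n q}
    (hh : ∀ i, 1 ≤ i → i + 1 < n → h * g n q i = g n q (i + 1) * h) {a k : ℕ} (ha : 1 ≤ a)
    (hak : a + k + 1 < n) : SemiconjBy h (palindrome n q a k) (palindrome n q (a + 1) k) := by
  induction k generalizing a with
  | zero => exact hh a ha hak
  | succ k ih =>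
    have h1 : SemiconjBy h (g n q a) (g n q (a + 1)) := hh a ha (by omega)
    exact (h1.mul_right (ih (by omega) (by omega))).mul_right h1

theorem semiconj_murphy {h : HeckeAlgebra n q}
    (hh : ∀ i, 1 ≤ i → i + 1 < n → h * g n q i = g n q (i + 1) * h) {i j : ℕ} (hi : 1 ≤ i)
    (hij : i + j ≤ n) : SemiconjBy h (murphy n q i j) (murphy n q (i + 1) j) := by
  unfold murphy SemiconjBy
  rw [Finset.mul_sum, Finset.sum_mul]
  refine Finset.sum_congr rfl fun k hk => ?_
  have hk := Finset.mem_range.1 hk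
  have e : j + (i + 1) - 2 - k = j + i - 2 - k + 1 := by omega
  rw [mul_smul_comm, smul_mul_assoc, e, (semiconj_palindrome hh (by omega) (by omega)).eq]

theorem semiconj_list_prod {R : Type*} [Monoid R] {h : R} {ι : Type*} (s : List ι) (x y : ι → R)
    (hxy : ∀ j ∈ s, SemiconjBy h (x j) (y j)) :
    SemiconjBy h (s.map x).prod (s.map y).prod := by
  induction s with
  | nil => simp
  | cons a s ih =>
    simp only [List.map_cons, List.prod_cons]
    exact (hxy a (by simp)).mul_right (ih fun j hj => hxy j (by simp [hj]))

theorem semiconj_rowProjector {h : HeckeAlgebra n q}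
    (hh : ∀ i, 1 ≤ i → i + 1 < n → h * g n q i = g n q (i + 1) * h) {i m : ℕ} (hi : 1 ≤ i)
    (him : i + m ≤ n) : SemiconjBy h (rowProjector n q i m) (rowProjector n q (i + 1) m) := by
  refine semiconj_list_prod _ _ _ fun j hj => ?_
  have hj := List.mem_range'_1.1 hj
  have := (semiconj_murphy hh hi (j := j) (by omega)).add_right (SemiconjBy.one_right h)
  exact this.smul_right _

theorem semiconj_colProjector {h : HeckeAlgebra n q}
    (hh : ∀ i, 1 ≤ i → i + 1 < n → h * g n q i = g n q (i + 1) * h) {i m : ℕ} (hi : 1 ≤ i)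
    (him : i + m ≤ n) : SemiconjBy h (colProjector n q i m) (colProjector n q (i + 1) m) := by
  refine semiconj_list_prod _ _ _ fun j hj => ?_
  have hj := List.mem_range'_1.1 hj
  have h2 : SemiconjBy h (algebraMap ℂ (HeckeAlgebra n q) q) (algebraMap ℂ _ (q : ℂ)) :=
    (Algebra.commutes _ h).symm
  exact ((semiconj_murphy hh hi (j := j) (by omega)).sub_right h2).smul_right _

/-- A quotient of the Hecke algebra kills all shifts of an element as soon as it kills the first. -/
theorem map_shift_eq_zero {A : Type*} [Ring A] [Algebra ℂ A] (π : HeckeAlgebra n q →ₐ[ℂ] A)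
    (hq : 0 < q) {x : ℕ → HeckeAlgebra n q} {m : ℕ}
    (hx : ∀ h : HeckeAlgebra n q,
      (∀ i, 1 ≤ i → i + 1 < n → h * g n q i = g n q (i + 1) * h) →
      ∀ i, 1 ≤ i → i < m → SemiconjBy h (x i) (x (i + 1)))
    (h1 : π (x 1) = 0) : ∀ i ∈ Finset.Icc 1 m, π (x i) = 0 := by
  obtain ⟨h, hu, hh⟩ := exists_unit_conj (n := n) hq
  intro i hi
  obtain ⟨hi1, him⟩ := Finset.mem_Icc.1 hi
  clear hi
  induction i, hi1 using Nat.le_induction with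
  | base => exact h1
  | succ i hi ih =>
    have e := congrArg π (hx h hh i hi (by omega)).eq
    rw [map_mul, map_mul, ih (by omega), mul_zero] at e
    exact (hu.map π).mul_left_eq_zero.1 e.symm

end HeckeAlgebra

/-! ### Adding and removing boxes of Young diagrams. -/

namespace YoungDiagram

/-- The content (column index minus row index) of a box. -/
def boxContent (b : ℕ × ℕ) : ℤ := (b.2 : ℤ) - (b.1 : ℤ)

/-- The diagram `μ` arises from `lam` by adding the box `b`. -/
structure Adds (lam : YoungDiagram) (b : ℕ × ℕ) (μ : YoungDiagram) : Prop where
  notMem : b ∉ lam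
  mem_iff : ∀ c, c ∈ μ ↔ c = b ∨ c ∈ lam

theorem ext_mem {lam μ : YoungDiagram} (h : ∀ c, c ∈ lam ↔ c ∈ μ) : lam = μ := SetLike.ext h

theorem exists_adds_of_mem {lam : YoungDiagram} {b : ℕ × ℕ} (hb : b ∉ lam)
    (h1 : ∀ i, i + 1 = b.1 → (i, b.2) ∈ lam) (h2 : ∀ j, j + 1 = b.2 → (b.1, j) ∈ lam) :
    ∃ μ, Adds lam b μ := by
  refine ⟨⟨insert b lam.cells, ?_⟩, hb, fun c => by
    rw [mem_mk, Finset.mem_insert, mem_cells]⟩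
  rintro ⟨x, y⟩ ⟨x', y'⟩ hle hx
  obtain ⟨hx', hy'⟩ : x' ≤ x ∧ y' ≤ y := hle
  simp only [Finset.coe_insert, Set.mem_insert_iff, Finset.mem_coe, mem_cells] at hx ⊢
  rcases hx with rfl | hx
  · by_cases h3 : x' = x
    · by_cases h4 : y' = y
      · left; rw [h3, h4]
      · right
        exact lam.up_left_mem hx' (show y' ≤ y - 1 by omega)
          (h2 (y - 1) (show y - 1 + 1 = y by omega))
    · right
      exact lam.up_left_mem (show x' ≤ x - 1 by omega) hy'
        (h1 (x - 1) (show x - 1 + 1 = x by omega))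
  · exact Or.inr (lam.up_left_mem hx' hy' hx)

theorem exists_adds_of_notMem {μ : YoungDiagram} {b : ℕ × ℕ} (hb : b ∈ μ)
    (h1 : (b.1 + 1, b.2) ∉ μ) (h2 : (b.1, b.2 + 1) ∉ μ) : ∃ lam, Adds lam b μ := by
  have hlow : IsLowerSet (↑(μ.cells.erase b) : Set (ℕ × ℕ)) := by
    rintro ⟨x, y⟩ ⟨x', y'⟩ hle hx
    obtain ⟨hx', hy'⟩ : x' ≤ x ∧ y' ≤ y := hle
    simp only [Finset.coe_erase, Set.mem_sdiff, Finset.mem_coe, mem_cells,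
      Set.mem_singleton_iff] at hx ⊢
    refine ⟨μ.up_left_mem hx' hy' hx.1, ?_⟩
    rintro rfl
    by_cases h : x' = x
    · subst h
      exact h2 (μ.up_left_mem le_rfl (show y' + 1 ≤ y by
        rcases hy'.eq_or_lt with h | h
        · exact absurd (by rw [h]) hx.2
        · exact h) hx.1)
    · exact h1 (μ.up_left_mem (show x' + 1 ≤ x by omega) hy' hx.1)
  refine ⟨⟨μ.cells.erase b, hlow⟩, ?_, fun c => ?_⟩
  · rw [mem_mk]; simp
  · change c ∈ μ ↔ c = b ∨ c ∈ μ.cells.erase b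
    rw [Finset.mem_erase, mem_cells]
    by_cases h : c = b
    · simp [h, hb]
    · simp [h]

namespace Adds

variable {lam μ ν ν' : YoungDiagram} {b b' : ℕ × ℕ}

theorem mem (h : Adds lam b μ) : b ∈ μ := (h.mem_iff b).2 (Or.inl rfl)

theorem le (h : Adds lam b μ) : lam ≤ μ := fun c hc => (h.mem_iff c).2 (Or.inr hc)

theorem cells_eq (h : Adds lam b μ) : μ.cells = insert b lam.cells := by
  ext c; rw [Finset.mem_insert, mem_cells, mem_cells, h.mem_iff]

theorem card_eq (h : Adds lam b μ) : μ.card = lam.card + 1 := by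
  rw [YoungDiagram.card, h.cells_eq, Finset.card_insert_of_notMem (by simpa using h.notMem)]

theorem mem_of_le (h : Adds lam b μ) {x y : ℕ} (hx : x ≤ b.1) (hy : y ≤ b.2)
    (hne : x < b.1 ∨ y < b.2) : (x, y) ∈ lam := by
  have : (x, y) ∈ μ := μ.up_left_mem hx hy h.mem
  rcases (h.mem_iff _).1 this with rfl | h
  · simp at hne
  · exact h

theorem box_unique (h : Adds lam b μ) (h' : Adds lam b' μ) : b = b' :=
  ((h'.mem_iff b).1 h.mem).resolve_right h.notMem

theorem top_unique (h : Adds lam b μ) (h' : Adds lam b ν) : μ = ν :=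
  ext_mem fun c => by rw [h.mem_iff, h'.mem_iff]

theorem bot_unique (h : Adds lam b μ) (h' : Adds ν b μ) : lam = ν := by
  refine ext_mem fun c => ?_
  have h1 := h.mem_iff c
  rw [h'.mem_iff c] at h1
  have h2 := h.notMem
  have h3 := h'.notMem
  by_cases hc : c = b
  · subst hc; simp [h2, h3]
  · simpa [hc] using h1.symm

/-- Distinct addable boxes of a diagram have contents that differ by at least two. -/
theorem content_far (h : Adds lam b μ) (h' : Adds lam b' ν) (hne : b ≠ b') :
    boxContent b' - boxContent b ≠ 0 ∧ boxContent b' - boxContent b ≠ 1 ∧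
      boxContent b' - boxContent b ≠ -1 := by
  obtain ⟨r, s⟩ := b
  obtain ⟨r', s'⟩ := b'
  -- Two distinct addable boxes are incomparable, since the smaller would already belong to the
  -- diagram; so one lies strictly below and strictly left of the other.
  have k1 : ¬ (r ≤ r' ∧ s ≤ s') := fun hc => by
    refine h.notMem (h'.mem_of_le hc.1 hc.2 ?_)
    simp only [ne_eq, Prod.mk.injEq] at hne
    show r < r' ∨ s < s'
    omega
  have k2 : ¬ (r' ≤ r ∧ s' ≤ s) := fun hc => by
    refine h'.notMem (h.mem_of_le hc.1 hc.2 ?_)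
    simp only [ne_eq, Prod.mk.injEq] at hne
    show r' < r ∨ s' < s
    omega
  simp only [boxContent]
  omega

/-- The upper half of the diamond property of Young's lattice; `inf` is the lower half. They supply
the alternative orders in which two boxes can be added. -/
theorem sup (h : Adds lam b μ) (h' : Adds lam b' ν) (hne : b ≠ b') :
    Adds μ b' (μ ⊔ ν) ∧ Adds ν b (μ ⊔ ν) := by
  refine ⟨⟨?_, ?_⟩, ⟨?_, ?_⟩⟩
  · rw [h.mem_iff]; exact fun hc => hc.elim (fun e => hne e.symm) h'.notMem
  · intro c; rw [mem_sup, h.mem_iff, h'.mem_iff]; tauto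
  · rw [h'.mem_iff]; exact fun hc => hc.elim hne h.notMem
  · intro c; rw [mem_sup, h.mem_iff, h'.mem_iff]; tauto

theorem inf (h : Adds ν b μ) (h' : Adds ν' b' μ) (hne : b ≠ b') :
    Adds (ν ⊓ ν') b' ν ∧ Adds (ν ⊓ ν') b ν' := by
  have k1 : b' ∈ ν := ((h.mem_iff _).1 h'.mem).resolve_left (Ne.symm hne)
  have k2 : b ∈ ν' := ((h'.mem_iff _).1 h.mem).resolve_left hne
  refine ⟨⟨?_, ?_⟩, ⟨?_, ?_⟩⟩
  · rw [mem_inf]; exact fun hc => h'.notMem hc.2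
  · intro c
    have e1 := h.mem_iff c
    have e2 := h'.mem_iff c
    rw [mem_inf]
    constructor
    · intro hc
      by_cases hcb : c = b'
      · exact Or.inl hcb
      · exact Or.inr ⟨hc, (e2.1 (e1.2 (Or.inr hc))).resolve_left hcb⟩
    · rintro (rfl | hc)
      · exact k1
      · exact hc.1
  · rw [mem_inf]; exact fun hc => h.notMem hc.1
  · intro c
    have e1 := h.mem_iff c
    have e2 := h'.mem_iff c
    rw [mem_inf]
    constructor
    · intro hc
      by_cases hcb : c = b
      · exact Or.inl hcb
      · exact Or.inr ⟨(e1.1 (e2.2 (Or.inr hc))).resolve_left hcb, hc⟩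
    · rintro (rfl | hc)
      · exact k2
      · exact hc.2

/-- Two boxes added in succession may be added in the other order, unless they are adjacent. -/
theorem swap_or_adjacent (h : Adds lam b ν) (h' : Adds ν b' μ) :
    (∃ ν', Adds lam b' ν' ∧ Adds ν' b μ) ∨ boxContent b' - boxContent b = 1 ∨
      boxContent b' - boxContent b = -1 := by
  by_cases k1 : ∃ i, i + 1 = b'.1 ∧ (i, b'.2) = b
  · obtain ⟨i, hi, rfl⟩ := k1
    right; right; simp only [boxContent]; omega
  by_cases k2 : ∃ j, j + 1 = b'.2 ∧ (b'.1, j) = b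
  · obtain ⟨j, hj, rfl⟩ := k2
    right; left; simp only [boxContent]; omega
  left
  push Not at k1 k2
  have hb' : b' ∉ lam := fun hc => h'.notMem (h.le hc)
  obtain ⟨ν', hν'⟩ := exists_adds_of_mem hb'
    (fun i hi => ((h.mem_iff _).1 (h'.mem_of_le (x := i) (y := b'.2) (by omega) le_rfl
      (by omega))).resolve_left (k1 i hi))
    (fun j hj => ((h.mem_iff _).1 (h'.mem_of_le (x := b'.1) (y := j) le_rfl (by omega)
      (by omega))).resolve_left (k2 j hj))
  refine ⟨ν', hν', ?_⟩
  have hne : b ≠ b' := fun e => h'.notMem (e ▸ h.mem)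
  have := (h.sup hν' hne)
  rw [this.1.top_unique h'] at this
  exact this.2

/-- The candidate is the box right of `b`. If it is not addable to `μ`, the box above it is missing,
and then the box directly above `b`, of the same content as the candidate, is a removable corner of
`lam`. The next lemma is the transposed statement. -/
theorem exists_content_add_one (h : Adds lam b μ) :
    (∃ b' ν, Adds μ b' ν ∧ boxContent b' = boxContent b + 1) ∨
      ∃ b' ν, Adds ν b' lam ∧ boxContent b' = boxContent b + 1 := by
  obtain ⟨r, s⟩ := b
  have hn : (r, s + 1) ∉ μ := fun hc => by
    rcases (h.mem_iff _).1 hc with e | e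
    · simp at e
    · exact h.notMem (lam.up_left_mem le_rfl (by omega) e)
  by_cases k : ∀ i, i + 1 = r → (i, s + 1) ∈ μ
  · left
    obtain ⟨ν, hν⟩ := exists_adds_of_mem (b := (r, s + 1)) hn k (fun j hj => by
      obtain rfl : j = s := by simpa using hj
      exact h.mem)
    exact ⟨_, ν, hν, by simp only [boxContent]; omega⟩
  · right
    push Not at k
    obtain ⟨i, rfl, hi⟩ := k
    obtain ⟨ν, hν⟩ := exists_adds_of_notMem (b := (i, s)) (μ := lam)
      (h.mem_of_le (show i ≤ i + 1 by omega) le_rfl (Or.inl (show i < i + 1 by omega))) h.notMem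
      (fun hc => hi (h.le hc))
    exact ⟨_, ν, hν, by simp only [boxContent]; omega⟩

theorem exists_content_sub_one (h : Adds lam b μ) :
    (∃ b' ν, Adds μ b' ν ∧ boxContent b' = boxContent b - 1) ∨
      ∃ b' ν, Adds ν b' lam ∧ boxContent b' = boxContent b - 1 := by
  obtain ⟨r, s⟩ := b
  have hn : (r + 1, s) ∉ μ := fun hc => by
    rcases (h.mem_iff _).1 hc with e | e
    · simp at e
    · exact h.notMem (lam.up_left_mem (by omega) le_rfl e)
  by_cases k : ∀ i, i + 1 = s → (r + 1, i) ∈ μ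
  · left
    obtain ⟨ν, hν⟩ := exists_adds_of_mem (b := (r + 1, s)) hn (fun j hj => by
      obtain rfl : j = r := by simpa using hj
      exact h.mem) k
    exact ⟨_, ν, hν, by simp only [boxContent]; omega⟩
  · right
    push Not at k
    obtain ⟨i, rfl, hi⟩ := k
    obtain ⟨ν, hν⟩ := exists_adds_of_notMem (b := (r, i)) (μ := lam)
      (h.mem_of_le le_rfl (show i ≤ i + 1 by omega) (Or.inr (show i < i + 1 by omega)))
      (fun hc => hi (h.le hc)) h.notMem
    exact ⟨_, ν, hν, by simp only [boxContent]; omega⟩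

end Adds

theorem exists_adds_of_card {lam μ : YoungDiagram} (h : lam ≤ μ) (hc : μ.card = lam.card + 1) :
    ∃ b, Adds lam b μ := by
  have h1 : (μ.cells \ lam.cells).card = 1 := by
    rw [Finset.card_sdiff_of_subset (cells_subset_iff.2 h)]
    change μ.card - lam.card = 1
    omega
  obtain ⟨b, hb⟩ := Finset.card_eq_one.1 h1
  have h2 : ∀ c, c ∈ μ ∧ c ∉ lam ↔ c = b := fun c => by
    have := congrArg (c ∈ ·) hb
    simpa using this
  refine ⟨b, ((h2 b).2 rfl).2, fun c => ?_⟩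
  by_cases hl : c ∈ lam
  · simp [hl, h hl]
  · simp [hl, ← h2 c]

/-- Above a proper subdiagram one can remove a corner. -/
theorem exists_adds_of_lt {lam μ : YoungDiagram} (h : lam < μ) :
    ∃ ν b, Adds ν b μ ∧ lam ≤ ν := by
  have hne : (μ.cells \ lam.cells).Nonempty := by
    rw [Finset.sdiff_nonempty, cells_subset_iff]; exact h.not_ge
  -- A box outside `lam` with maximal row plus column index has no box of `μ` below it or to its
  -- right.
  obtain ⟨b, hb, hmax⟩ := Finset.exists_max_image _ (fun c : ℕ × ℕ => c.1 + c.2) hne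
  simp only [Finset.mem_sdiff, mem_cells] at hb hmax
  have hout : ∀ x y, b.1 ≤ x → b.2 ≤ y → b.1 + b.2 < x + y → (x, y) ∉ μ := by
    intro x y hx hy hlt hc
    have := hmax (x, y) ⟨hc, fun hc' => hb.2 (lam.up_left_mem hx hy hc')⟩
    simp only at this; omega
  obtain ⟨ν, hν⟩ := exists_adds_of_notMem hb.1 (hout _ _ (by omega) le_rfl (by omega))
    (hout _ _ le_rfl (by omega) (by omega))
  refine ⟨ν, b, hν, fun c hc => ?_⟩
  rcases (hν.mem_iff c).1 (h.le hc) with rfl | h'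
  · exact absurd hc hb.2
  · exact h'

theorem adds_bot_iff {b : ℕ × ℕ} {μ : YoungDiagram} (h : Adds ⊥ b μ) : b = (0, 0) := by
  by_contra hne
  have : (0, 0) ∈ (⊥ : YoungDiagram) := h.mem_of_le (by omega) (by omega) (by
    by_contra hc
    exact hne (Prod.ext (by omega) (by omega)))
  exact notMem_bot _ this

theorem exists_adds_bot : ∃ μ, Adds ⊥ (0, 0) μ :=
  exists_adds_of_mem (notMem_bot _) (by simp) (by simp)

theorem card_eq_zero_iff {μ : YoungDiagram} : μ.card = 0 ↔ μ = ⊥ := by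
  constructor
  · intro h
    refine ext_mem fun c => ?_
    rw [YoungDiagram.card, Finset.card_eq_zero] at h
    rw [← mem_cells, h]; simp
  · rintro rfl; simp [YoungDiagram.card]

/-- A diagram without the box `(1, 0)` is a single row, so the only possible counterexample on the
right is the row of `l + 1` boxes. The right side is what a box projector detects. -/
theorem rowLen_zero_le_iff {μ : YoungDiagram} {l : ℕ} :
    μ.rowLen 0 ≤ l ↔ ∀ lam ≤ μ, lam.card = l + 1 → (1, 0) ∈ lam := by
  constructor
  · intro h lam hle hc
    by_contra hn
    have hrow : lam.cells = lam.row 0 := by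
      ext ⟨x, y⟩
      rw [mem_row_iff, mem_cells]
      refine ⟨fun hx => ⟨hx, ?_⟩, And.left⟩
      by_contra hx0
      exact hn (lam.up_left_mem (Nat.one_le_iff_ne_zero.2 hx0) (Nat.zero_le _) hx)
    rw [YoungDiagram.card, hrow, ← rowLen_eq_card] at hc
    have : (0, l) ∈ μ := hle (mem_iff_lt_rowLen.2 (by omega))
    rw [mem_iff_lt_rowLen] at this
    omega
  · intro h
    by_contra hl
    have hlow : IsLowerSet (↑({0} ×ˢ Finset.range (l + 1)) : Set (ℕ × ℕ)) := by
      rintro ⟨x, y⟩ ⟨x', y'⟩ hle hx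
      obtain ⟨hx', hy'⟩ : x' ≤ x ∧ y' ≤ y := hle
      simp only [Finset.mem_coe, Finset.mem_product, Finset.mem_singleton,
        Finset.mem_range] at hx ⊢
      omega
    have := h ⟨{0} ×ˢ Finset.range (l + 1), hlow⟩ (fun c hc => by
      obtain ⟨x, y⟩ := c
      have hc : (x, y) ∈ ({0} ×ˢ Finset.range (l + 1) : Finset (ℕ × ℕ)) := hc
      simp only [Finset.mem_product, Finset.mem_singleton, Finset.mem_range] at hc
      obtain ⟨rfl, hy⟩ := hc
      exact mem_iff_lt_rowLen.2 (by omega)) (by simp [YoungDiagram.card])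
    rw [mem_mk] at this
    simp at this

theorem card_transpose (μ : YoungDiagram) : μ.transpose.card = μ.card := by
  simp [YoungDiagram.card, transpose]

theorem colLen_zero_le_iff {μ : YoungDiagram} {l : ℕ} :
    μ.colLen 0 ≤ l ↔ ∀ lam ≤ μ, lam.card = l + 1 → (0, 1) ∈ lam := by
  rw [← rowLen_transpose, rowLen_zero_le_iff]
  constructor
  · intro h lam hle hc
    have := h lam.transpose (YoungDiagram.transpose_mono hle) (by rw [card_transpose, hc])
    simpa using this
  · intro h lam hle hc
    have := h lam.transpose (by
      rw [← transpose_le_iff, transpose_transpose]; exact hle)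
      (by rw [card_transpose, hc])
    simpa using this

/-! ### Standard chains, their contents and the swaps connecting them. -/

/-- A chain of diagrams starting at the empty one in which the first `m` steps add a box. The
diagrams beyond the `m`-th one are unrestricted. -/
structure IsStandardChain (m : ℕ) (Γ : ℕ → YoungDiagram) : Prop where
  zero : Γ 0 = ⊥
  adds : ∀ p < m, ∃ b, Adds (Γ p) b (Γ (p + 1))

/-- The content of the box added in the step from `Γ k` to `Γ (k + 1)`. -/
def stepContent (Γ : ℕ → YoungDiagram) (k : ℕ) : ℤ :=
  ∑ c ∈ (Γ (k + 1)).cells \ (Γ k).cells, ((c.2 : ℤ) - (c.1 : ℤ))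

theorem stepContent_eq {Γ : ℕ → YoungDiagram} {k : ℕ} {b : ℕ × ℕ}
    (h : Adds (Γ k) b (Γ (k + 1))) : stepContent Γ k = boxContent b := by
  have : (Γ (k + 1)).cells \ (Γ k).cells = {b} := by
    ext c
    have := h.notMem
    simp only [Finset.mem_sdiff, mem_cells, h.mem_iff, Finset.mem_singleton]
    constructor
    · tauto
    · rintro rfl; tauto
  rw [stepContent, this, Finset.sum_singleton, boxContent]

theorem stepContent_congr {Γ Γ' : ℕ → YoungDiagram} {k : ℕ} (h1 : Γ k = Γ' k)
    (h2 : Γ (k + 1) = Γ' (k + 1)) : stepContent Γ k = stepContent Γ' k := by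
  rw [stepContent, stepContent, h1, h2]

/-- The chains `Γ` and `Γ'` differ at the place `k + 1` and nowhere else. -/
def IsSwap (k : ℕ) (Γ Γ' : ℕ → YoungDiagram) : Prop :=
  Γ' (k + 1) ≠ Γ (k + 1) ∧ ∀ p, p ≠ k + 1 → Γ' p = Γ p

theorem IsSwap.symm {k : ℕ} {Γ Γ' : ℕ → YoungDiagram} (h : IsSwap k Γ Γ') : IsSwap k Γ' Γ :=
  ⟨h.1.symm, fun p hp => (h.2 p hp).symm⟩

theorem isSwap_update {k : ℕ} {Γ : ℕ → YoungDiagram} {ν : YoungDiagram} (h : ν ≠ Γ (k + 1)) :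
    IsSwap k Γ (Function.update Γ (k + 1) ν) :=
  ⟨by simpa using h, fun p hp => by simp [hp]⟩

namespace IsStandardChain

variable {m : ℕ} {Γ Γ' : ℕ → YoungDiagram}

theorem mono {m' : ℕ} (h : IsStandardChain m Γ) (hm : m' ≤ m) : IsStandardChain m' Γ :=
  ⟨h.zero, fun p hp => h.adds p (by omega)⟩

theorem succ {b : ℕ × ℕ} (h : IsStandardChain m Γ) (hb : Adds (Γ m) b (Γ (m + 1))) :
    IsStandardChain (m + 1) Γ :=
  ⟨h.zero, fun p hp => by
    rcases (show p < m ∨ p = m by omega) with h' | rfl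
    · exact h.adds p h'
    · exact ⟨b, hb⟩⟩

theorem card_eq (h : IsStandardChain m Γ) {p : ℕ} (hp : p ≤ m) : (Γ p).card = p := by
  induction p with
  | zero => rw [h.zero]; exact card_eq_zero_iff.2 rfl
  | succ p ih =>
    obtain ⟨b, hb⟩ := h.adds p (by omega)
    rw [hb.card_eq, ih (by omega)]

theorem le (h : IsStandardChain m Γ) {p p' : ℕ} (hp : p ≤ p') (hp' : p' ≤ m) : Γ p ≤ Γ p' := by
  induction p', hp using Nat.le_induction with
  | base => exact le_rfl
  | succ p' hpp ih =>
    obtain ⟨b, hb⟩ := h.adds p' (by omega)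
    exact (ih (by omega)).trans hb.le

theorem stepContent_zero (h : IsStandardChain m Γ) (hm : 0 < m) : stepContent Γ 0 = 0 := by
  obtain ⟨b, hb⟩ := h.adds 0 hm
  rw [stepContent_eq hb]
  rw [h.zero] at hb
  rw [adds_bot_iff hb]; simp [boxContent]

/-- The boxes involved in a swap. -/
theorem swap_boxes (h : IsStandardChain m Γ) (h' : IsStandardChain m Γ') {k : ℕ} (hk : k + 1 < m)
    (hs : IsSwap k Γ Γ') : ∃ b b', b ≠ b' ∧ Adds (Γ k) b (Γ (k + 1)) ∧
      Adds (Γ (k + 1)) b' (Γ (k + 2)) ∧ Adds (Γ k) b' (Γ' (k + 1)) ∧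
      Adds (Γ' (k + 1)) b (Γ (k + 2)) := by
  obtain ⟨b, hb⟩ := h.adds k (by omega)
  obtain ⟨b', hb'⟩ := h.adds (k + 1) hk
  obtain ⟨x, hx⟩ := h'.adds k (by omega)
  obtain ⟨y, hy⟩ := h'.adds (k + 1) hk
  rw [hs.2 k (by omega)] at hx
  rw [hs.2 (k + 1 + 1) (by omega)] at hy
  have hxb : x ≠ b := by
    rintro rfl
    exact hs.1 (hx.top_unique hb)
  have hx' : x = b' := by
    rcases (hb'.mem_iff x).1 (hy.le hx.mem) with e | e
    · exact e
    · exact absurd e fun e => ((hb.mem_iff x).1 e).elim hxb hx.notMem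
  subst hx'
  have hyb : y = b := by
    rcases (hb'.mem_iff y).1 hy.mem with e | e
    · exact absurd hx.mem (e ▸ hy.notMem)
    · exact ((hb.mem_iff y).1 e).resolve_right fun e => hy.notMem (hx.le e)
  subst hyb
  exact ⟨y, x, hxb.symm, hb, hb', hx, hy⟩

theorem swap_contents (h : IsStandardChain m Γ) (h' : IsStandardChain m Γ') {k : ℕ}
    (hk : k + 1 < m) (hs : IsSwap k Γ Γ') :
    stepContent Γ' k = stepContent Γ (k + 1) ∧ stepContent Γ' (k + 1) = stepContent Γ k ∧
      stepContent Γ (k + 1) - stepContent Γ k ≠ 0 ∧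
      stepContent Γ (k + 1) - stepContent Γ k ≠ 1 ∧
      stepContent Γ (k + 1) - stepContent Γ k ≠ -1 := by
  obtain ⟨b, b', hne, h1, h2, h3, h4⟩ := h.swap_boxes h' hk hs
  have e1 : stepContent Γ' k = boxContent b' :=
    stepContent_eq (by rwa [hs.2 k (by omega)])
  have e2 : stepContent Γ' (k + 1) = boxContent b :=
    stepContent_eq (by rwa [hs.2 (k + 1 + 1) (by omega)])
  rw [e1, e2, stepContent_eq h1, stepContent_eq h2]
  exact ⟨rfl, rfl, h1.content_far h3 hne⟩

theorem swap_stepContent {k j : ℕ} (hs : IsSwap k Γ Γ') (h1 : j ≠ k) (h2 : j ≠ k + 1) :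
    stepContent Γ' j = stepContent Γ j :=
  stepContent_congr (hs.2 j h2) (hs.2 (j + 1) (by omega))

theorem eq_of_isSwap (h : IsStandardChain m Γ) (h' : IsStandardChain m Γ')
    {Γ'' : ℕ → YoungDiagram} (h'' : IsStandardChain m Γ'') {k : ℕ} (hk : k + 1 < m)
    (hs : IsSwap k Γ Γ') (hs' : IsSwap k Γ Γ'') : Γ' = Γ'' := by
  obtain ⟨b, b', hne, h1, h2, h3, h4⟩ := h.swap_boxes h' hk hs
  obtain ⟨c, c', hne', k1, k2, k3, k4⟩ := h.swap_boxes h'' hk hs'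
  funext p
  by_cases hp : p = k + 1
  · subst hp
    rw [h2.box_unique k2] at h3
    exact h3.top_unique k3
  · rw [hs.2 p hp, hs'.2 p hp]

/-- If no swap is possible, the two boxes are adjacent. -/
theorem exists_isSwap_or_adjacent (h : IsStandardChain m Γ) {k : ℕ} (hk : k + 1 < m) :
    (∃ Γ', IsStandardChain m Γ' ∧ IsSwap k Γ Γ') ∨
      stepContent Γ (k + 1) - stepContent Γ k = 1 ∨
      stepContent Γ (k + 1) - stepContent Γ k = -1 := by
  obtain ⟨b, hb⟩ := h.adds k (by omega)
  obtain ⟨b', hb'⟩ := h.adds (k + 1) hk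
  rw [stepContent_eq hb, stepContent_eq hb']
  refine (hb.swap_or_adjacent hb').imp_left fun ⟨ν, h1, h2⟩ => ?_
  have hne : ν ≠ Γ (k + 1) := by
    rintro rfl
    exact hb'.notMem h1.mem
  refine ⟨_, ⟨?_, fun p hp => ?_⟩, isSwap_update hne⟩
  · simpa using h.zero
  · by_cases e1 : p = k
    · subst e1; exact ⟨b', by simpa using h1⟩
    by_cases e2 : p = k + 1
    · subst e2; exact ⟨b, by simpa using h2⟩
    simpa [e1, e2] using h.adds p hp

theorem congr (h : IsStandardChain m Γ) {m' : ℕ} (h' : IsStandardChain m' Γ')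
    (he : ∀ p, m' ≤ p → p ≤ m → Γ' p = Γ p) : IsStandardChain m Γ' := by
  refine ⟨h'.zero, fun p hp => ?_⟩
  by_cases hpm : p < m'
  · exact h'.adds p hpm
  · rw [he p (by omega) (by omega), he (p + 1) (by omega) (by omega)]
    exact h.adds p hp

end IsStandardChain

/-- A diagram `μ` is reached by a standard chain through any given subdiagram and with any given
tail. -/
theorem exists_isStandardChain {lam μ : YoungDiagram} (hle : lam ≤ μ) (t : ℕ → YoungDiagram)
    (ht : t μ.card = μ) :
    ∃ Γ, IsStandardChain μ.card Γ ∧ Γ lam.card = lam ∧ ∀ p, μ.card ≤ p → Γ p = t p := by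
  obtain ⟨N, hN⟩ : ∃ N, μ.card = N := ⟨_, rfl⟩
  induction N generalizing lam μ t with
  | zero =>
    have hμ := card_eq_zero_iff.1 hN
    have hl : lam = ⊥ := le_bot_iff.1 (hμ ▸ hle)
    have hl0 : lam.card = 0 := card_eq_zero_iff.2 hl
    refine ⟨t, ⟨?_, fun p hp => by omega⟩, ?_, fun _ _ => rfl⟩
    · rw [← hN, ht, hμ]
    · rw [hl0, ← hN, ht, hμ, hl]
  | succ N ih =>
    have key : ∀ lam < μ, ∃ Γ, IsStandardChain μ.card Γ ∧ Γ lam.card = lam ∧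
        ∀ p, μ.card ≤ p → Γ p = t p := by
      intro lam hlt
      obtain ⟨ν, b, hb, hlν⟩ := exists_adds_of_lt hlt
      have hc := hb.card_eq
      obtain ⟨Γ, h1, h2, h3⟩ := ih hlν (Function.update t ν.card ν) (by simp) (by omega)
      have e1 : Γ ν.card = ν := by rw [h3 _ le_rfl]; simp
      have e2 : ∀ p, μ.card ≤ p → Γ p = t p := fun p hp => by
        rw [h3 p (by omega)]; simp [show p ≠ ν.card by omega]
      refine ⟨Γ, ?_, h2, e2⟩
      rw [hc]
      refine h1.succ (b := b) ?_
      rwa [e1, ← hc, e2 _ le_rfl, ht]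
    rcases hle.lt_or_eq with hlt | rfl
    · exact key lam hlt
    -- For `lam = μ` no corner can be removed above `lam`; any chain to `μ` serves, so one starting
    -- from `⊥` is taken.
    · obtain ⟨Γ, h1, -, h3⟩ := key ⊥ (bot_lt_iff_ne_bot.2 fun h => by
        rw [card_eq_zero_iff.2 h] at hN; omega)
      exact ⟨Γ, h1, by rw [h3 _ le_rfl, ht], h3⟩

/-- Standard chains with the same end are connected by swaps. -/
theorem IsStandardChain.induction_swap {m : ℕ} {p : (ℕ → YoungDiagram) → Prop}
    (hp : ∀ k Γ Γ', k + 1 < m → IsStandardChain m Γ → IsStandardChain m Γ' → IsSwap k Γ Γ' →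
      p Γ → p Γ') {Γ₀ Γ : ℕ → YoungDiagram} (h₀ : IsStandardChain m Γ₀) (h : IsStandardChain m Γ)
    (ht : ∀ j, m ≤ j → Γ j = Γ₀ j) (hp₀ : p Γ₀) : p Γ := by
  induction m generalizing p Γ₀ Γ with
  | zero =>
    rwa [show Γ = Γ₀ from funext fun j => ht j (Nat.zero_le _)]
  | succ m ih =>
    have key : ∀ {Γ₁ Γ₂ : ℕ → YoungDiagram}, IsStandardChain (m + 1) Γ₁ →
        IsStandardChain (m + 1) Γ₂ → (∀ j, m ≤ j → Γ₂ j = Γ₁ j) → p Γ₁ → p Γ₂ := by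
      intro Γ₁ Γ₂ h₁ h₂ hj hp₁
      -- The predicate carries standardness up to `m + 1` along, since the induction hypothesis only
      -- sees the first `m` steps.
      refine (ih (p := fun Δ => IsStandardChain (m + 1) Δ ∧ p Δ) ?_ (h₁.mono (by omega))
        (h₂.mono (by omega)) hj ⟨h₁, hp₁⟩).2
      rintro k Δ Δ' hk hΔ hΔ' hs ⟨hΔ1, hpΔ⟩
      have hΔ'1 : IsStandardChain (m + 1) Δ' :=
        hΔ1.congr hΔ' fun j hj _ => hs.2 j (by omega)
      exact ⟨hΔ'1, hp k Δ Δ' (by omega) hΔ1 hΔ'1 hs hpΔ⟩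
    by_cases hm : Γ m = Γ₀ m
    · refine key h₀ h (fun j hj => ?_) hp₀
      rcases (show j = m ∨ m + 1 ≤ j by omega) with rfl | h'
      · exact hm
      · exact ht j h'
    obtain ⟨b, hb⟩ := h₀.adds m (by omega)
    obtain ⟨b', hb'⟩ := h.adds m (by omega)
    rw [ht (m + 1) le_rfl] at hb'
    have hne : b ≠ b' := by
      rintro rfl
      exact hm (hb'.bot_unique hb)
    obtain ⟨k1, k2⟩ := hb.inf hb' hne
    -- If the chains differ at `m`, both are moved to chains through `κ`, which lies one box below
    -- either diagram; there a single swap exchanges the last two boxes.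
    set κ := Γ₀ m ⊓ Γ m with hκ
    have hcard : κ.card + 1 = m := by rw [← k1.card_eq, h₀.card_eq (by omega)]
    obtain ⟨Γ₁, c1, -, c3⟩ := exists_isStandardChain (bot_le : ⊥ ≤ κ)
      (Function.update Γ₀ κ.card κ) (by simp)
    have d1 : Γ₁ κ.card = κ := by rw [c3 _ le_rfl]; simp
    have d2 : ∀ j, m ≤ j → Γ₁ j = Γ₀ j := fun j hj => by
      rw [c3 j (by omega)]; simp [show j ≠ κ.card by omega]
    have hΓ₁ : IsStandardChain (m + 1) Γ₁ := by
      have : IsStandardChain (κ.card + 1) Γ₁ := c1.succ (b := b') (by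
        rw [d1, hcard, d2 m le_rfl]; exact k1)
      rw [hcard] at this
      exact this.succ (b := b) (by rw [d2 m le_rfl, d2 (m + 1) (by omega)]; exact hb)
    have hs : IsSwap κ.card Γ₁ (Function.update Γ₁ (κ.card + 1) (Γ m)) :=
      isSwap_update (by rw [hcard, d2 m le_rfl]; exact hm)
    have e1 : ∀ j, j ≠ m → Function.update Γ₁ (κ.card + 1) (Γ m) j = Γ₁ j := fun j hj => by
      rw [Function.update_of_ne (by omega)]
    have e2 : Function.update Γ₁ (κ.card + 1) (Γ m) m = Γ m := by
      rw [hcard, Function.update_self]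
    generalize Function.update Γ₁ (κ.card + 1) (Γ m) = Γ₂ at hs e1 e2
    have hΓ₂ : IsStandardChain (m + 1) Γ₂ := by
      have c2 : IsStandardChain κ.card Γ₂ := by
        refine ⟨by rw [e1 0 (by omega), c1.zero], fun j hj => ?_⟩
        rw [e1 j (by omega), e1 (j + 1) (by omega)]
        exact c1.adds j hj
      have : IsStandardChain (κ.card + 1) Γ₂ := c2.succ (b := b) (by
        rw [e1 _ (by omega), d1, hcard, e2]; exact k2)
      rw [hcard] at this
      exact this.succ (b := b') (by rw [e2, e1 (m + 1) (by omega), d2 (m + 1) (by omega)]; exact hb')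
    have hp1 : p Γ₁ := key h₀ hΓ₁ d2 hp₀
    have hp2 : p Γ₂ := hp _ _ _ (by omega) hΓ₁ hΓ₂ hs hp1
    refine key hΓ₂ h (fun j hj => ?_) hp2
    rcases (show j = m ∨ m + 1 ≤ j by omega) with rfl | h'
    · exact e2.symm
    · rw [ht j h', e1 j (by omega), d2 j (by omega)]

/-- A standard chain is determined by its contents and its tail. -/
theorem IsStandardChain.eq_of_stepContent {m : ℕ} {Γ Γ' : ℕ → YoungDiagram}
    (h : IsStandardChain m Γ) (h' : IsStandardChain m Γ')
    (hc : ∀ k < m, stepContent Γ k = stepContent Γ' k) : ∀ p ≤ m, Γ p = Γ' p := by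
  intro p hp
  induction p with
  | zero => rw [h.zero, h'.zero]
  | succ p ih =>
    have e := ih (by omega)
    obtain ⟨b, hb⟩ := h.adds p (by omega)
    obtain ⟨b', hb'⟩ := h'.adds p (by omega)
    have hcp := hc p (by omega)
    rw [stepContent_eq hb, stepContent_eq hb'] at hcp
    rw [← e] at hb'
    by_cases hbb : b = b'
    · subst hbb; exact hb.top_unique hb'
    · have := (hb.content_far hb' hbb).1
      omega

end YoungDiagram

/-! ### Transposition, and chains that stay in one row or one column. -/

namespace YoungDiagram

theorem Adds.transpose {lam μ : YoungDiagram} {b : ℕ × ℕ} (h : Adds lam b μ) :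
    Adds lam.transpose b.swap μ.transpose := by
  refine ⟨by simpa using h.notMem, fun c => ?_⟩
  rw [mem_transpose, mem_transpose, h.mem_iff, Prod.swap_eq_iff_eq_swap]

theorem boxContent_swap (b : ℕ × ℕ) : boxContent b.swap = -boxContent b := by
  simp only [boxContent, Prod.fst_swap, Prod.snd_swap]; ring

namespace IsStandardChain

variable {m l : ℕ} {Γ : ℕ → YoungDiagram}

theorem transpose (h : IsStandardChain m Γ) : IsStandardChain m fun p => (Γ p).transpose := by
  refine ⟨?_, fun p hp => ?_⟩
  · rw [h.zero]; exact ext_mem fun c => by simp [mem_transpose]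
  · obtain ⟨b, hb⟩ := h.adds p hp
    exact ⟨_, hb.transpose⟩

theorem stepContent_transpose (h : IsStandardChain m Γ) {k : ℕ} (hk : k < m) :
    stepContent (fun p => (Γ p).transpose) k = -stepContent Γ k := by
  obtain ⟨b, hb⟩ := h.adds k hk
  rw [stepContent_eq hb, stepContent_eq (Γ := fun p => (Γ p).transpose) hb.transpose,
    boxContent_swap]

/-- The step that adds `(1, 0)` is the one sought; it is not step `0`, which adds `(0, 0)`. -/
theorem exists_stepContent_eq_neg_one (h : IsStandardChain m Γ) (hl : l < m)
    (hz : (1, 0) ∈ Γ (l + 1)) : ∃ k, 1 ≤ k ∧ k ≤ l ∧ stepContent Γ k = -1 := by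
  induction l with
  | zero =>
    obtain ⟨b, hb⟩ := h.adds 0 hl
    rw [h.zero] at hb
    rcases (hb.mem_iff _).1 hz with e | e
    · rw [adds_bot_iff hb] at e; simp at e
    · exact absurd e (notMem_bot _)
  | succ l ih =>
    obtain ⟨b, hb⟩ := h.adds (l + 1) hl
    rcases (hb.mem_iff _).1 hz with e | e
    · exact ⟨l + 1, by omega, le_rfl, by rw [stepContent_eq hb, ← e]; simp [boxContent]⟩
    · obtain ⟨k, h1, h2, h3⟩ := ih (by omega) e
      exact ⟨k, h1, by omega, h3⟩

theorem stepContent_of_row (h : IsStandardChain m Γ) (hl : l < m) (hz : (1, 0) ∉ Γ (l + 1))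
    {k : ℕ} (hk : k ≤ l) : stepContent Γ k = k := by
  have hrow : ∀ p ≤ l + 1, ∀ x y, (x, y) ∈ Γ p → x = 0 := by
    intro p hp x y hxy
    by_contra hx
    exact hz (h.le hp (by omega) ((Γ p).up_left_mem (Nat.one_le_iff_ne_zero.2 hx) (Nat.zero_le _)
      hxy))
  obtain ⟨⟨r, s⟩, hb⟩ := h.adds k (by omega)
  obtain rfl : r = 0 := hrow (k + 1) (by omega) r s hb.mem
  have hcells : (Γ k).cells = {0} ×ˢ Finset.range s := by
    ext ⟨x, y⟩
    simp only [mem_cells, Finset.mem_product, Finset.mem_singleton, Finset.mem_range]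
    constructor
    · intro hxy
      obtain rfl := hrow k (by omega) x y hxy
      refine ⟨rfl, ?_⟩
      by_contra hy
      exact hb.notMem ((Γ k).up_left_mem le_rfl (by omega) hxy)
    · rintro ⟨rfl, hy⟩
      exact hb.mem_of_le le_rfl hy.le (Or.inr hy)
  have hcard := h.card_eq (p := k) (by omega)
  rw [YoungDiagram.card, hcells] at hcard
  simp only [Finset.card_product, Finset.card_singleton, one_mul, Finset.card_range] at hcard
  rw [stepContent_eq hb, boxContent, hcard]
  simp

theorem exists_stepContent_eq_one (h : IsStandardChain m Γ) (hl : l < m)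
    (hz : (0, 1) ∈ Γ (l + 1)) : ∃ k, 1 ≤ k ∧ k ≤ l ∧ stepContent Γ k = 1 := by
  obtain ⟨k, h1, h2, h3⟩ := h.transpose.exists_stepContent_eq_neg_one hl
    (by simpa [mem_transpose] using hz)
  rw [h.stepContent_transpose (by omega)] at h3
  exact ⟨k, h1, h2, by omega⟩

theorem stepContent_of_column (h : IsStandardChain m Γ) (hl : l < m) (hz : (0, 1) ∉ Γ (l + 1))
    {k : ℕ} (hk : k ≤ l) : stepContent Γ k = -k := by
  have := h.transpose.stepContent_of_row hl (by simpa [mem_transpose] using hz) hk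
  rw [h.stepContent_transpose (by omega)] at this
  omega

end IsStandardChain

end YoungDiagram

/-! ### Seminormal families and the Murphy weights of their members. -/

open YoungDiagram

/-- The standard chains of length `m` with the same diagrams as `t` from the place `m` on. -/
def chainsTo (m : ℕ) (t : ℕ → YoungDiagram) : Set (ℕ → YoungDiagram) :=
  {Γ | IsStandardChain m Γ ∧ ∀ j, m ≤ j → Γ j = t j}

theorem mem_chainsTo_of_isSwap {m k : ℕ} {t Γ Γ' : ℕ → YoungDiagram} (h : Γ ∈ chainsTo m t)
    (h' : IsStandardChain m Γ') (hk : k + 1 < m) (hs : IsSwap k Γ Γ') : Γ' ∈ chainsTo m t :=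
  ⟨h', fun j hj => by rw [hs.2 j (by omega), h.2 j hj]⟩

/-- The content difference governing the action of the `k`-th generator. -/
def axialDistance (Γ : ℕ → YoungDiagram) (k : ℕ) : ℤ := stepContent Γ (k + 1) - stepContent Γ k

section Seminormal

variable {q : ℝ} {V W : Type*} [AddCommGroup V] [Module ℂ V] [AddCommGroup W] [Module ℂ W]

/-- A family of vectors indexed by the standard chains to a diagram on which the operators
`g 0, …, g (m - 2)` act by the seminormal matrices. -/
structure IsSeminormal (q : ℝ) (g : ℕ → Module.End ℂ V) (m : ℕ) (t : ℕ → YoungDiagram)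
    (u : (ℕ → YoungDiagram) → V) : Prop where
  swap : ∀ k Γ Γ', k + 1 < m → Γ ∈ chainsTo m t → Γ' ∈ chainsTo m t → IsSwap k Γ Γ' →
    g k (u Γ) = diagCoeff q (axialDistance Γ k) • u Γ + swapCoeff q (axialDistance Γ k) • u Γ'
  adjacent : ∀ k Γ, k + 1 < m → Γ ∈ chainsTo m t →
    (axialDistance Γ k = 1 ∨ axialDistance Γ k = -1) →
    g k (u Γ) = diagCoeff q (axialDistance Γ k) • u Γ

theorem axialDistance_swap {m k : ℕ} {t Γ Γ' : ℕ → YoungDiagram} (h : Γ ∈ chainsTo m t)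
    (h' : Γ' ∈ chainsTo m t) (hk : k + 1 < m) (hs : IsSwap k Γ Γ') :
    axialDistance Γ' k = -axialDistance Γ k ∧ axialDistance Γ k ≠ 0 ∧ axialDistance Γ k ≠ 1 ∧
      axialDistance Γ k ≠ -1 := by
  obtain ⟨h1, h2, h3⟩ := h.1.swap_contents h'.1 hk hs
  exact ⟨by rw [axialDistance, axialDistance, h1, h2]; ring, h3⟩

namespace IsSeminormal

variable {g : ℕ → Module.End ℂ V} {m : ℕ} {t : ℕ → YoungDiagram} {u : (ℕ → YoungDiagram) → V}

theorem map {g' : ℕ → Module.End ℂ W} (hu : IsSeminormal q g m t u) (X : V →ₗ[ℂ] W)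
    (hX : ∀ k, k + 1 < m → ∀ v, X (g k v) = g' k (X v)) :
    IsSeminormal q g' m t (fun Γ => X (u Γ)) where
  swap k Γ Γ' hk h h' hs := by
    rw [← hX k hk, hu.swap k Γ Γ' hk h h' hs, map_add, map_smul, map_smul]
  adjacent k Γ hk h hd := by
    rw [← hX k hk, hu.adjacent k Γ hk h hd, map_smul]

/-- A seminormal family that vanishes at one chain vanishes. -/
theorem eq_zero (hu : IsSeminormal q g m t u) (hq : 0 < q) {Γ₀ Γ : ℕ → YoungDiagram}
    (h₀ : Γ₀ ∈ chainsTo m t) (h : Γ ∈ chainsTo m t) (hz : u Γ₀ = 0) : u Γ = 0 := by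
  refine (IsStandardChain.induction_swap (p := fun Δ => Δ ∈ chainsTo m t ∧ u Δ = 0) ?_ h₀.1 h.1
    (fun j hj => by rw [h.2 j hj, h₀.2 j hj]) ⟨h₀, hz⟩).2
  rintro k Δ Δ' hk hΔ hΔ' hs ⟨hc, hz⟩
  have hc' := mem_chainsTo_of_isSwap hc hΔ' hk hs
  refine ⟨hc', ?_⟩
  have := hu.swap k Δ Δ' hk hc hc' hs
  obtain ⟨-, h0, h1, h2⟩ := axialDistance_swap hc hc' hk hs
  rw [hz, map_zero, smul_zero, zero_add] at this
  -- Boxes that can be swapped are never adjacent, so the off-diagonal coefficient is nonzero and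
  -- vanishing spreads along swaps.
  exact (smul_eq_zero.1 this.symm).resolve_left (swapCoeff_ne_zero hq h0 h2)

/-- `X - x` carries the family to another seminormal family, which vanishes at one chain and hence
at all. -/
theorem eigen_of_commute (hu : IsSeminormal q g m t u) (hq : 0 < q) {Γ₀ Γ : ℕ → YoungDiagram}
    (h₀ : Γ₀ ∈ chainsTo m t) (h : Γ ∈ chainsTo m t) {X : Module.End ℂ V}
    (hX : ∀ k, k + 1 < m → Commute (g k) X) {x : ℂ} (hx : X (u Γ₀) = x • u Γ₀) :
    X (u Γ) = x • u Γ := by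
  have h1 := hu.map (g' := g) (X - x • LinearMap.id) (fun k hk v => by
    have := congrArg (fun Y : Module.End ℂ V => Y v) (hX k hk).eq
    simp only [Module.End.mul_apply] at this
    simp [this])
  have := h1.eq_zero hq h₀ h (by simp [hx])
  simpa [sub_eq_zero] using this

/-- The members of a seminormal family are weight vectors of the Jucys–Murphy operators. -/
theorem jucysMurphy_apply (hu : IsSeminormal q g m t u) (hq : 0 < q) {k : ℕ} (hk : k < m)
    {Γ : ℕ → YoungDiagram} (h : Γ ∈ chainsTo m t) :
    jucysMurphy q g k (u Γ) = murphyEigenvalue q (stepContent Γ k) • u Γ := by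
  have hq' : (q : ℂ) ≠ 0 := by exact_mod_cast hq.ne'
  induction k generalizing Γ with
  | zero =>
    rw [h.1.stepContent_zero (by omega), murphyEigenvalue_zero]
    simp [jucysMurphy]
  | succ k ih =>
    have ih1 := ih (by omega) h
    simp only [jucysMurphy, LinearMap.add_apply, LinearMap.smul_apply, Module.End.mul_apply]
    rcases h.1.exists_isSwap_or_adjacent hk with ⟨Γ', hΓ', hs⟩ | hd
    · have h' := mem_chainsTo_of_isSwap h hΓ' hk hs
      obtain ⟨e, h0, h1, h2⟩ := axialDistance_swap h h' hk hs
      have ih2 := ih (by omega) h'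
      have s1 := hu.swap k Γ Γ' hk h h' hs
      have s2 := hu.swap k Γ' Γ hk h' h hs.symm
      -- The swapped chain has the two contents interchanged, so the `k`-th operator acts on the
      -- plane of `u Γ` and `u Γ'` with known eigenvalues `a` and `b`.
      rw [(h.1.swap_contents h'.1 hk hs).1] at ih2
      rw [e] at s2
      have hab : stepContent Γ k ≠ stepContent Γ (k + 1) := fun e => h0 (by
        rw [axialDistance, e, sub_self])
      have i1 := diagCoeff_mul_sub hq hab
      have i2 := diagCoeff_add_diagCoeff_neg hq h0
      have i3 := swapCoeff_mul_swapCoeff_neg hq h0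
      rw [show stepContent Γ (k + 1) - stepContent Γ k = axialDistance Γ k from rfl] at i1
      generalize axialDistance Γ k = d at *
      generalize murphyEigenvalue q (stepContent Γ k) = a at *
      generalize murphyEigenvalue q (stepContent Γ (k + 1)) = b at *
      rw [s1, map_add, map_smul, map_smul, ih1, ih2, map_add, map_smul, map_smul, map_smul,
        map_smul, s1, s2]
      generalize diagCoeff q d = x at *
      generalize diagCoeff q (-d) = y at *
      generalize swapCoeff q d = z at *
      generalize swapCoeff q (-d) = w at *
      obtain rfl : y = q - 1 - x := by linear_combination i2
      match_scalars
      · field_simp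
        linear_combination b * i3 - x * i1
      · field_simp
        linear_combination -z * i1
    · change axialDistance Γ k = 1 ∨ axialDistance Γ k = -1 at hd
      have s1 := hu.adjacent k Γ hk h hd
      have e1 : stepContent Γ (k + 1) = stepContent Γ k + axialDistance Γ k := by
        rw [axialDistance]; ring
      rw [s1, map_smul, ih1, map_smul, map_smul, s1, e1]
      -- Here `g k` acts by `x = q` or `x = -1`, and the recursion sends the eigenvalue `a` to `x +
      -- q⁻¹ x² a`, that is, to content one larger or one smaller.
      rcases hd with hd | hd
      · rw [hd, diagCoeff_one, murphyEigenvalue_add_one hq]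
        match_scalars
        field_simp
        ring
      · have e2 := murphyEigenvalue_add_one hq (stepContent Γ k + -1)
        rw [neg_add_cancel_right] at e2
        rw [hd, diagCoeff_neg_one hq, e2]
        match_scalars
        field_simp
        ring

end IsSeminormal

/-- The reverse of an edge of a seminormal family. -/
theorem seminormal_edge_symm {g : Module.End ℂ V} (hg : g * g = ((q : ℂ) - 1) • g + (q : ℂ) • 1)
    (hq : 0 < q) {d : ℤ} (h0 : d ≠ 0) (h1 : d ≠ -1) {v w : V}
    (h : g v = diagCoeff q d • v + swapCoeff q d • w) :
    g w = diagCoeff q (-d) • w + swapCoeff q (-d) • v := by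
  have hs := swapCoeff_ne_zero hq h0 h1
  have e1 : g (g v) = ((q : ℂ) - 1) • g v + (q : ℂ) • v := by
    simpa using congrArg (fun Y : Module.End ℂ V => Y v) hg
  rw [h, map_add, map_smul, map_smul, h] at e1
  have i2 := diagCoeff_add_diagCoeff_neg hq h0
  have i3 := swapCoeff_mul_swapCoeff_neg hq h0
  generalize diagCoeff q d = x at *
  generalize diagCoeff q (-d) = y at *
  generalize swapCoeff q d = z at *
  generalize swapCoeff q (-d) = w' at *
  obtain rfl : y = q - 1 - x := by linear_combination i2
  have : z • g w = z • ((q - 1 - x : ℂ) • w + w' • v) := by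
    have e2 : z • g w = ((q : ℂ) - 1) • (x • v + z • w) + (q : ℂ) • v - x • (x • v + z • w) := by
      rw [← e1]; abel
    rw [e2]
    match_scalars
    · linear_combination -i3
    · ring
  exact smul_right_injective V hs this

/-- After clearing denominators this is `[e + f] = [e] + q^e [f]`; it is the constraint which the
braid relation puts on the diagonal coefficients. -/
theorem diagCoeff_add_identity (hq : 0 < q) {e f : ℤ} (he : e ≠ 0) (hf : f ≠ 0) (hef : e + f ≠ 0) :
    diagCoeff q e * diagCoeff q (e + f) + diagCoeff q f * diagCoeff q (e + f) =
      diagCoeff q e * diagCoeff q f + ((q : ℂ) - 1) * diagCoeff q (e + f) := by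
  rw [diagCoeff_eq hq he, diagCoeff_eq hq hf, diagCoeff_eq hq hef]
  have h1 : ((qInt q e : ℝ) : ℂ) ≠ 0 := by exact_mod_cast mt (qInt_eq_zero_iff hq).1 he
  have h2 : ((qInt q f : ℝ) : ℂ) ≠ 0 := by exact_mod_cast mt (qInt_eq_zero_iff hq).1 hf
  have h3 : ((qInt q (e + f) : ℝ) : ℂ) ≠ 0 := by exact_mod_cast mt (qInt_eq_zero_iff hq).1 hef
  have h4 : ((qInt q (e + f) : ℝ) : ℂ) =
      (qInt q e : ℝ) + (1 + ((q : ℂ) - 1) * (qInt q e : ℝ)) * (qInt q f : ℝ) := by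
    rw [qInt_add hq, ← one_add_mul_qInt hq]; push_cast; ring
  generalize ((qInt q e : ℝ) : ℂ) = x at *
  generalize ((qInt q f : ℝ) : ℂ) = y at *
  generalize ((qInt q (e + f) : ℝ) : ℂ) = z at *
  field_simp
  rw [h4]; ring

/-- The braid relation closes a hexagon of a seminormal family: five edges imply the sixth. -/
theorem seminormal_hexagon {s t : Module.End ℂ V} (hst : s * t * s = t * s * t) (hq : 0 < q)
    {e f : ℤ} (he : e ≠ 0) (hf : f ≠ 0) (hef : e + f ≠ 0) (hf1 : f ≠ -1) (hef1 : e + f ≠ -1)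
    {p₁ p₂ p₃ p₄ p₅ p₆ : V}
    (t12 : t p₁ = diagCoeff q f • p₁ + swapCoeff q f • p₂)
    (t21 : t p₂ = diagCoeff q (-f) • p₂ + swapCoeff q (-f) • p₁)
    (s23 : s p₂ = diagCoeff q (e + f) • p₂ + swapCoeff q (e + f) • p₃)
    (s14 : s p₁ = diagCoeff q e • p₁ + swapCoeff q e • p₄)
    (s41 : s p₄ = diagCoeff q (-e) • p₄ + swapCoeff q (-e) • p₁)
    (t45 : t p₄ = diagCoeff q (e + f) • p₄ + swapCoeff q (e + f) • p₅)
    (s56 : s p₅ = diagCoeff q f • p₅ + swapCoeff q f • p₆) :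
    t p₃ = diagCoeff q e • p₃ + swapCoeff q e • p₆ := by
  have hb : s (t (s p₁)) = t (s (t p₁)) := by
    simpa using congrArg (fun Y : Module.End ℂ V => Y p₁) hst
  have i0 := diagCoeff_add_identity hq he hf hef
  have i1 := diagCoeff_add_diagCoeff_neg hq he
  have i2 := diagCoeff_add_diagCoeff_neg hq hf
  have i3 := swapCoeff_mul_swapCoeff_neg hq he
  have i4 := swapCoeff_mul_swapCoeff_neg hq hf
  have z1 := swapCoeff_ne_zero hq hf hf1
  have z2 := swapCoeff_ne_zero hq hef hef1
  rw [s14, t12] at hb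
  simp only [map_add, map_smul, t12, t21, s23, s14, s41, t45, s56] at hb
  generalize diagCoeff q e = ke at *
  generalize diagCoeff q f = kf at *
  generalize diagCoeff q (e + f) = kef at *
  obtain h1 : diagCoeff q (-e) = q - 1 - ke := by linear_combination i1
  obtain h2 : diagCoeff q (-f) = q - 1 - kf := by linear_combination i2
  rw [h1] at hb i3
  rw [h2] at hb i4
  generalize swapCoeff q e = se at *
  generalize swapCoeff q f = sf at *
  generalize swapCoeff q (e + f) = sef at *
  generalize swapCoeff q (-e) = se' at *
  generalize swapCoeff q (-f) = sf' at *
  -- In the braid relation applied to `p₁`, the only term not covered by the given edges is `t p₃`,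
  -- whose coefficient `sf * sef` is nonzero.
  have key : (sf * sef) • t p₃ = (sf * sef) • (ke • p₃ + se • p₆) := by
    rw [← sub_eq_zero] at hb ⊢
    rw [← neg_eq_zero, ← hb]
    match_scalars
    all_goals try ring1
    · linear_combination (ke - kf) * i0 - kef * i3 + kef * i4
    · linear_combination se * i0
    · linear_combination -sf * i0
  exact smul_right_injective V (mul_ne_zero z1 z2) key

end Seminormal

theorem update_mem_chainsTo {k : ℕ} {Δ t : ℕ → YoungDiagram} {ν : YoungDiagram} {x y : ℕ × ℕ}
    (hΔ : IsStandardChain k Δ) (ht : ∀ p, k + 2 ≤ p → Δ p = t p) (h1 : Adds (Δ k) x ν)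
    (h2 : Adds ν y (t (k + 2))) : Function.update Δ (k + 1) ν ∈ chainsTo (k + 2) t := by
  have hc : IsStandardChain k (Function.update Δ (k + 1) ν) := by
    refine ⟨by simpa using hΔ.zero, fun p hp => ?_⟩
    rw [Function.update_of_ne (by omega), Function.update_of_ne (by omega)]
    exact hΔ.adds p hp
  have hc1 := hc.succ (b := x) (by simpa using h1)
  refine ⟨hc1.succ (b := y) (by simpa [ht] using h2), fun p hp => ?_⟩
  rw [Function.update_of_ne (by omega), ht p hp]

/-- The tail `t` need not be compatible with `κ`: the missing diagrams in between are inserted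
afterwards by `Function.update`. -/
theorem exists_prefix {κ : YoungDiagram} {k : ℕ} (hκ : κ.card = k) (t : ℕ → YoungDiagram) :
    ∃ Δ, IsStandardChain k Δ ∧ Δ k = κ ∧ ∀ p, k < p → Δ p = t p := by
  subst hκ
  obtain ⟨Δ, h1, h2, h3⟩ := exists_isStandardChain (le_refl κ) (Function.update t κ.card κ)
    (by simp)
  refine ⟨Δ, h1, h2, fun p hp => ?_⟩
  rw [h3 p hp.le, Function.update_of_ne (by omega)]

/-! ### Weight vectors for self-adjoint generators. -/

section Unitary

variable {N : ℕ} {q : ℝ} {P : Type*} [NormedAddCommGroup P] [InnerProductSpace ℂ P]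
  {g : ℕ → Module.End ℂ P}

theorem jucysMurphy_isSymmetric (hsym : ∀ k < N, (g k).IsSymmetric) {k : ℕ} (hk : k ≤ N) :
    (jucysMurphy q g k).IsSymmetric := by
  induction k with
  | zero => exact fun x y => by simp [jucysMurphy]
  | succ k ih =>
    intro x y
    have h1 := hsym k (by omega)
    have h2 := ih (by omega)
    simp only [jucysMurphy, LinearMap.add_apply, LinearMap.smul_apply, Module.End.mul_apply,
      inner_add_left, inner_add_right, inner_smul_left, inner_smul_right]
    rw [h1 x y, h1 _ y, h2 _ (g k y), h1 x _]
    simp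

theorem conj_murphyEigenvalue (c : ℤ) :
    (starRingEnd ℂ) (murphyEigenvalue q c) = murphyEigenvalue q c := by
  rw [murphyEigenvalue, Complex.conj_ofReal]

section

variable (hg : IsHeckeFamily N q g) (hq : 0 < q)

include hg hq

theorem jucysMurphy_apply_generator {k : ℕ} (hk : k < N) {v : P} {b : ℂ}
    (hb : jucysMurphy q g (k + 1) v = b • v) :
    jucysMurphy q g k (g k v) = b • g k v - (((q : ℂ) - 1) * b + q) • v := by
  have h := congrArg (fun Y : Module.End ℂ P => Y v) (hg.mul_jucysMurphy_succ hq hk)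
  simp only [Module.End.mul_apply, LinearMap.add_apply, LinearMap.smul_apply, hb,
    Module.End.one_apply, map_smul] at h
  rw [h]
  module

theorem jucysMurphy_succ_apply_generator {k : ℕ} (hk : k < N) {v : P} {a b : ℂ}
    (ha : jucysMurphy q g k v = a • v) (hb : jucysMurphy q g (k + 1) v = b • v) :
    jucysMurphy q g (k + 1) (g k v) = a • g k v + (((q : ℂ) - 1) * b + q) • v := by
  have h := congrArg (fun Y : Module.End ℂ P => Y v) (hg.jucysMurphy_succ_mul hq hk)
  simp only [Module.End.mul_apply, LinearMap.add_apply, LinearMap.smul_apply, hb, ha,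
    Module.End.one_apply, map_smul] at h
  rw [h]
  module

/-- `g k - x` is the intertwiner: `x` is chosen to absorb the inhomogeneous terms of the mixed
relations, which leaves the eigenvalues interchanged. -/
theorem jucysMurphy_apply_swapped {k : ℕ} (hk : k < N) {v : P} {a b x : ℂ}
    (ha : jucysMurphy q g k v = a • v) (hb : jucysMurphy q g (k + 1) v = b • v)
    (hx : x * (b - a) = ((q : ℂ) - 1) * b + q) :
    jucysMurphy q g k (g k v - x • v) = b • (g k v - x • v) ∧
      jucysMurphy q g (k + 1) (g k v - x • v) = a • (g k v - x • v) := by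
  rw [map_sub, map_sub, map_smul, map_smul, jucysMurphy_apply_generator hg hq hk hb,
    jucysMurphy_succ_apply_generator hg hq hk ha hb, ha, hb, ← hx]
  constructor <;> module

theorem jucysMurphy_apply_swapped_of_ne {k j : ℕ} (hk : k < N) (hj : j ≤ N) (h1 : j ≠ k)
    (h2 : j ≠ k + 1) {v : P} {a x : ℂ} (ha : jucysMurphy q g j v = a • v) :
    jucysMurphy q g j (g k v - x • v) = a • (g k v - x • v) := by
  have h := congrArg (fun Y : Module.End ℂ P => Y v) (hg.commute_jucysMurphy hq hk hj h1 h2).eq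
  simp only [Module.End.mul_apply] at h
  rw [map_sub, map_smul, ← h, ha, map_smul]
  module

variable (hsym : ∀ k < N, (g k).IsSymmetric)

include hsym

/-- Consecutive Murphy eigenvalues of a weight vector are distinct. -/
theorem eq_zero_of_equal_eigenvalues {k : ℕ} (hk : k < N) {v : P} {c : ℤ}
    (ha : jucysMurphy q g k v = murphyEigenvalue q c • v)
    (hb : jucysMurphy q g (k + 1) v = murphyEigenvalue q c • v) : v = 0 := by
  have h1 := jucysMurphy_apply_generator hg hq hk hb
  have h2 := jucysMurphy_isSymmetric (q := q) hsym hk.le v (g k v)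
  rw [ha, h1, inner_smul_left, inner_sub_right, inner_smul_right, inner_smul_right,
    conj_murphyEigenvalue] at h2
  -- Self-adjointness, tested on `v` and `g k v`, cancels everything but the inhomogeneous term.
  have h3 : (((q : ℂ) - 1) * murphyEigenvalue q c + q) * inner ℂ v v = 0 := by
    linear_combination h2
  exact inner_self_eq_zero.1
    ((mul_eq_zero.1 h3).resolve_left (murphyEigenvalue_nondegenerate hq c))

/-- The defect `w = g k v - x v` has a different eigenvalue from `v`, so it is orthogonal to `v`. As
`x` is a root of the quadratic relation, `w` is an eigenvector of `g k` for the other root; moving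
`g k` across the inner product then gives `⟨w, w⟩ = 0`. -/
theorem generator_apply_of_root {k : ℕ} (hk : k < N) {v : P} {c : ℤ} {b x : ℂ}
    (ha : jucysMurphy q g k v = murphyEigenvalue q c • v)
    (hb : jucysMurphy q g (k + 1) v = b • v) (hne : b ≠ murphyEigenvalue q c)
    (hx : x * (b - murphyEigenvalue q c) = ((q : ℂ) - 1) * b + q)
    (hroot : x = q ∨ x = -1) : g k v = x • v := by
  obtain ⟨h1, -⟩ := jucysMurphy_apply_swapped hg hq hk ha hb hx
  set w := g k v - x • v with hw
  have horth : inner ℂ v w = 0 := by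
    have h2 := jucysMurphy_isSymmetric (q := q) hsym hk.le v w
    rw [ha, h1, inner_smul_left, inner_smul_right, conj_murphyEigenvalue] at h2
    have h3 : (b - murphyEigenvalue q c) * inner ℂ v w = 0 := by linear_combination -h2
    exact (mul_eq_zero.1 h3).resolve_left (sub_ne_zero.2 hne)
  have hgw : g k w = ((q : ℂ) - 1 - x) • w := by
    have e : g k (g k v) = ((q : ℂ) - 1) • g k v + (q : ℂ) • v := by
      simpa using congrArg (fun Y : Module.End ℂ P => Y v) (hg.quadratic k hk)
    rw [hw, map_sub, map_smul, e]
    match_scalars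
    · ring
    · rcases hroot with rfl | rfl <;> ring
  have h0 : inner ℂ w w = 0 := by
    conv_lhs => arg 2; rw [hw]
    rw [inner_sub_left, inner_smul_left, horth, hsym k hk v w, hgw, inner_smul_right, horth]
    simp
  exact sub_eq_zero.1 (inner_self_eq_zero.1 h0)

theorem generator_apply_of_adjacent {k : ℕ} (hk : k < N) {v : P} {c c' : ℤ}
    (ha : jucysMurphy q g k v = murphyEigenvalue q c • v)
    (hb : jucysMurphy q g (k + 1) v = murphyEigenvalue q c' • v)
    (hd : c' - c = 1 ∨ c' - c = -1) : g k v = diagCoeff q (c' - c) • v := by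
  refine generator_apply_of_root hg hq hsym hk ha hb
    (fun h => by have := murphyEigenvalue_injective hq h; omega)
    (diagCoeff_mul_sub hq (by omega)) ?_
  rcases hd with hd | hd
  · left; rw [hd, diagCoeff_one]
  · right; rw [hd, diagCoeff_neg_one hq]

omit hsym in
theorem weight_swapped {m k : ℕ} (hm : m ≤ N + 1) (hk : k + 1 < m) {t Γ Γ' : ℕ → YoungDiagram}
    (h : Γ ∈ chainsTo m t) (h' : Γ' ∈ chainsTo m t) (hs : IsSwap k Γ Γ') {v : P}
    (hv : ∀ j < m, jucysMurphy q g j v = murphyEigenvalue q (stepContent Γ j) • v) :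
    ∀ j < m, jucysMurphy q g j (g k v - diagCoeff q (axialDistance Γ k) • v) =
      murphyEigenvalue q (stepContent Γ' j) • (g k v - diagCoeff q (axialDistance Γ k) • v) := by
  intro j hj
  obtain ⟨c1, c2, c3, -⟩ := h.1.swap_contents h'.1 hk hs
  have hab : stepContent Γ k ≠ stepContent Γ (k + 1) := fun e => c3 (by rw [e, sub_self])
  obtain ⟨e1, e2⟩ := jucysMurphy_apply_swapped hg hq (show k < N by omega) (hv k (by omega))
    (hv (k + 1) hk) (diagCoeff_mul_sub hq hab)
  by_cases h1 : j = k
  · subst h1; rw [c1]; exact e1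
  by_cases h2 : j = k + 1
  · subst h2; rw [c2]; exact e2
  rw [IsStandardChain.swap_stepContent hs h1 h2]
  exact jucysMurphy_apply_swapped_of_ne hg hq (by omega) (by omega) h1 h2 (hv j hj)

end

/-- An edge of a seminormal family in the direction of the last generator. -/
def IsLastEdge (q : ℝ) (g : ℕ → Module.End ℂ P) (u : (ℕ → YoungDiagram) → P) (k : ℕ)
    (Γ Γ' : ℕ → YoungDiagram) : Prop :=
  g k (u Γ) = diagCoeff q (axialDistance Γ k) • u Γ + swapCoeff q (axialDistance Γ k) • u Γ'

/-- An edge between two components determines all edges between them. -/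
theorem IsLastEdge.transport (hg : IsHeckeFamily N q g) (hq : 0 < q) {k : ℕ} (hk : k < N)
    {t : ℕ → YoungDiagram} {u : (ℕ → YoungDiagram) → P}
    (hu : ∀ j Γ Γ', j + 1 < k + 1 → Γ ∈ chainsTo (k + 2) t → Γ' ∈ chainsTo (k + 2) t →
      IsSwap j Γ Γ' → IsLastEdge q g u j Γ Γ')
    {Γ₁ Γ₁' Γ Γ' : ℕ → YoungDiagram} (h₁ : Γ₁ ∈ chainsTo (k + 2) t)
    (h₁' : Γ₁' ∈ chainsTo (k + 2) t) (h : Γ ∈ chainsTo (k + 2) t) (h' : Γ' ∈ chainsTo (k + 2) t)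
    (hs₁ : IsSwap k Γ₁ Γ₁') (hs : IsSwap k Γ Γ') (he : Γ (k + 1) = Γ₁ (k + 1))
    (he' : Γ' (k + 1) = Γ₁' (k + 1)) (hE : IsLastEdge q g u k Γ₁ Γ₁') :
    IsLastEdge q g u k Γ Γ' := by
  have hupd : ∀ {Δ Δ' : ℕ → YoungDiagram}, IsSwap k Δ Δ' →
      Δ' = Function.update Δ (k + 1) (Δ' (k + 1)) := fun {Δ Δ'} hΔ => by
    funext p
    by_cases hp : p = k + 1
    · subst hp; simp
    · rw [Function.update_of_ne hp, hΔ.2 p hp]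
  have htop : Γ (k + 2) = Γ₁ (k + 2) := by rw [h.2 _ le_rfl, h₁.2 _ le_rfl]
  -- The diagram at `k` is determined by those at `k + 2` and by the two diagrams between.
  have hbot : Γ k = Γ₁ k := by
    obtain ⟨b, b', hne, k1, k2, k3, k4⟩ := h.1.swap_boxes h'.1 (by omega) hs
    obtain ⟨c, c', hne', l1, l2, l3, l4⟩ := h₁.1.swap_boxes h₁'.1 (by omega) hs₁
    rw [htop, he'] at k4
    rw [← (k4.box_unique l4), ← he] at l1
    exact k1.bot_unique l1
  have hagree : ∀ j, k ≤ j → Γ j = Γ₁ j := fun j hj => by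
    rcases (show j = k ∨ j = k + 1 ∨ k + 2 ≤ j by omega) with rfl | rfl | hj
    · exact hbot
    · exact he
    · rw [h.2 j hj, h₁.2 j hj]
  set ν := Γ₁' (k + 1) with hν
  have hmem : ∀ Δ : ℕ → YoungDiagram, IsStandardChain k Δ → (∀ j, k ≤ j → Δ j = Γ₁ j) →
      Δ ∈ chainsTo (k + 2) t ∧ Function.update Δ (k + 1) ν ∈ chainsTo (k + 2) t := by
    intro Δ hΔ hj
    obtain ⟨c, c', hne', l1, l2, l3, l4⟩ := h₁.1.swap_boxes h₁'.1 (by omega) hs₁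
    refine ⟨⟨h₁.1.congr hΔ fun p hp _ => hj p hp, fun p hp => ?_⟩, ?_⟩
    · rw [hj p (by omega), h₁.2 p hp]
    · refine update_mem_chainsTo (x := c') (y := c) hΔ
        (fun p hp => by rw [hj p (by omega), h₁.2 p hp]) ?_ ?_
      · rw [hj k le_rfl]; exact l3
      · rw [← h₁.2 _ le_rfl]; exact l4
  have key := IsStandardChain.induction_swap (m := k) (Γ₀ := Γ₁) (Γ := Γ)
    (p := fun Δ => (∀ j, k ≤ j → Δ j = Γ₁ j) ∧
      IsLastEdge q g u k Δ (Function.update Δ (k + 1) ν)) ?_ (h₁.1.mono (by omega))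
      (h.1.mono (by omega)) hagree ⟨fun _ _ => rfl, by rwa [hν, ← hupd hs₁]⟩
  · rw [hupd hs, he']; exact key.2
  rintro j Δ Δ' hj hΔ hΔ' hsw ⟨hΔj, hE⟩
  have hΔj' : ∀ p, k ≤ p → Δ' p = Γ₁ p := fun p hp => by rw [hsw.2 p (by omega), hΔj p hp]
  refine ⟨hΔj', ?_⟩
  obtain ⟨m1, m2⟩ := hmem Δ hΔ hΔj
  obtain ⟨m1', m2'⟩ := hmem Δ' hΔ' hΔj'
  have hsw' : IsSwap j (Function.update Δ (k + 1) ν) (Function.update Δ' (k + 1) ν) := by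
    refine ⟨?_, fun p hp => ?_⟩
    · rw [Function.update_of_ne (by omega), Function.update_of_ne (by omega)]; exact hsw.1
    · by_cases hpk : p = k + 1
      · subst hpk; simp
      · rw [Function.update_of_ne hpk, Function.update_of_ne hpk, hsw.2 p hp]
  have E1 := hu j Δ Δ' (by omega) m1 m1' hsw
  have E2 := hu j _ _ (by omega) m2 m2' hsw'
  have a1 : axialDistance (Function.update Δ (k + 1) ν) j = axialDistance Δ j := by
    rw [axialDistance, axialDistance]
    congr 1 <;> refine stepContent_congr ?_ ?_ <;> rw [Function.update_of_ne (by omega)]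
  have a2 : axialDistance Δ' k = axialDistance Δ k := by
    rw [axialDistance, axialDistance]
    congr 1 <;> refine stepContent_congr ?_ ?_ <;> rw [hΔj' _ (by omega), hΔj _ (by omega)]
  obtain ⟨-, d0, -, d1⟩ := axialDistance_swap m1 m1' (by omega) hsw
  unfold IsLastEdge at E1 E2 hE ⊢
  rw [a1] at E2
  rw [a2]
  -- Along a swap below `k` the new edge follows from the old one because `g j` and `g k` commute;
  -- the coefficient of `g k (u Δ')` is nonzero and can be cancelled.
  have hcomm : g j (g k (u Δ)) = g k (g j (u Δ)) := by
    simpa using congrArg (fun Y : Module.End ℂ P => Y (u Δ)) (hg.comm j k (by omega) hk)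
  rw [E1, hE, map_add, map_add, map_smul, map_smul, map_smul, map_smul, E1, E2, hE] at hcomm
  refine smul_right_injective P (swapCoeff_ne_zero hq d0 d1) ?_
  show swapCoeff q (axialDistance Δ j) • _ = swapCoeff q (axialDistance Δ j) • _
  have h3 : swapCoeff q (axialDistance Δ j) • g k (u Δ') =
      (diagCoeff q (axialDistance Δ j) • (diagCoeff q (axialDistance Δ k) • u Δ +
        swapCoeff q (axialDistance Δ k) • u (Function.update Δ (k + 1) ν)) +
        swapCoeff q (axialDistance Δ j) • g k (u Δ')) -
      diagCoeff q (axialDistance Δ j) • (diagCoeff q (axialDistance Δ k) • u Δ +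
        swapCoeff q (axialDistance Δ k) • u (Function.update Δ (k + 1) ν)) := by abel
  rw [h3, ← hcomm]
  module

end Unitary

/-! ### From a weight vector to a standard chain and a seminormal family. -/

section Unitary

variable {N : ℕ} {q : ℝ} {P : Type*} [NormedAddCommGroup P] [InnerProductSpace ℂ P]
  {g : ℕ → Module.End ℂ P}

/-- The last edges of a family follow from those that involve one fixed component. -/
theorem isLastEdge_of_component (hg : IsHeckeFamily N q g) (hq : 0 < q) {k : ℕ} (hk : k < N)
    {t : ℕ → YoungDiagram} {u : (ℕ → YoungDiagram) → P}
    (hu : ∀ j Γ Γ', j + 1 < k + 1 → Γ ∈ chainsTo (k + 2) t → Γ' ∈ chainsTo (k + 2) t →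
      IsSwap j Γ Γ' → IsLastEdge q g u j Γ Γ')
    (hadj : ∃ b₀, Adds (t (k + 1)) b₀ (t (k + 2)))
    (hlink : ∀ Γ Γ', Γ ∈ chainsTo (k + 2) t → Γ' ∈ chainsTo (k + 2) t → IsSwap k Γ Γ' →
      Γ (k + 1) = t (k + 1) → IsLastEdge q g u k Γ Γ')
    {Γ Γ' : ℕ → YoungDiagram} (h : Γ ∈ chainsTo (k + 2) t) (h' : Γ' ∈ chainsTo (k + 2) t)
    (hs : IsSwap k Γ Γ') : IsLastEdge q g u k Γ Γ' := by
  have hsymm : ∀ Γ Γ', Γ ∈ chainsTo (k + 2) t → Γ' ∈ chainsTo (k + 2) t → IsSwap k Γ Γ' →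
      Γ' (k + 1) = t (k + 1) → IsLastEdge q g u k Γ Γ' := by
    intro Γ Γ' h h' hs he
    have E := hlink Γ' Γ h' h hs.symm he
    obtain ⟨e, h0, h1, h2⟩ := axialDistance_swap h' h (by omega) hs.symm
    have := seminormal_edge_symm (hg.quadratic k hk) hq h0 h2 E
    rwa [← e] at this
  by_cases c1 : Γ (k + 1) = t (k + 1)
  · exact hlink Γ Γ' h h' hs c1
  by_cases c2 : Γ' (k + 1) = t (k + 1)
  · exact hsymm Γ Γ' h h' hs c2
  -- Now the top diagram has three distinct corners `b₀`, `b`, `b'`. The six orders of adding them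
  -- form a hexagon; the edges through the fixed component and those of the lower generator give
  -- five sides, and the braid relation gives the sixth.
  obtain ⟨b₀, a₀⟩ := hadj
  obtain ⟨b', b, hne, l1, l2, l3, l4⟩ := h.1.swap_boxes h'.1 (by omega) hs
  rw [h.2 (k + 2) le_rfl] at l2 l4
  have hb₀ : b₀ ≠ b := by rintro rfl; exact c1 (l2.bot_unique a₀)
  have hb₀' : b₀ ≠ b' := by rintro rfl; exact c2 (l4.bot_unique a₀)
  -- the diagrams with two and three of the boxes `b₀`, `b`, `b'` removed
  obtain ⟨m1, m2⟩ := a₀.inf l2 hb₀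
  obtain ⟨n1, n2⟩ := a₀.inf l4 hb₀'
  have hcard : (Γ k).card = k := h.1.card_eq (by omega)
  obtain ⟨r1, r2⟩ := m1.inf n1 hne.symm
  obtain ⟨r3, r4⟩ := m2.inf l1 hb₀'
  set A := t (k + 1) ⊓ Γ (k + 1) with hA
  set A' := t (k + 1) ⊓ Γ' (k + 1) with hA'
  have hbot : A ⊓ A' = A ⊓ Γ k := r1.bot_unique r3
  rw [← hbot] at r4
  obtain ⟨j, rfl⟩ : ∃ j, k = j + 1 := ⟨k - 1, by have := r4.card_eq; omega⟩
  obtain ⟨Δ, hΔ1, hΔ2, hΔ3⟩ := exists_prefix (κ := A ⊓ A') (k := j)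
    (by have := r4.card_eq; omega) t
  rw [← hΔ2] at r1 r2 r4
  set X : YoungDiagram → YoungDiagram → ℕ → YoungDiagram :=
    fun B C => Function.update (Function.update Δ (j + 1) B) (j + 2) C with hX
  have X0 : ∀ B C, X B C j = Δ j := fun B C => by simp [hX]
  have X1 : ∀ B C, X B C (j + 1) = B := fun B C => by simp [hX]
  have X2 : ∀ B C, X B C (j + 2) = C := fun B C => by simp [hX]
  have X3 : ∀ B C p, j + 3 ≤ p → X B C p = t p := fun B C p hp => by
    simp only [hX]
    rw [Function.update_of_ne (by omega), Function.update_of_ne (by omega), hΔ3 p (by omega)]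
  have hmem : ∀ {B C : YoungDiagram} {x y z : ℕ × ℕ}, Adds (Δ j) x B → Adds B y C →
      Adds C z (t (j + 3)) → X B C ∈ chainsTo (j + 1 + 2) t ∧
      axialDistance (X B C) j = boxContent y - boxContent x ∧
      axialDistance (X B C) (j + 1) = boxContent z - boxContent y := by
    intro B C x y z h1 h2 h3
    have e1 : Adds (X B C j) x (X B C (j + 1)) := by rwa [X0, X1]
    have e2 : Adds (X B C (j + 1)) y (X B C (j + 2)) := by rwa [X1, X2]
    have e3 : Adds (X B C (j + 2)) z (X B C (j + 3)) := by rwa [X2, X3 _ _ _ le_rfl]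
    have hc : IsStandardChain j (X B C) := by
      refine ⟨?_, fun p hp => ?_⟩
      · simpa [hX] using hΔ1.zero
      · simp only [hX]
        rw [Function.update_of_ne (by omega), Function.update_of_ne (by omega),
          Function.update_of_ne (by omega), Function.update_of_ne (by omega)]
        exact hΔ1.adds p hp
    refine ⟨⟨((hc.succ e1).succ e2).succ e3, fun p hp => X3 B C p hp⟩, ?_, ?_⟩
    · rw [axialDistance, stepContent_eq e1, stepContent_eq e2]
    · rw [axialDistance, stepContent_eq e2, stepContent_eq e3]
  have hsw : ∀ {B B' C : YoungDiagram}, B' ≠ B → IsSwap j (X B C) (X B' C) := fun {B B' C} hB => by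
    refine ⟨by rwa [X1, X1], fun p hp => ?_⟩
    simp only [hX, Function.update_apply, hp, if_false]
  have hsw' : ∀ {B C C' : YoungDiagram}, C' ≠ C → IsSwap (j + 1) (X B C) (X B C') :=
    fun {B C C'} hC => by
      refine ⟨by rwa [X2, X2], fun p hp => ?_⟩
      simp only [hX]
      rw [Function.update_of_ne hp, Function.update_of_ne hp]
  set T := t (j + 1 + 1) with hT
  set D := Γ (j + 1) with hD
  set L := Γ (j + 1 + 1) with hL
  set L' := Γ' (j + 1 + 1) with hL'
  have nLL' : L' ≠ L := hs.1
  have nA : A' ≠ A := by rintro e; rw [e] at r2; exact hne (r1.box_unique r2)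
  have nDA : D ≠ A := by rintro e; rw [e] at r4; exact hb₀' (r4.box_unique r1)
  have nDA' : D ≠ A' := by rintro e; rw [e] at r4; exact hb₀ (r4.box_unique r2)
  obtain ⟨q1, d1, d1'⟩ := hmem r1 m1 a₀
  obtain ⟨q2, d2, d2'⟩ := hmem r1 m2 l2
  obtain ⟨q3, d3, d3'⟩ := hmem r4 l1 l2
  obtain ⟨q4, d4, d4'⟩ := hmem r2 n1 a₀
  obtain ⟨q5, d5, d5'⟩ := hmem r2 n2 l4
  obtain ⟨q6, d6, d6'⟩ := hmem r4 l3 l4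
  have t12 := hlink _ _ q1 q2 (hsw' c1) (X2 _ _)
  have t21 := hsymm _ _ q2 q1 (hsw' (Ne.symm c1)) (X2 _ _)
  have s23 := hu j _ _ (by omega) q2 q3 (hsw nDA)
  have s14 := hu j _ _ (by omega) q1 q4 (hsw nA)
  have s41 := hu j _ _ (by omega) q4 q1 (hsw nA.symm)
  have t45 := hlink _ _ q4 q5 (hsw' c2) (X2 _ _)
  have s56 := hu j _ _ (by omega) q5 q6 (hsw nDA')
  have f1 := r1.content_far r2 hne
  have f2 := r2.content_far r4 (Ne.symm hb₀)
  have f3 := r1.content_far r4 (Ne.symm hb₀')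
  have g1 : boxContent b₀ - boxContent b' =
      (boxContent b - boxContent b') + (boxContent b₀ - boxContent b) := by ring
  have g2 : boxContent b - boxContent b₀ = -(boxContent b₀ - boxContent b) := by ring
  have g3 : boxContent b' - boxContent b = -(boxContent b - boxContent b') := by ring
  unfold IsLastEdge at t12 t21 s23 s14 s41 t45 s56
  rw [d1'] at t12
  rw [d2', g2] at t21
  rw [d2, g1] at s23
  rw [d1] at s14
  rw [d4, g3] at s41
  rw [d4', g1] at t45
  rw [d5] at s56
  rw [g1] at f3
  have E : IsLastEdge q g u (j + 1) (X D L) (X D L') := by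
    unfold IsLastEdge
    rw [d3']
    exact seminormal_hexagon (hg.braid j hk) hq f1.1 f2.1 f3.1 f2.2.2 f3.2.2 t12 t21 s23 s14 s41
      t45 s56
  -- The hexagon was built over a chosen prefix `Δ`; transport moves its edge to the given chains.
  exact E.transport hg hq hk hu q3 q6 h h' (hsw' nLL') hs (X2 _ _).symm (X2 _ _).symm

/-- A weight vector of the Jucys–Murphy operators belonging to a standard chain is a member of a
seminormal family. -/
theorem exists_isSeminormal (hg : IsHeckeFamily N q g) (hq : 0 < q)
    (hsym : ∀ k < N, (g k).IsSymmetric) {m : ℕ} (hm : m ≤ N + 1) {Γ₀ : ℕ → YoungDiagram}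
    (h₀ : IsStandardChain m Γ₀) {v : P}
    (hv : ∀ j < m, jucysMurphy q g j v = murphyEigenvalue q (stepContent Γ₀ j) • v) :
    ∃ u : (ℕ → YoungDiagram) → P, u Γ₀ = v ∧ IsSeminormal q g m Γ₀ u := by
  induction m generalizing Γ₀ v with
  | zero => exact ⟨fun _ => v, rfl, fun k _ _ hk => by omega, fun k _ hk => by omega⟩
  | succ m ih =>
  obtain ⟨u₀, hu₀v, hu₀⟩ := ih (by omega) (h₀.mono (by omega)) (fun j hj => hv j (by omega))
  obtain _ | k := m
  · exact ⟨u₀, hu₀v, fun k _ _ hk => by omega, fun k _ hk => by omega⟩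
  have hkN : k < N := by omega
  have hself : Γ₀ ∈ chainsTo (k + 2) Γ₀ := ⟨h₀, fun _ _ => rfl⟩
  -- membership in a component
  have hcomp : ∀ {R Γ : ℕ → YoungDiagram}, R ∈ chainsTo (k + 2) Γ₀ → Γ ∈ chainsTo (k + 2) Γ₀ →
      Γ (k + 1) = R (k + 1) → Γ ∈ chainsTo (k + 1) R := by
    intro R Γ hR hΓ he
    refine ⟨hΓ.1.mono (by omega), fun j hj => ?_⟩
    rcases (show j = k + 1 ∨ k + 2 ≤ j by omega) with rfl | hj
    · exact he
    · rw [hΓ.2 j hj, hR.2 j hj]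
  -- the weights of a component
  have hwt : ∀ {R : ℕ → YoungDiagram} {u : (ℕ → YoungDiagram) → P}, R ∈ chainsTo (k + 2) Γ₀ →
      IsSeminormal q g (k + 1) R u →
      jucysMurphy q g (k + 1) (u R) = murphyEigenvalue q (stepContent R (k + 1)) • u R →
      ∀ Γ ∈ chainsTo (k + 2) Γ₀, Γ (k + 1) = R (k + 1) → ∀ j < k + 2,
      jucysMurphy q g j (u Γ) = murphyEigenvalue q (stepContent Γ j) • u Γ := by
    intro R u hR hu hJ Γ hΓ he j hj
    have hΓR := hcomp hR hΓ he
    rcases (show j < k + 1 ∨ j = k + 1 by omega) with hj' | rfl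
    · exact hu.jucysMurphy_apply hq hj' hΓR
    · rw [stepContent_congr (hΓR.2 (k + 1) le_rfl) (hΓR.2 (k + 1 + 1) (by omega))]
      exact hu.eigen_of_commute hq (hcomp hR hR rfl) hΓR
        (fun i hi => hg.commute_jucysMurphy hq (by omega) (by omega) (by omega) (by omega)) hJ
  obtain ⟨b₀, a₀⟩ := h₀.adds (k + 1) (by omega)
  have hw₀ := hwt hself hu₀ (by rw [hu₀v]; exact hv (k + 1) (by omega))
  -- One family is chosen for each penultimate diagram `ν`: the inductive one for the component of
  -- `Γ₀`, and otherwise one grown from a vector obtained by a single intertwiner step out of that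
  -- component.
  have hU : ∀ ν : YoungDiagram, ∃ U : (ℕ → YoungDiagram) → P, (ν = Γ₀ (k + 1) → U = u₀) ∧
      ((∃ b, Adds ν b (Γ₀ (k + 2))) → ∃ R ∈ chainsTo (k + 2) Γ₀, R (k + 1) = ν ∧
        IsSeminormal q g (k + 1) R U ∧
        (∀ Γ ∈ chainsTo (k + 2) Γ₀, Γ (k + 1) = R (k + 1) → ∀ j < k + 2,
          jucysMurphy q g j (U Γ) = murphyEigenvalue q (stepContent Γ j) • U Γ) ∧
        (ν ≠ Γ₀ (k + 1) → ∃ S ∈ chainsTo (k + 2) Γ₀, S (k + 1) = Γ₀ (k + 1) ∧ IsSwap k S R ∧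
          g k (u₀ S) = diagCoeff q (axialDistance S k) • u₀ S +
            swapCoeff q (axialDistance S k) • U R)) := by
    intro ν
    by_cases hν : ν = Γ₀ (k + 1)
    · exact ⟨u₀, fun _ => rfl, fun _ => ⟨Γ₀, hself, hν.symm, hu₀, hw₀, fun h => absurd hν h⟩⟩
    by_cases hb : ∃ b, Adds ν b (Γ₀ (k + 2))
    swap
    · exact ⟨0, fun h => absurd h hν, fun h => absurd h hb⟩
    obtain ⟨b, hb⟩ := hb
    have hbb : b₀ ≠ b := by rintro rfl; exact hν (hb.bot_unique a₀)
    obtain ⟨k1, k2⟩ := a₀.inf hb hbb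
    obtain ⟨Δ, hΔ1, hΔ2, hΔ3⟩ := exists_prefix (κ := Γ₀ (k + 1) ⊓ ν) (k := k)
      (by have := k1.card_eq; have := h₀.card_eq (p := k + 1) (by omega); omega) Γ₀
    rw [← hΔ2] at k1 k2
    have hS := update_mem_chainsTo (t := Γ₀) hΔ1 (fun p hp => hΔ3 p (by omega)) k1 a₀
    have hR := update_mem_chainsTo (t := Γ₀) hΔ1 (fun p hp => hΔ3 p (by omega)) k2 hb
    have hsw : IsSwap k (Function.update Δ (k + 1) (Γ₀ (k + 1))) (Function.update Δ (k + 1) ν) := by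
      refine ⟨by simpa using hν, fun p hp => ?_⟩
      rw [Function.update_of_ne hp, Function.update_of_ne hp]
    have hS1 : Function.update Δ (k + 1) (Γ₀ (k + 1)) (k + 1) = Γ₀ (k + 1) :=
      Function.update_self ..
    have hR1 : Function.update Δ (k + 1) ν (k + 1) = ν := Function.update_self ..
    generalize Function.update Δ (k + 1) (Γ₀ (k + 1)) = S at hS hsw hS1
    generalize Function.update Δ (k + 1) ν = R at hR hsw hR1
    obtain ⟨-, d0, -, d1⟩ := axialDistance_swap hS hR (by omega) hsw
    have hne := swapCoeff_ne_zero hq d0 d1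
    have hw := weight_swapped hg hq hm (by omega) hS hR hsw (hw₀ S hS hS1)
    -- Normalised so that the edge from `S` to `R` has the seminormal coefficients.
    set w := (swapCoeff q (axialDistance S k))⁻¹ •
      (g k (u₀ S) - diagCoeff q (axialDistance S k) • u₀ S) with hwdef
    have hw' : ∀ j < k + 2,
        jucysMurphy q g j w = murphyEigenvalue q (stepContent R j) • w := fun j hj => by
      rw [hwdef, map_smul, hw j hj, smul_comm]
    obtain ⟨U, hUw, hUs⟩ := ih (by omega) (hR.1.mono (by omega)) (fun j hj => hw' j (by omega))
    refine ⟨U, fun h => absurd h hν, fun _ => ⟨R, hR, hR1, hUs, ?_, fun _ => ⟨S, hS, hS1, hsw, ?_⟩⟩⟩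
    · exact hwt hR hUs (by rw [hUw]; exact hw' (k + 1) (by omega))
    · rw [hUw, hwdef, smul_inv_smul₀ hne]; abel
  choose U hU0 hU using hU
  have hUR : ∀ Γ ∈ chainsTo (k + 2) Γ₀, ∃ b, Adds (Γ (k + 1)) b (Γ₀ (k + 2)) := fun Γ hΓ => by
    obtain ⟨b, hb⟩ := hΓ.1.adds (k + 1) (by omega)
    rw [hΓ.2 _ le_rfl] at hb
    exact ⟨b, hb⟩
  have hweight : ∀ Γ ∈ chainsTo (k + 2) Γ₀, ∀ j < k + 2,
      jucysMurphy q g j (U (Γ (k + 1)) Γ) =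
        murphyEigenvalue q (stepContent Γ j) • U (Γ (k + 1)) Γ := fun Γ hΓ => by
    obtain ⟨R, hR, hR1, -, hRw, -⟩ := hU _ (hUR Γ hΓ)
    exact hRw Γ hΓ hR1.symm
  have hinner : ∀ j Γ Γ', j + 1 < k + 1 → Γ ∈ chainsTo (k + 2) Γ₀ → Γ' ∈ chainsTo (k + 2) Γ₀ →
      IsSwap j Γ Γ' → IsLastEdge q g (fun Γ => U (Γ (k + 1)) Γ) j Γ Γ' := by
    intro j Γ Γ' hj hΓ hΓ' hs
    obtain ⟨R, hR, hR1, hRs, -, -⟩ := hU _ (hUR Γ hΓ)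
    have e : Γ' (k + 1) = Γ (k + 1) := hs.2 _ (by omega)
    have := hRs.swap j Γ Γ' hj (hcomp hR hΓ hR1.symm) (hcomp hR hΓ' (by rw [e, hR1])) hs
    simpa only [IsLastEdge, e] using this
  have hlink : ∀ Γ Γ', Γ ∈ chainsTo (k + 2) Γ₀ → Γ' ∈ chainsTo (k + 2) Γ₀ → IsSwap k Γ Γ' →
      Γ (k + 1) = Γ₀ (k + 1) → IsLastEdge q g (fun Γ => U (Γ (k + 1)) Γ) k Γ Γ' := by
    intro Γ Γ' hΓ hΓ' hs he
    obtain ⟨R, hR, hR1, -, -, hlk⟩ := hU _ (hUR Γ' hΓ')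
    obtain ⟨S, hS, hS1, hsw, hE⟩ := hlk (by rw [← he]; exact hs.1)
    refine IsLastEdge.transport hg hq hkN hinner hS hR hΓ hΓ' hsw hs (by rw [he, hS1])
      hR1.symm ?_
    simp only [IsLastEdge, hS1, hR1, hU0 _ rfl]
    exact hE
  refine ⟨fun Γ => U (Γ (k + 1)) Γ, by simp only [hU0 _ rfl, hu₀v], ?_, ?_⟩
  · intro j Γ Γ' hj hΓ hΓ' hs
    rcases (show j + 1 < k + 1 ∨ j = k by omega) with hj | rfl
    · exact hinner j Γ Γ' hj hΓ hΓ' hs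
    -- Edges leaving the component of `Γ₀` are transports of the edges that defined the families;
    -- hexagons supply the remaining ones.
    · exact isLastEdge_of_component hg hq hkN hinner ⟨b₀, a₀⟩ hlink hΓ hΓ' hs
  · intro j Γ hj hΓ hd
    exact generator_apply_of_adjacent hg hq hsym (by omega) (hweight Γ hΓ j (by omega))
      (hweight Γ hΓ (j + 1) hj) hd

/-- The next Murphy eigenvalue of a weight vector belongs to an addable box. -/
theorem exists_addable_of_eigenvalue (hg : IsHeckeFamily N q g) (hq : 0 < q)
    (hsym : ∀ k < N, (g k).IsSymmetric) {m : ℕ} (hm : m ≤ N) {Γ : ℕ → YoungDiagram}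
    (h : IsStandardChain m Γ) {v : P} (hv0 : v ≠ 0)
    (hv : ∀ j < m, jucysMurphy q g j v = murphyEigenvalue q (stepContent Γ j) • v) {a : ℂ}
    (ha : jucysMurphy q g m v = a • v) :
    ∃ b μ, Adds (Γ m) b μ ∧ a = murphyEigenvalue q (boxContent b) := by
  induction m generalizing v a with
  | zero =>
    obtain ⟨μ, hμ⟩ := exists_adds_bot
    refine ⟨_, μ, by rw [h.zero]; exact hμ, ?_⟩
    have : a • v = 0 := by rw [← ha]; simp [jucysMurphy]
    rw [(smul_eq_zero.1 this).resolve_right hv0]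
    simp [boxContent, murphyEigenvalue]
  | succ m ih =>
  have hmN : m < N := by omega
  have hq' : (q : ℂ) ≠ 0 := by exact_mod_cast hq.ne'
  obtain ⟨b, hb⟩ := h.adds m (by omega)
  have hvm := hv m (by omega)
  rw [stepContent_eq hb] at hvm
  by_cases hab : a = murphyEigenvalue q (boxContent b)
  · rw [hab] at ha
    exact absurd (eq_zero_of_equal_eigenvalues hg hq hsym hmN hvm ha) hv0
  have hx : (((q : ℂ) - 1) * a + q) / (a - murphyEigenvalue q (boxContent b)) *
      (a - murphyEigenvalue q (boxContent b)) = ((q : ℂ) - 1) * a + q :=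
    div_mul_cancel₀ _ (sub_ne_zero.2 hab)
  generalize (((q : ℂ) - 1) * a + q) / (a - murphyEigenvalue q (boxContent b)) = x at hx
  obtain ⟨w1, -⟩ := jucysMurphy_apply_swapped hg hq hmN hvm ha hx
  by_cases hw : g m v - x • v = 0
  swap
  -- A nonzero intertwiner image keeps the first `m` weights and has `a` in place `m`, so `a`
  -- belongs to a box addable to `Γ m`; being different from `b`, it stays addable after `b`.
  · obtain ⟨b', μ', hb', rfl⟩ := ih (by omega) (h.mono (by omega)) hw
      (fun j hj => jucysMurphy_apply_swapped_of_ne hg hq hmN (by omega) (by omega) (by omega)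
        (hv j (by omega))) w1
    have hne : b ≠ b' := by rintro rfl; exact hab rfl
    exact ⟨b', _, (hb.sup hb' hne).1, rfl⟩
  have hgv : g m v = x • v := sub_eq_zero.1 hw
  have hroot : x = q ∨ x = -1 := by
    have e : g m (g m v) = ((q : ℂ) - 1) • g m v + (q : ℂ) • v := by
      simpa using congrArg (fun Y : Module.End ℂ P => Y v) (hg.quadratic m hmN)
    rw [hgv, map_smul, hgv, ← sub_eq_zero] at e
    have e2 : ((x - q) * (x + 1)) • v = 0 := by rw [← e]; module
    rcases mul_eq_zero.1 ((smul_eq_zero.1 e2).resolve_right hv0) with h | h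
    · exact Or.inl (sub_eq_zero.1 h)
    · exact Or.inr (eq_neg_of_add_eq_zero_left h)
  -- the next eigenvalue cannot repeat the previous but one
  have hrepeat : ∀ {b' : ℕ × ℕ} {ν : YoungDiagram}, Adds ν b' (Γ m) →
      (boxContent b - boxContent b' = 1 ∨ boxContent b - boxContent b' = -1) →
      a = murphyEigenvalue q (boxContent b') → False := by
    intro b' ν hν hd ha'
    have hcard := h.card_eq (p := m) (by omega)
    obtain ⟨j, rfl⟩ : ∃ j, m = j + 1 := ⟨m - 1, by have := hν.card_eq; omega⟩
    obtain ⟨Δ, hΔ1, hΔ2, hΔ3⟩ := exists_prefix (κ := ν) (k := j)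
      (by have := hν.card_eq; omega) Γ
    rw [← hΔ2, ← hΔ3 (j + 1) (by omega)] at hν
    have hΔ4 : IsStandardChain (j + 1) Δ := hΔ1.succ hν
    have hΔmem : Δ ∈ chainsTo (j + 1) Γ := ⟨hΔ4, fun p hp => hΔ3 p (by omega)⟩
    have hΓmem : Γ ∈ chainsTo (j + 1) Γ := ⟨h.mono (by omega), fun _ _ => rfl⟩
    obtain ⟨u, hu0, hu⟩ := exists_isSeminormal hg hq hsym (by omega) (h.mono (m' := j + 1) (by omega))
      (fun i hi => hv i (by omega))
    have y0 : u Δ ≠ 0 := fun hz => hv0 (hu0 ▸ hu.eq_zero hq hΔmem hΓmem hz)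
    have y1 := hu.jucysMurphy_apply hq (k := j) (by omega) hΔmem
    rw [stepContent_eq hν] at y1
    have y2 := hu.eigen_of_commute hq hΓmem hΔmem (X := jucysMurphy q g (j + 1))
      (fun i hi => hg.commute_jucysMurphy hq (by omega) (by omega) (by omega) (by omega))
      (by rw [hu0]; exact hvm)
    have y3 := hu.eigen_of_commute hq hΓmem hΔmem (X := jucysMurphy q g (j + 2))
      (fun i hi => hg.commute_jucysMurphy hq (by omega) (by omega) (by omega) (by omega))
      (by rw [hu0]; exact ha)
    rw [ha'] at y3
    have z1 := generator_apply_of_adjacent hg hq hsym (by omega) y1 y2 hd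
    have z2 := generator_apply_of_adjacent hg hq hsym hmN y2 y3 (by omega)
    -- The contents of `Δ` followed by `a` would be `c'`, `c`, `c'` with `c`, `c'` adjacent. Both
    -- generators then act on `u Δ` by scalars, `q` and `-1` in some order, and the braid relation
    -- would give `q (q + 1) = 0`.
    have hbr : g j (g (j + 1) (g j (u Δ))) = g (j + 1) (g j (g (j + 1) (u Δ))) := by
      simpa using congrArg (fun Y : Module.End ℂ P => Y (u Δ)) (hg.braid j hmN)
    rw [show boxContent b' - boxContent b = -(boxContent b - boxContent b') by ring] at z2
    have hq1 : (q : ℂ) * (q + 1) ≠ 0 :=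
      mul_ne_zero hq' (by exact_mod_cast (show q + 1 ≠ 0 by positivity))
    rcases hd with hd | hd <;>
    · rw [hd] at z1 z2
      simp only [neg_neg, diagCoeff_one, diagCoeff_neg_one hq] at z1 z2
      simp only [z1, z2, map_smul, smul_smul] at hbr
      rw [← sub_eq_zero, ← sub_smul] at hbr
      have := (smul_eq_zero.1 hbr).resolve_right y0
      apply hq1
      first
        | linear_combination this
        | linear_combination -this
  rcases hroot with rfl | rfl
  · have hae : a = murphyEigenvalue q (boxContent b + 1) := by
      rw [murphyEigenvalue_add_one hq]; linear_combination hx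
    rcases hb.exists_content_add_one with ⟨b', μ, hμ, hc⟩ | ⟨b', ν, hν, hc⟩
    · exact ⟨b', μ, hμ, by rw [hc, hae]⟩
    · exact (hrepeat hν (by omega) (by rw [hc, hae])).elim
  · have hae : a = murphyEigenvalue q (boxContent b - 1) := by
      have e2 := murphyEigenvalue_add_one hq (boxContent b - 1)
      rw [sub_add_cancel] at e2
      rw [e2] at hx
      refine mul_left_cancel₀ hq' ?_
      linear_combination -hx
    rcases hb.exists_content_sub_one with ⟨b', μ, hμ, hc⟩ | ⟨b', ν, hν, hc⟩
    · exact ⟨b', μ, hμ, by rw [hc, hae]⟩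
    · exact (hrepeat hν (by omega) (by rw [hc, hae])).elim

/-- The weight of a joint eigenvector of the Jucys–Murphy operators is given by a standard
chain. -/
theorem exists_isStandardChain_of_eigenvector (hg : IsHeckeFamily N q g) (hq : 0 < q)
    (hsym : ∀ k < N, (g k).IsSymmetric) {v : P} (hv0 : v ≠ 0) {a : ℕ → ℂ}
    (hv : ∀ j ≤ N, jucysMurphy q g j v = a j • v) {m : ℕ} (hm : m ≤ N + 1) :
    ∃ Γ, IsStandardChain m Γ ∧ (∀ p, m ≤ p → Γ p = Γ m) ∧
      ∀ j < m, a j = murphyEigenvalue q (stepContent Γ j) := by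
  induction m with
  | zero => exact ⟨fun _ => ⊥, ⟨rfl, by simp⟩, fun _ _ => rfl, by simp⟩
  | succ m ih =>
    obtain ⟨Γ, h1, -, h3⟩ := ih (by omega)
    obtain ⟨b, μ, hμ, ha⟩ := exists_addable_of_eigenvalue hg hq hsym (by omega) h1 hv0
      (fun j hj => by rw [hv j (by omega), h3 j hj]) (hv m (by omega))
    have e1 : ∀ p ≤ m, (fun p => if p ≤ m then Γ p else μ) p = Γ p := fun p hp => if_pos hp
    have e2 : ∀ p, m < p → (fun p => if p ≤ m then Γ p else μ) p = μ := fun p hp =>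
      if_neg (by omega)
    generalize (fun p => if p ≤ m then Γ p else μ) = Γ' at e1 e2
    have hc : IsStandardChain m Γ' := ⟨by rw [e1 0 (by omega), h1.zero], fun p hp => by
      rw [e1 p (by omega), e1 (p + 1) (by omega)]; exact h1.adds p hp⟩
    have hb : Adds (Γ' m) b (Γ' (m + 1)) := by rwa [e1 m le_rfl, e2 (m + 1) (by omega)]
    refine ⟨Γ', hc.succ hb, fun p hp => by rw [e2 p (by omega), e2 (m + 1) (by omega)],
      fun j hj => ?_⟩
    rcases (show j < m ∨ j = m by omega) with hj | rfl
    · rw [h3 j hj, stepContent_congr (e1 j (by omega)) (e1 (j + 1) (by omega))]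
    · rw [ha, stepContent_eq hb]

end Unitary

/-! ### A self-adjoint Hecke action on functions on the symmetric group. -/

section PermutationModule

variable {N : ℕ} {q : ℝ}

/-- The coefficient with which `w` occurs in its own image under the operator exchanging the
places `a` and `b`. -/
noncomputable def descentCoeff (q : ℝ) (a b : Fin (N + 1)) (w : Equiv.Perm (Fin (N + 1))) : ℂ :=
  if w b < w a then (q : ℂ) - 1 else 0

/-- The operator on functions on the symmetric group exchanging the places `a` and `b`. -/
noncomputable def exchange (q : ℝ) (a b : Fin (N + 1)) :
    Module.End ℂ (EuclideanSpace ℂ (Equiv.Perm (Fin (N + 1)))) where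
  toFun f := WithLp.toLp 2 fun w =>
    (Real.sqrt q : ℂ) * f (w * Equiv.swap a b) + descentCoeff q a b w * f w
  map_add' f f' := by ext w; simp; ring
  map_smul' c f := by ext w; simp; ring

theorem exchange_apply (a b : Fin (N + 1)) (f : EuclideanSpace ℂ (Equiv.Perm (Fin (N + 1))))
    (w : Equiv.Perm (Fin (N + 1))) :
    exchange q a b f w =
      (Real.sqrt q : ℂ) * f (w * Equiv.swap a b) + descentCoeff q a b w * f w := rfl

/-- The off-diagonal entry is `√q` in both directions, instead of the usual `1` and `q`; the
diagonal is real. -/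
theorem exchange_isSymmetric (a b : Fin (N + 1)) : (exchange q a b).IsSymmetric := by
  intro f f'
  simp only [PiLp.inner_apply, exchange_apply, RCLike.inner_apply, map_add, map_mul, mul_add, add_mul,
    Finset.sum_add_distrib]
  congr 1
  · refine (Equiv.sum_comp (Equiv.mulRight (Equiv.swap a b)) _).symm.trans
      (Finset.sum_congr rfl fun w _ => ?_)
    simp only [Equiv.coe_mulRight, mul_assoc, Equiv.swap_mul_self, mul_one, Complex.conj_ofReal]
    ring
  · refine Finset.sum_congr rfl fun w _ => ?_
    have : (starRingEnd ℂ) (descentCoeff q a b w) = descentCoeff q a b w := by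
      unfold descentCoeff
      split_ifs <;> simp
    rw [this]; ring

theorem exchange_mul_self (hq : 0 < q) {a b : Fin (N + 1)} (hab : a ≠ b) :
    exchange q a b * exchange q a b =
      ((q : ℂ) - 1) • exchange q a b + (q : ℂ) • 1 := by
  have hr : (Real.sqrt q : ℂ) * Real.sqrt q = q := by
    exact_mod_cast Real.mul_self_sqrt hq.le
  ext f w
  -- Exactly one of `w` and `w * swap a b` has a descent at the pair.
  have hD : descentCoeff q a b (w * Equiv.swap a b) = (q : ℂ) - 1 - descentCoeff q a b w := by
    have : w a ≠ w b := fun h => hab (w.injective h)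
    simp only [descentCoeff, Equiv.Perm.mul_apply, Equiv.swap_apply_left, Equiv.swap_apply_right]
    rcases lt_or_gt_of_ne this with h | h <;> simp [h, h.not_gt]
  have hD2 : descentCoeff q a b w * descentCoeff q a b w =
      ((q : ℂ) - 1) * descentCoeff q a b w := by
    unfold descentCoeff; split_ifs <;> ring
  simp only [Module.End.mul_apply, exchange_apply, LinearMap.add_apply, LinearMap.smul_apply,
    Module.End.one_apply, PiLp.add_apply, PiLp.smul_apply, smul_eq_mul, hD, mul_assoc,
    Equiv.swap_mul_self, mul_one]
  linear_combination f w * hr + f w * hD2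

theorem exchange_braid {a b c : Fin (N + 1)} (hab : a ≠ b) (hbc : b ≠ c)
    (hac : a ≠ c) : exchange q a b * exchange q b c * exchange q a b =
      exchange q b c * exchange q a b * exchange q b c := by
  ext f w
  have hs : Equiv.swap a b * Equiv.swap b c * Equiv.swap a b =
      Equiv.swap b c * Equiv.swap a b * Equiv.swap b c := by
    rw [Equiv.swap_mul_swap_mul_swap hab hac, Equiv.swap_comm a b, Equiv.swap_comm b c,
      Equiv.swap_mul_swap_mul_swap hbc.symm hac.symm, Equiv.swap_comm]
  have e1 : w * Equiv.swap a b * Equiv.swap b c * Equiv.swap a b =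
      w * Equiv.swap b c * Equiv.swap a b * Equiv.swap b c := by
    simpa only [mul_assoc] using congrArg (w * ·) hs
  have e2 : w * Equiv.swap a b * Equiv.swap a b = w := by simp [mul_assoc]
  have e3 : w * Equiv.swap b c * Equiv.swap b c = w := by simp [mul_assoc]
  have h1 : w a ≠ w b := fun h => hab (w.injective h)
  have h2 : w b ≠ w c := fun h => hbc (w.injective h)
  have h3 : w a ≠ w c := fun h => hac (w.injective h)
  have s1 : Equiv.swap a b c = c := Equiv.swap_apply_of_ne_of_ne hac.symm hbc.symm
  have s2 : Equiv.swap b c a = a := Equiv.swap_apply_of_ne_of_ne hab hac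
  simp only [Module.End.mul_apply, exchange_apply, e1, e2, e3]
  simp only [descentCoeff, Equiv.Perm.mul_apply, Equiv.swap_apply_left, Equiv.swap_apply_right,
    s1, s2]
  -- Only the relative order of `w a`, `w b`, `w c` matters: two of the eight sign patterns are
  -- cyclic and impossible, the other six are polynomial identities.
  rcases lt_or_gt_of_ne h1 with h1 | h1 <;> rcases lt_or_gt_of_ne h2 with h2 | h2 <;>
    rcases lt_or_gt_of_ne h3 with h3 | h3 <;>
    first
      | (exfalso; exact absurd (h1.trans h2) h3.not_gt)
      | (exfalso; exact absurd (h2.trans h1) h3.not_gt)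
      | (simp only [h1, h2, h3, h1.not_gt, h2.not_gt, h3.not_gt, if_true, if_false]; ring)

theorem exchange_comm {a b c d : Fin (N + 1)} (hac : a ≠ c) (had : a ≠ d) (hbc : b ≠ c)
    (hbd : b ≠ d) : exchange q a b * exchange q c d = exchange q c d * exchange q a b := by
  ext f w
  have hs : Equiv.swap a b * Equiv.swap c d = Equiv.swap c d * Equiv.swap a b := by
    refine (Equiv.Perm.Disjoint.commute fun x => ?_).eq
    by_cases h1 : x = a
    · right; rw [h1, Equiv.swap_apply_of_ne_of_ne hac had]
    by_cases h2 : x = b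
    · right; rw [h2, Equiv.swap_apply_of_ne_of_ne hbc hbd]
    left; rw [Equiv.swap_apply_of_ne_of_ne h1 h2]
  have e1 : w * Equiv.swap a b * Equiv.swap c d = w * Equiv.swap c d * Equiv.swap a b := by
    simp only [mul_assoc, hs]
  have e2 : descentCoeff q c d (w * Equiv.swap a b) = descentCoeff q c d w := by
    simp [descentCoeff, Equiv.swap_apply_of_ne_of_ne hac.symm hbc.symm,
      Equiv.swap_apply_of_ne_of_ne had.symm hbd.symm]
  have e3 : descentCoeff q a b (w * Equiv.swap c d) = descentCoeff q a b w := by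
    simp [descentCoeff, Equiv.swap_apply_of_ne_of_ne hac had,
      Equiv.swap_apply_of_ne_of_ne hbc hbd]
  simp only [Module.End.mul_apply, exchange_apply, e1, e2, e3]
  ring

/-- The generators of the Hecke algebra acting on functions on the symmetric group. -/
noncomputable def permGenerator (N : ℕ) (q : ℝ) (k : ℕ) :
    Module.End ℂ (EuclideanSpace ℂ (Equiv.Perm (Fin (N + 1)))) :=
  if h : k < N then exchange q (Fin.castSucc ⟨k, h⟩) (Fin.succ ⟨k, h⟩) else 0

theorem isHeckeFamily_permGenerator (hq : 0 < q) : IsHeckeFamily N q (permGenerator N q) where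
  quadratic i hi := by
    simp only [permGenerator, hi, dif_pos]
    exact exchange_mul_self hq (by simp [Fin.ext_iff])
  braid i hi := by
    simp only [permGenerator, hi, show i < N by omega, dif_pos]
    refine exchange_braid ?_ ?_ ?_ <;> (simp [Fin.ext_iff]; try omega)
  comm i j hij hj := by
    simp only [permGenerator, hj, show i < N by omega, dif_pos]
    refine exchange_comm ?_ ?_ ?_ ?_ <;> simp [Fin.ext_iff] <;> omega

theorem permGenerator_isSymmetric (k : ℕ) : (permGenerator N q k).IsSymmetric := by
  unfold permGenerator
  split_ifs
  · exact exchange_isSymmetric _ _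
  · exact LinearMap.IsSymmetric.zero

/-- The function supported at the identity generates all functions. -/
theorem permGenerator_cyclic (hq : 0 < q)
    (S : Submodule ℂ (EuclideanSpace ℂ (Equiv.Perm (Fin (N + 1)))))
    (h1 : EuclideanSpace.single 1 1 ∈ S) (hS : ∀ k < N, ∀ f ∈ S, permGenerator N q k f ∈ S) :
    S = ⊤ := by
  have hr : (Real.sqrt q : ℂ) ≠ 0 := by
    exact_mod_cast (Real.sqrt_pos.2 hq).ne'
  have key : ∀ w : Equiv.Perm (Fin (N + 1)), EuclideanSpace.single w (1 : ℂ) ∈ S := by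
    intro w
    have hw : w ∈ Submonoid.closure (Set.range fun i : Fin N => Equiv.swap i.castSucc i.succ) := by
      rw [Equiv.Perm.mclosure_swap_castSucc_succ]; trivial
    induction hw using Submonoid.closure_induction_right with
    | one => exact h1
    | mul_right w _ y hy ih =>
      obtain ⟨i, rfl⟩ := hy
      have h2 := hS i i.2 _ ih
      have e : permGenerator N q i (EuclideanSpace.single w (1 : ℂ)) =
          (Real.sqrt q : ℂ) • EuclideanSpace.single (w * Equiv.swap i.castSucc i.succ) (1 : ℂ) +
          descentCoeff q i.castSucc i.succ w • EuclideanSpace.single w (1 : ℂ) := by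
        simp only [permGenerator, i.2, dif_pos]
        ext x
        rw [exchange_apply]
        have hx : x * Equiv.swap i.castSucc i.succ = w ↔
            x = w * Equiv.swap i.castSucc i.succ := by
          rw [← Equiv.swap_inv i.castSucc i.succ, ← eq_mul_inv_iff_mul_eq, inv_inv]
          simp
        simp only [PiLp.add_apply, PiLp.smul_apply, PiLp.single_apply, smul_eq_mul, hx,
          Fin.eta]
        congr 1
        by_cases hxw : x = w
        · rw [hxw]
        · simp [hxw]
      rw [e] at h2
      have h3 := S.sub_mem h2 (S.smul_mem (descentCoeff q i.castSucc i.succ w) ih)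
      rw [add_sub_cancel_right] at h3
      exact (S.smul_mem_iff hr).1 h3
  rw [eq_top_iff, ← (EuclideanSpace.basisFun (Equiv.Perm (Fin (N + 1))) ℂ).toBasis.span_eq,
    Submodule.span_le]
  rintro _ ⟨w, rfl⟩
  simpa using key w

end PermutationModule

/-! ### The bound `(N + 1)!` on the dimension, by normal forms. -/

section Dimension

variable {N : ℕ} {q : ℝ} {R : Type*} [Ring R]

/-- The descending product `g m * g (m - 1) * ⋯` of `j` factors. -/
def descendingProd (g : ℕ → R) (m : ℕ) : ℕ → R
  | 0 => 1
  | j + 1 => descendingProd g m j * g (m - j)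

theorem descendingProd_commute [Algebra ℂ R] {g : ℕ → R} (hg : IsHeckeFamily N q g)
    {m j i : ℕ} (hm : m < N) (hi : i + j < m) : descendingProd g m j * g i = g i * descendingProd g m j := by
  induction j with
  | zero => simp [descendingProd]
  | succ j ih =>
    rw [descendingProd, mul_assoc, ← hg.comm i (m - j) (by omega) (by omega), ← mul_assoc,
      ih (by omega), mul_assoc]

/-- The hypotheses say that `i + 1` and `i` both occur among the letters. The factor `g (i + 1)`
passes the smaller letters, meets `g (i + 1) * g i`, and a braid move releases `g i` on the left. -/
theorem descendingProd_shift [Algebra ℂ R] {g : ℕ → R} (hg : IsHeckeFamily N q g)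
    {m j i : ℕ} (hm : m < N) (hi : i < m) (hj : j ≤ m + 1) (hij : m + 1 < i + 1 + j) :
    descendingProd g m j * g (i + 1) = g i * descendingProd g m j := by
  induction j with
  | zero => omega
  | succ j ih =>
    rcases (show m + 1 < i + 1 + j ∨ m = i + j by omega) with h | h
    · rw [descendingProd, mul_assoc, hg.comm (m - j) (i + 1) (by omega) (by omega), ← mul_assoc,
        ih (by omega) h, mul_assoc]
    · obtain ⟨j, rfl⟩ : ∃ j', j = j' + 1 := ⟨j - 1, by omega⟩
      have e1 : m - j = i + 1 := by omega
      have e2 : m - (j + 1) = i := by omega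
      rw [descendingProd, descendingProd, e1, e2, mul_assoc, mul_assoc, ← mul_assoc (g (i + 1)),
        ← hg.braid i (by omega), ← mul_assoc, ← mul_assoc,
        descendingProd_commute hg hm (by omega)]
      simp only [mul_assoc]

open Classical in
/-- A spanning set of the subalgebra generated by `g 0, …, g (m - 1)`. -/
noncomputable def heckeWords (g : ℕ → R) : ℕ → Finset R
  | 0 => {1}
  | m + 1 => Finset.image₂ (· * ·) (heckeWords g m)
      ((Finset.range (m + 2)).image (descendingProd g m))

theorem card_heckeWords (g : ℕ → R) (m : ℕ) : (heckeWords g m).card ≤ (m + 1).factorial := by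
  classical
  induction m with
  | zero => simp [heckeWords]
  | succ m ih =>
    rw [heckeWords]
    refine (Finset.card_image₂_le _ _ _).trans ?_
    rw [Nat.factorial_succ, mul_comm (m + 1 + 1)]
    exact Nat.mul_le_mul ih (Finset.card_image_le.trans (by simp))

theorem one_mem_heckeWords (g : ℕ → R) (m : ℕ) : 1 ∈ heckeWords g m := by
  classical
  induction m with
  | zero => simp [heckeWords]
  | succ m ih =>
    rw [heckeWords]
    exact Finset.mem_image₂.2 ⟨1, ih, 1, Finset.mem_image.2 ⟨0, by simp, rfl⟩, by simp⟩

theorem mul_mem_span_heckeWords [Algebra ℂ R] {g : ℕ → R} (hg : IsHeckeFamily N q g)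
    {m : ℕ} (hm : m ≤ N) {i : ℕ} (hi : i < m) {x : R} (hx : x ∈ Submodule.span ℂ (heckeWords g m : Set R)) :
    x * g i ∈ Submodule.span ℂ (heckeWords g m : Set R) := by
  classical
  induction m generalizing i x with
  | zero => omega
  | succ m ih =>
    have hmul : ∀ y ∈ Submodule.span ℂ (heckeWords g m : Set R), ∀ j < m + 2,
        y * descendingProd g m j ∈ Submodule.span ℂ (heckeWords g (m + 1) : Set R) := by
      intro y hy j hj
      induction hy using Submodule.span_induction with
      | mem y hy =>
        refine Submodule.subset_span ?_
        rw [heckeWords]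
        exact Finset.mem_coe.2 (Finset.mem_image₂.2
          ⟨y, hy, _, Finset.mem_image.2 ⟨j, by simpa using hj, rfl⟩, rfl⟩)
      | zero => simp
      | add y z _ _ hy hz => rw [add_mul]; exact add_mem hy hz
      | smul c y _ hy => rw [smul_mul_assoc]; exact Submodule.smul_mem _ _ hy
    induction hx using Submodule.span_induction with
    | zero => simp
    | add y z _ _ hy hz => rw [add_mul]; exact add_mem hy hz
    | smul c y _ hy => rw [smul_mul_assoc]; exact Submodule.smul_mem _ _ hy
    | mem x hx =>
      rw [heckeWords] at hx
      obtain ⟨y, hy, _, hw, rfl⟩ := Finset.mem_image₂.1 (Finset.mem_coe.1 hx)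
      obtain ⟨j, hj, rfl⟩ := Finset.mem_image.1 hw
      rw [Finset.mem_range] at hj
      have hy' : y ∈ Submodule.span ℂ (heckeWords g m : Set R) := Submodule.subset_span hy
      show y * descendingProd g m j * g i ∈ _
      -- The last letter of the descending product is `m - j + 1` when `j > 0`. A smaller distant
      -- `i` commutes past, the next index prolongs the product, an equal one is reduced
      -- quadratically, and a larger one passes through with its index lowered.
      rcases (show i + j < m ∨ i + j = m ∨ i + j = m + 1 ∨ m + 1 < i + j by omega) with
        h | h | h | h
      · rw [mul_assoc, descendingProd_commute hg (by omega) h, ← mul_assoc]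
        exact hmul _ (ih (by omega) (by omega) hy') j hj
      · obtain rfl : i = m - j := by omega
        rw [mul_assoc, ← descendingProd]
        exact hmul _ hy' _ (by omega)
      · obtain ⟨j, rfl⟩ : ∃ j', j = j' + 1 := ⟨j - 1, by omega⟩
        obtain rfl : i = m - j := by omega
        have e : y * descendingProd g m (j + 1) * g (m - j) =
            ((q : ℂ) - 1) • (y * descendingProd g m (j + 1)) +
              (q : ℂ) • (y * descendingProd g m j) := by
          rw [descendingProd, mul_assoc, mul_assoc, hg.quadratic _ (by omega)]
          simp only [mul_add, mul_smul_comm, mul_one]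
        rw [e]
        exact add_mem (Submodule.smul_mem _ _ (hmul _ hy' _ hj))
          (Submodule.smul_mem _ _ (hmul _ hy' _ (by omega)))
      · obtain ⟨i, rfl⟩ : ∃ i', i = i' + 1 := ⟨i - 1, by omega⟩
        rw [mul_assoc, descendingProd_shift hg (by omega) (by omega) (by omega) (by omega),
          ← mul_assoc]
        exact hmul _ (ih (by omega) (by omega) hy') j hj

end Dimension

/-! ### The regular representation as the permutation module. -/

namespace HeckeAlgebra

variable {N : ℕ} {q : ℝ}

/-- The homomorphism from the Hecke algebra defined by a Hecke family. -/
noncomputable def lift {R : Type*} [Ring R] [Algebra ℂ R] {x : ℕ → R} (hx : IsHeckeFamily N q x) :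
    HeckeAlgebra (N + 1) q →ₐ[ℂ] R :=
  RingQuot.liftAlgHom ℂ ⟨FreeAlgebra.lift ℂ fun i : Set.Ico 1 (N + 1) => x (i - 1), by
    intro a b h
    induction h with
    | quadratic i =>
      have := i.2.1
      have := i.2.2
      rw [map_mul, map_add, map_smul, AlgHom.commutes, Algebra.algebraMap_eq_smul_one,
        FreeAlgebra.lift_ι_apply]
      exact hx.quadratic (i - 1) (by omega)
    | braid i j h =>
      have := i.2.1
      have := j.2.2
      have e : (j : ℕ) - 1 = (i : ℕ) - 1 + 1 := by omega
      simpa [e] using hx.braid (i - 1) (by omega)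
    | comm i j h =>
      have := i.2.1
      have := j.2.2
      simpa using hx.comm (i - 1) (j - 1) (by omega) (by omega)⟩

theorem lift_g {R : Type*} [Ring R] [Algebra ℂ R] {x : ℕ → R} (hx : IsHeckeFamily N q x) {k : ℕ}
    (hk : k < N) : lift hx (g (N + 1) q (k + 1)) = x k := by
  have h : k + 1 ∈ Set.Ico 1 (N + 1) := ⟨by omega, by omega⟩
  rw [lift, g, dif_pos h, RingQuot.liftAlgHom_mkAlgHom_apply]
  simp

/-- Induction over words in the generators. -/
theorem induction_g {p : HeckeAlgebra (N + 1) q → Prop} (hc : ∀ c : ℂ, p (algebraMap ℂ _ c))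
    (hg : ∀ k < N, p (g (N + 1) q (k + 1))) (hmul : ∀ a b, p a → p b → p (a * b))
    (hadd : ∀ a b, p a → p b → p (a + b)) (h : HeckeAlgebra (N + 1) q) : p h := by
  obtain ⟨y, rfl⟩ := RingQuot.mkAlgHom_surjective ℂ (HeckeRel (N + 1) q) h
  induction y with
  | grade0 c => rw [AlgHom.commutes]; exact hc c
  | grade1 i =>
    have h1 := i.2.1
    have h2 := i.2.2
    have := hg (i - 1) (by omega)
    have e : (i : ℕ) - 1 + 1 = i := by omega
    rw [e, g, dif_pos i.2] at this
    exact this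
  | mul a b ha hb => rw [map_mul]; exact hmul _ _ ha hb
  | add a b ha hb => rw [map_add]; exact hadd _ _ ha hb

theorem span_heckeWords :
    Submodule.span ℂ (heckeWords (fun k => g (N + 1) q (k + 1)) N : Set (HeckeAlgebra (N + 1) q)) =
      ⊤ := by
  set S := Submodule.span ℂ
    (heckeWords (fun k => g (N + 1) q (k + 1)) N : Set (HeckeAlgebra (N + 1) q)) with hS
  have key : ∀ h : HeckeAlgebra (N + 1) q, ∀ x ∈ S, x * h ∈ S := by
    intro h
    induction h using induction_g with
    | hc c =>
      intro x hx
      rw [← Algebra.commutes, ← Algebra.smul_def]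
      exact S.smul_mem c hx
    | hg k hk => exact fun x hx => mul_mem_span_heckeWords (isHeckeFamily_g (N + 1) q) le_rfl hk hx
    | hmul a b ha hb => exact fun x hx => by rw [← mul_assoc]; exact hb _ (ha _ hx)
    | hadd a b ha hb => exact fun x hx => by rw [mul_add]; exact add_mem (ha _ hx) (hb _ hx)
  rw [eq_top_iff]
  intro h _
  simpa using key h 1 (Submodule.subset_span (one_mem_heckeWords _ _))

instance : Module.Finite ℂ (HeckeAlgebra (N + 1) q) := ⟨⟨_, span_heckeWords⟩⟩

theorem finrank_le : Module.finrank ℂ (HeckeAlgebra (N + 1) q) ≤ (N + 1).factorial := by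
  refine le_trans ?_ (card_heckeWords (fun k => g (N + 1) q (k + 1)) N)
  have := finrank_span_finset_le_card (R := ℂ) (heckeWords (fun k => g (N + 1) q (k + 1)) N)
  rwa [Set.finrank, span_heckeWords, finrank_top] at this

/-- The action of the Hecke algebra on functions on the symmetric group. -/
noncomputable def permAction (N : ℕ) (hq : 0 < q) : HeckeAlgebra (N + 1) q →ₐ[ℂ]
    Module.End ℂ (EuclideanSpace ℂ (Equiv.Perm (Fin (N + 1)))) :=
  lift (isHeckeFamily_permGenerator hq)

/-- The orbit map of the function supported at the identity. -/
noncomputable def orbitMap (N : ℕ) (hq : 0 < q) : HeckeAlgebra (N + 1) q →ₗ[ℂ]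
    EuclideanSpace ℂ (Equiv.Perm (Fin (N + 1))) :=
  (LinearMap.applyₗ (EuclideanSpace.single 1 1)).comp (permAction N hq).toLinearMap

theorem orbitMap_mul (hq : 0 < q) (h x : HeckeAlgebra (N + 1) q) :
    orbitMap N hq (h * x) = permAction N hq h (orbitMap N hq x) := by
  simp [orbitMap]

/-- Cyclicity bounds the dimension of the algebra below by the order of the symmetric group, the
normal forms bound it above by the same number. -/
theorem orbitMap_bijective (hq : 0 < q) : Function.Bijective (orbitMap N hq) := by
  have hsurj : LinearMap.range (orbitMap N hq) = ⊤ := by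
    refine permGenerator_cyclic hq _ ⟨1, by simp [orbitMap]⟩ ?_
    rintro k hk _ ⟨h, rfl⟩
    exact ⟨g (N + 1) q (k + 1) * h, by rw [orbitMap_mul, permAction, lift_g _ hk]⟩
  have hs := LinearMap.range_eq_top.1 hsurj
  refine ⟨?_, hs⟩
  have h1 : Module.finrank ℂ (HeckeAlgebra (N + 1) q) =
      Module.finrank ℂ (EuclideanSpace ℂ (Equiv.Perm (Fin (N + 1)))) := by
    refine le_antisymm ?_ (LinearMap.finrank_le_finrank_of_surjective hs)
    rw [finrank_euclideanSpace, Fintype.card_perm, Fintype.card_fin]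
    exact finrank_le
  exact (LinearMap.injective_iff_surjective_of_finrank_eq_finrank h1).2 hs

/-- The orbit map identifies the regular representation with a unitary one. -/
noncomputable def orbitEquiv (N : ℕ) (hq : 0 < q) : HeckeAlgebra (N + 1) q ≃ₗ[ℂ]
    EuclideanSpace ℂ (Equiv.Perm (Fin (N + 1))) :=
  LinearEquiv.ofBijective _ (orbitMap_bijective hq)

/-- The Jucys–Murphy elements of the Hecke algebra. -/
noncomputable abbrev murphyElement (N : ℕ) (q : ℝ) (k : ℕ) : HeckeAlgebra (N + 1) q :=
  jucysMurphy q (fun k => g (N + 1) q (k + 1)) k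

theorem jucysMurphy_congr {R : Type*} [Ring R] [Algebra ℂ R] {x y : ℕ → R}
    (h : ∀ k < N, x k = y k) {k : ℕ} (hk : k ≤ N) : jucysMurphy q x k = jucysMurphy q y k := by
  induction k with
  | zero => rfl
  | succ k ih => rw [jucysMurphy, jucysMurphy, ih (by omega), h k (by omega)]

theorem permAction_murphyElement (hq : 0 < q) {k : ℕ} (hk : k ≤ N) :
    permAction N hq (murphyElement N q k) = jucysMurphy q (permGenerator N q) k := by
  rw [map_jucysMurphy]
  exact jucysMurphy_congr (fun k hk => lift_g _ hk) hk

/-- A linear map on the permutation module that vanishes on all weight vectors vanishes. -/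
theorem eq_zero_of_weight_vectors (hq : 0 < q) {M : Type*} [AddCommGroup M] [Module ℂ M]
    (ψ : EuclideanSpace ℂ (Equiv.Perm (Fin (N + 1))) →ₗ[ℂ] M)
    (hψ : ∀ (Γ : ℕ → YoungDiagram) (v : EuclideanSpace ℂ (Equiv.Perm (Fin (N + 1)))),
      IsStandardChain (N + 1) Γ → (∀ p, N + 1 ≤ p → Γ p = Γ (N + 1)) →
      (∀ k < N + 1, jucysMurphy q (permGenerator N q) k v =
        murphyEigenvalue q (stepContent Γ k) • v) → ψ v = 0) : ψ = 0 := by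
  have hg := isHeckeFamily_permGenerator (N := N) hq
  have hsym : ∀ k < N, (permGenerator N q k).IsSymmetric := fun k _ => permGenerator_isSymmetric k
  -- Commuting self-adjoint operators in finite dimension: the joint eigenspaces span.
  have htop := LinearMap.IsSymmetric.iSup_iInf_eq_top_of_commute
    (T := fun k : Fin (N + 1) => jucysMurphy q (permGenerator N q) (k : ℕ))
    (fun k => jucysMurphy_isSymmetric hsym (by omega))
    (fun j k _ => hg.jucysMurphy_commute hq (by omega) (by omega))
  rw [← LinearMap.ker_eq_top, eq_top_iff, ← htop, iSup_le_iff]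
  intro χ v hv
  rw [Submodule.mem_iInf] at hv
  by_cases hv0 : v = 0
  · rw [hv0]; exact zero_mem _
  have hv' : ∀ k ≤ N, jucysMurphy q (permGenerator N q) k v =
      (fun k => if h : k < N + 1 then χ ⟨k, h⟩ else 0) k • v := fun k hk => by
    have := Module.End.mem_eigenspace_iff.1 (hv ⟨k, by omega⟩)
    simpa [show k < N + 1 by omega] using this
  obtain ⟨Γ, h1, h2, h3⟩ :=
    exists_isStandardChain_of_eigenvector hg hq hsym hv0 hv' (m := N + 1) le_rfl
  exact hψ Γ v h1 h2 fun k hk => by rw [hv' k (by omega), ← h3 k hk]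

end HeckeAlgebra

/-! ### Standard tableaux as chains, and the seminormal matrix entries. -/

namespace StandardTableau

variable {n : ℕ} {μ : YoungDiagram}

theorem card_of_nonempty (T : StandardTableau n μ) : μ.card = n := by
  rw [← T.shape_last, T.card_shape, min_self]

theorem shape_mem_chainsTo (T : StandardTableau n μ) : T.shape ∈ chainsTo n fun _ => μ := by
  refine ⟨⟨?_, fun p hp => ?_⟩, fun j hj => ?_⟩
  · rw [← card_eq_zero_iff, T.card_shape, Nat.zero_min]
  · exact exists_adds_of_card (T.mono (Nat.le_succ p)) (by
      rw [T.card_shape, T.card_shape]; omega)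
  · have hle : μ ≤ T.shape j := by
      have := T.mono hj
      rwa [T.shape_last] at this
    refine (SetLike.coe_injective ?_)
    have h1 : μ.cells = (T.shape j).cells := by
      refine Finset.eq_of_subset_of_card_le (cells_subset_iff.2 hle) ?_
      change (T.shape j).card ≤ μ.card
      rw [T.card_shape, T.card_of_nonempty]; omega
    ext c
    change c ∈ (T.shape j).cells ↔ c ∈ μ.cells
    rw [h1]

/-- The standard tableau of a chain. -/
def ofChain {Γ : ℕ → YoungDiagram} (h : Γ ∈ chainsTo n fun _ => μ) : StandardTableau n μ where
  shape := Γ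
  mono := by
    refine monotone_nat_of_le_succ fun p => ?_
    by_cases hp : p < n
    · obtain ⟨b, hb⟩ := h.1.adds p hp
      exact hb.le
    · rw [h.2 p (by omega), h.2 (p + 1) (by omega)]
  card_shape p := by
    rcases le_total p n with hp | hp
    · rw [h.1.card_eq hp, min_eq_left hp]
    · rw [min_eq_right hp, h.2 p hp, ← h.2 n le_rfl, h.1.card_eq le_rfl]
  shape_last := h.2 n le_rfl

theorem content_succ (T : StandardTableau n μ) (k : ℕ) :
    T.content (k + 1) = stepContent T.shape k := rfl

theorem isSwap_iff {T T' : StandardTableau n μ} {k : ℕ} :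
    IsSwap k T.shape T'.shape ↔ T' ≠ T ∧ ∀ p, p ≠ k + 1 → T'.shape p = T.shape p := by
  refine and_congr_left fun h => not_congr ⟨fun e => ?_, fun e => by rw [e]⟩
  ext1
  funext p
  by_cases hp : p = k + 1
  · rw [hp, e]
  · exact h p hp

theorem seminormalEntry_self (q : ℝ) (k : ℕ) (T : StandardTableau n μ) :
    (seminormalEntry q (k + 1) T T : ℂ) = diagCoeff q (axialDistance T.shape k) := by
  simp [seminormalEntry, diagCoeff, axialDistance, content_succ]

theorem seminormalEntry_swap (q : ℝ) {k : ℕ} {T T' : StandardTableau n μ}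
    (h : IsSwap k T.shape T'.shape) :
    (seminormalEntry q (k + 1) T' T : ℂ) = swapCoeff q (axialDistance T.shape k) := by
  obtain ⟨h1, h2⟩ := isSwap_iff.1 h
  rw [seminormalEntry, if_neg h1, if_pos h2]
  rfl

theorem seminormalEntry_eq_zero (q : ℝ) {k : ℕ} {T T' : StandardTableau n μ} (hne : T' ≠ T)
    (h : ¬ IsSwap k T.shape T'.shape) : (seminormalEntry q (k + 1) T' T : ℂ) = 0 := by
  rw [seminormalEntry, if_neg hne, if_neg fun h2 => h (isSwap_iff.2 ⟨hne, h2⟩)]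
  simp

/-- The coordinates of a vector given by the seminormal formula, in the presence of a swap. -/
theorem repr_swap {q : ℝ} {V : Type*} [AddCommGroup V] [Module ℂ V]
    (b : Module.Basis (StandardTableau n μ) ℂ V) {k : ℕ} (hk : k + 1 < n)
    {T S : StandardTableau n μ} (h : IsSwap k T.shape S.shape) (T' : StandardTableau n μ) :
    b.repr (diagCoeff q (axialDistance T.shape k) • b T +
      swapCoeff q (axialDistance T.shape k) • b S) T' = (seminormalEntry q (k + 1) T' T : ℂ) := by
  classical
  simp only [map_add, map_smul, Module.Basis.repr_self, Finsupp.add_apply, Finsupp.smul_apply,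
    Finsupp.single_apply, smul_eq_mul]
  have hne := (isSwap_iff.1 h).1
  by_cases e1 : T' = T
  · subst e1
    rw [seminormalEntry_self]; simp [hne]
  by_cases e2 : T' = S
  · subst e2
    rw [seminormalEntry_swap q h]; simp [hne.symm]
  rw [seminormalEntry_eq_zero q e1 fun h' => e2 ?_]
  · simp [Ne.symm e1, Ne.symm e2]
  · ext1
    exact T.shape_mem_chainsTo.1.eq_of_isSwap T'.shape_mem_chainsTo.1 S.shape_mem_chainsTo.1 hk h' h

theorem repr_adjacent {q : ℝ} {V : Type*} [AddCommGroup V] [Module ℂ V]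
    (b : Module.Basis (StandardTableau n μ) ℂ V) {k : ℕ} (hk : k + 1 < n)
    {T : StandardTableau n μ}
    (hd : axialDistance T.shape k = 1 ∨ axialDistance T.shape k = -1) (T' : StandardTableau n μ) :
    b.repr (diagCoeff q (axialDistance T.shape k) • b T) T' =
      (seminormalEntry q (k + 1) T' T : ℂ) := by
  classical
  simp only [map_smul, Module.Basis.repr_self, Finsupp.smul_apply, Finsupp.single_apply,
    smul_eq_mul]
  by_cases e1 : T' = T
  · subst e1
    rw [seminormalEntry_self]; simp
  rw [seminormalEntry_eq_zero q e1 fun h' => ?_]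
  · simp [Ne.symm e1]
  · obtain ⟨-, -, h1, h2⟩ :=
      axialDistance_swap T.shape_mem_chainsTo T'.shape_mem_chainsTo hk h'
    tauto

end StandardTableau

/-! ### Irreducible representations are labelled by Young diagrams. -/

namespace HeckeAlgebra

variable {N : ℕ} {q : ℝ}

/-- A labelled representation has a seminormal family. -/
theorem exists_isSeminormal_of_isLabelledBy {V : Type*} [AddCommGroup V] [Module ℂ V]
    {ρ : HeckeAlgebra (N + 1) q →ₐ[ℂ] Module.End ℂ V} {μ : YoungDiagram}
    (b : Module.Basis (StandardTableau (N + 1) μ) ℂ V)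
    (hb : ∀ i ∈ Set.Ico 1 (N + 1), ∀ T T' : StandardTableau (N + 1) μ,
      b.repr (ρ (g (N + 1) q i) (b T)) T' =
        ((StandardTableau.seminormalEntry q i T' T : ℝ) : ℂ)) :
    ∃ u : (ℕ → YoungDiagram) → V, (∀ T, u T.shape = b T) ∧
      IsSeminormal q (fun k => ρ (g (N + 1) q (k + 1))) (N + 1) (fun _ => μ) u := by
  classical
  refine ⟨fun Γ => if h : Γ ∈ chainsTo (N + 1) (fun _ => μ) then
    b (StandardTableau.ofChain h) else 0, fun T => ?_, ?_, ?_⟩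
  · exact dif_pos T.shape_mem_chainsTo
  · intro k Γ Γ' hk h h' hs
    rw [dif_pos h, dif_pos h']
    refine b.ext_elem fun T' => ?_
    rw [hb (k + 1) ⟨by omega, by omega⟩]
    exact (StandardTableau.repr_swap b hk (T := .ofChain h) (S := .ofChain h') hs T').symm
  · intro k Γ hk h hd
    rw [dif_pos h]
    refine b.ext_elem fun T' => ?_
    rw [hb (k + 1) ⟨by omega, by omega⟩]
    exact (StandardTableau.repr_adjacent b hk (T := .ofChain h) hd T').symm

theorem murphyElement_apply_of_isLabelledBy (hq : 0 < q) {V : Type*} [AddCommGroup V] [Module ℂ V]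
    {ρ : HeckeAlgebra (N + 1) q →ₐ[ℂ] Module.End ℂ V} {μ : YoungDiagram}
    (b : Module.Basis (StandardTableau (N + 1) μ) ℂ V)
    (hb : ∀ i ∈ Set.Ico 1 (N + 1), ∀ T T' : StandardTableau (N + 1) μ,
      b.repr (ρ (g (N + 1) q i) (b T)) T' =
        ((StandardTableau.seminormalEntry q i T' T : ℝ) : ℂ))
    (T : StandardTableau (N + 1) μ) {k : ℕ} (hk : k < N + 1) :
    ρ (murphyElement N q k) (b T) = murphyEigenvalue q (stepContent T.shape k) • b T := by
  obtain ⟨u, hu, hs⟩ := exists_isSeminormal_of_isLabelledBy b hb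
  rw [map_jucysMurphy, ← hu]
  exact hs.jucysMurphy_apply hq hk T.shape_mem_chainsTo

/-- Every irreducible representation of the Hecke algebra is labelled by a Young diagram. -/
theorem exists_isLabelledBy (hq : 0 < q) {M : Type*} [AddCommGroup M] [Module ℂ M] [Nontrivial M]
    (ρ : HeckeAlgebra (N + 1) q →ₐ[ℂ] Module.End ℂ M)
    (hirr : ∀ S : Submodule ℂ M, (∀ h, ∀ x ∈ S, ρ h x ∈ S) → S = ⊥ ∨ S = ⊤) :
    ∃ μ, IsLabelledBy ρ μ := by
  obtain ⟨x, hx⟩ := exists_ne (0 : M)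
  -- The equivariant map from the regular module sending `h` to `ρ h x`, transported to the
  -- permutation module.
  set ψ : EuclideanSpace ℂ (Equiv.Perm (Fin (N + 1))) →ₗ[ℂ] M :=
    ((LinearMap.applyₗ x).comp ρ.toLinearMap).comp (orbitEquiv N hq).symm.toLinearMap with hψ
  have hψe : ∀ h, ψ (orbitMap N hq h) = ρ h x := fun h => by
    have : (orbitEquiv N hq).symm (orbitMap N hq h) = h := (orbitEquiv N hq).symm_apply_apply h
    simp [hψ, this]
  have hψh : ∀ h v, ψ (permAction N hq h v) = ρ h (ψ v) := fun h v => by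
    obtain ⟨y, rfl⟩ := (orbitMap_bijective hq).2 v
    rw [← orbitMap_mul, hψe, hψe, map_mul, Module.End.mul_apply]
  have hψ0 : ψ ≠ 0 := fun h0 => hx (by
    have := hψe 1
    rw [h0, map_one ρ] at this
    simpa using this.symm)
  have hex : ∃ (Γ : ℕ → YoungDiagram) (v : EuclideanSpace ℂ (Equiv.Perm (Fin (N + 1)))),
      IsStandardChain (N + 1) Γ ∧ (∀ p, N + 1 ≤ p → Γ p = Γ (N + 1)) ∧
      (∀ k < N + 1, jucysMurphy q (permGenerator N q) k v =
        murphyEigenvalue q (stepContent Γ k) • v) ∧ ψ v ≠ 0 := by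
    by_contra hc
    push Not at hc
    exact hψ0 (eq_zero_of_weight_vectors hq ψ hc)
  obtain ⟨Γ₀, v, hΓ, htail, hv, hv0⟩ := hex
  obtain ⟨u, hu0, hu⟩ := exists_isSeminormal (isHeckeFamily_permGenerator (N := N) hq) hq
    (fun k _ => permGenerator_isSymmetric k) le_rfl hΓ hv
  set μ := Γ₀ (N + 1) with hμ
  have hset : chainsTo (N + 1) (fun _ => μ) = chainsTo (N + 1) Γ₀ := by
    ext Γ
    exact and_congr_right fun _ => forall₂_congr fun j hj => by rw [htail j hj]
  have hw : IsSeminormal q (fun k => ρ (g (N + 1) q (k + 1))) (N + 1) Γ₀ (fun Γ => ψ (u Γ)) :=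
    hu.map ψ fun k hk y => by rw [← hψh, permAction, lift_g _ (by omega)]
  have hmem : ∀ T : StandardTableau (N + 1) μ, T.shape ∈ chainsTo (N + 1) Γ₀ := fun T =>
    hset ▸ T.shape_mem_chainsTo
  have hself : Γ₀ ∈ chainsTo (N + 1) Γ₀ := ⟨hΓ, fun _ _ => rfl⟩
  have hne : ∀ T : StandardTableau (N + 1) μ, ψ (u T.shape) ≠ 0 := fun T hz =>
    hv0 (hu0 ▸ hw.eq_zero hq (hmem T) hself hz)
  have hHecke := (isHeckeFamily_g (N + 1) q).map ρ
  -- Distinct tableaux have distinct content sequences, hence distinct joint weights, which gives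
  -- linear independence.
  have hindep := Module.End.independent_iInf_maxGenEigenspace_of_forall_mapsTo
    (fun k : Fin (N + 1) => jucysMurphy q (fun k => ρ (g (N + 1) q (k + 1))) (k : ℕ))
    (fun i j φ => Module.End.mapsTo_maxGenEigenspace_of_comm
      (hHecke.jucysMurphy_commute hq (by simp; omega) (by simp; omega)) φ)
  have hinj : Function.Injective fun (T : StandardTableau (N + 1) μ) (k : Fin (N + 1)) =>
      murphyEigenvalue q (stepContent T.shape k) := by
    intro T T' h
    ext1
    have := T.shape_mem_chainsTo.1.eq_of_stepContent T'.shape_mem_chainsTo.1 fun k hk =>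
      murphyEigenvalue_injective hq (congrFun h ⟨k, hk⟩)
    funext p
    rcases le_total p (N + 1) with hp | hp
    · exact this p hp
    · rw [T.shape_mem_chainsTo.2 p hp, T'.shape_mem_chainsTo.2 p hp]
  have hli : LinearIndependent ℂ fun T : StandardTableau (N + 1) μ => ψ (u T.shape) := by
    refine iSupIndep.linearIndependent _ (hindep.comp hinj) (fun T => ?_) hne
    simp only [Function.comp, Submodule.mem_iInf]
    intro k
    exact Module.End.genEigenspace_le_maximal _ _ 1
      (Module.End.mem_eigenspace_iff.2 (hw.jucysMurphy_apply hq k.2 (hmem T)))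
  have hstep : ∀ k, k + 1 < N + 1 → ∀ T : StandardTableau (N + 1) μ,
      (∃ S : StandardTableau (N + 1) μ, IsSwap k T.shape S.shape ∧
        ρ (g (N + 1) q (k + 1)) (ψ (u T.shape)) =
          diagCoeff q (axialDistance T.shape k) • ψ (u T.shape) +
          swapCoeff q (axialDistance T.shape k) • ψ (u S.shape)) ∨
      ((axialDistance T.shape k = 1 ∨ axialDistance T.shape k = -1) ∧
        ρ (g (N + 1) q (k + 1)) (ψ (u T.shape)) =
          diagCoeff q (axialDistance T.shape k) • ψ (u T.shape)) := by
    intro k hk T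
    rcases (hmem T).1.exists_isSwap_or_adjacent hk with ⟨Γ', hΓ', hs⟩ | hd
    · have hc := mem_chainsTo_of_isSwap T.shape_mem_chainsTo hΓ' hk hs
      exact Or.inl ⟨.ofChain hc, hs, hw.swap k T.shape Γ' hk (hmem T) (hset ▸ hc) hs⟩
    · exact Or.inr ⟨hd, hw.adjacent k T.shape hk (hmem T) hd⟩
  have hspan : Submodule.span ℂ
      (Set.range fun T : StandardTableau (N + 1) μ => ψ (u T.shape)) = ⊤ := by
    set S := Submodule.span ℂ (Set.range fun T : StandardTableau (N + 1) μ => ψ (u T.shape))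
    have hinS : ∀ T : StandardTableau (N + 1) μ, ψ (u T.shape) ∈ S := fun T =>
      Submodule.subset_span ⟨T, rfl⟩
    -- The seminormal formula makes the span invariant; it contains the nonzero image of `v`, so it
    -- is everything.
    refine (hirr S fun h => ?_).resolve_left fun hbot => ?_
    · induction h using induction_g with
      | hc c =>
        intro y hy
        rw [AlgHom.commutes, Module.algebraMap_end_apply]
        exact S.smul_mem c hy
      | hg k hk =>
        intro y hy
        induction hy using Submodule.span_induction with
        | zero => simp
        | add y z _ _ hy hz => rw [map_add]; exact add_mem hy hz
        | smul c y _ hy => rw [map_smul]; exact S.smul_mem c hy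
        | mem y hy =>
          obtain ⟨T, rfl⟩ := hy
          rcases hstep k (by omega) T with ⟨T', -, e⟩ | ⟨-, e⟩
          · simp only [e]
            exact add_mem (S.smul_mem _ (hinS T)) (S.smul_mem _ (hinS T'))
          · simp only [e]
            exact S.smul_mem _ (hinS T)
      | hmul a b ha hb =>
        intro y hy
        rw [map_mul, Module.End.mul_apply]
        exact ha _ (hb _ hy)
      | hadd a b ha hb =>
        intro y hy
        rw [map_add, LinearMap.add_apply]
        exact add_mem (ha _ hy) (hb _ hy)
    · have h1 := hinS (.ofChain (hset ▸ hself))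
      rw [hbot, Submodule.mem_bot] at h1
      exact hne _ h1
  refine ⟨μ, hΓ.card_eq le_rfl, Module.Basis.mk hli hspan.ge, fun i hi T T' => ?_⟩
  obtain ⟨k, rfl⟩ := Nat.exists_eq_add_of_le' hi.1
  have hk : k + 1 < N + 1 := hi.2
  have hbT : ∀ T, Module.Basis.mk hli hspan.ge T = ψ (u T.shape) := fun T => by
    rw [Module.Basis.mk_apply]
  rcases hstep k hk T with ⟨S, hs, e⟩ | ⟨hd, e⟩
  · rw [hbT, e, ← hbT T, ← hbT S]
    exact StandardTableau.repr_swap _ hk hs T'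
  · rw [hbT, e, ← hbT T]
    exact StandardTableau.repr_adjacent _ hk hd T'

/-! ### Box projectors and their vanishing in a quotient. -/

/-- The element `x` acts on the weight vectors of a chain `Γ` as the projection onto those chains
for which `Γ m` does not contain the box `z`. -/
def IsBoxProjector.{w} (x : HeckeAlgebra (N + 1) q) (m : ℕ) (z : ℕ × ℕ) : Prop :=
  ∀ (V : Type w) [AddCommGroup V] [Module ℂ V] (ρ : HeckeAlgebra (N + 1) q →ₐ[ℂ] Module.End ℂ V)
    (Γ : ℕ → YoungDiagram) (v : V), IsStandardChain (N + 1) Γ →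
    (∀ k < N + 1, ρ (murphyElement N q k) v = murphyEigenvalue q (stepContent Γ k) • v) →
    (z ∈ Γ m → ρ x v = 0) ∧ (z ∉ Γ m → ρ x v = v)

/-- `x * x - x` kills every weight vector of the permutation module, and that module is faithful
because its orbit map is injective. -/
theorem IsBoxProjector.isIdempotentElem (hq : 0 < q) {x : HeckeAlgebra (N + 1) q} {m : ℕ}
    {z : ℕ × ℕ} (hx : IsBoxProjector.{0} x m z) : IsIdempotentElem x := by
  have h0 : permAction N hq (x * x - x) = 0 := by
    refine eq_zero_of_weight_vectors hq _ fun Γ v h1 _ h3 => ?_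
    obtain ⟨e1, e2⟩ := hx _ (permAction N hq) Γ v h1 fun k hk => by
      rw [permAction_murphyElement hq (by omega)]; exact h3 k hk
    rw [map_sub, map_mul, LinearMap.sub_apply, Module.End.mul_apply]
    by_cases hz : z ∈ Γ m
    · simp [e1 hz]
    · simp [e2 hz]
  refine sub_eq_zero.1 ((orbitMap_bijective hq).1 ?_)
  have : orbitMap N hq ((x * x - x) * 1) = 0 := by rw [orbitMap_mul, h0, LinearMap.zero_apply]
  rw [mul_one] at this
  rw [this, map_zero]

/-- A quotient of the Hecke algebra kills a box projector exactly if all of its irreducible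
representations are labelled by diagrams all of whose subdiagrams of the given size contain the
box. -/
theorem IsBoxProjector.map_eq_zero_iff.{u} (hq : 0 < q) {x : HeckeAlgebra (N + 1) q} {m : ℕ}
    (hm : m ≤ N + 1) {z : ℕ × ℕ} (hx0 : IsBoxProjector.{0} x m z) (hx : IsBoxProjector.{u} x m z)
    {A : Type u} [Ring A] [Algebra ℂ A] (π : HeckeAlgebra (N + 1) q →ₐ[ℂ] A)
    (hπ : Function.Surjective π) :
    π x = 0 ↔ OnlyIrrepsLabelled π fun μ => ∀ lam ≤ μ, lam.card = m → z ∈ lam := by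
  constructor
  · intro h0 M _ _ _ _ _
    have : Nontrivial M := IsSimpleModule.nontrivial A M
    set ρ := (Algebra.lsmul ℂ ℂ M).comp π with hρ
    have hρa : ∀ h y, ρ h y = π h • y := fun h y => rfl
    obtain ⟨μ, hμ⟩ := exists_isLabelledBy hq ρ (fun S hS => by
      let S' : Submodule A M :=
        { S with
          smul_mem' := fun a y hy => by
            obtain ⟨h, rfl⟩ := hπ a
            exact hS h y hy }
      rcases eq_bot_or_eq_top S' with h | h
      · left
        refine (Submodule.eq_bot_iff _).2 fun y hy => ?_
        have : y ∈ S' := hy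
        rwa [h, Submodule.mem_bot] at this
      · right
        refine Submodule.eq_top_iff'.2 fun y => ?_
        have : y ∈ S' := by rw [h]; trivial
        exact this)
    refine ⟨μ, hμ, fun lam hle hcard => ?_⟩
    obtain ⟨hc, b, hb⟩ := hμ
    -- A tableau of shape `μ` passing through `lam`: if `lam` misses `z`, then `x` fixes its basis
    -- vector although `π x = 0`.
    obtain ⟨Γ, c1, c2, c3⟩ := exists_isStandardChain hle (fun _ => μ) rfl
    rw [hc] at c1 c3
    rw [hcard] at c2
    have hΓ : Γ ∈ chainsTo (N + 1) fun _ => μ := ⟨c1, c3⟩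
    have hw := hx M ρ Γ (b (.ofChain hΓ)) c1 fun k hk =>
      murphyElement_apply_of_isLabelledBy hq b hb (.ofChain hΓ) hk
    rw [c2] at hw
    by_contra hz
    have := hw.2 hz
    rw [hρa, h0, zero_smul] at this
    exact b.ne_zero _ this.symm
  · intro hirr
    have hkill : ∀ I : Submodule A A, IsCoatom I → π x ∈ I := by
      intro I hI
      have : IsSimpleModule A (A ⧸ I) := isSimpleModule_iff_isCoatom.2 hI
      obtain ⟨μ, ⟨hc, b, hb⟩, hμ⟩ := hirr (A ⧸ I)
      have hzero : (Algebra.lsmul ℂ ℂ (A ⧸ I)).comp π x = 0 := by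
        refine b.ext fun T => ?_
        have hT := T.shape_mem_chainsTo
        refine (hx (A ⧸ I) _ T.shape (b T) hT.1 fun k hk =>
          murphyElement_apply_of_isLabelledBy hq b hb T hk).1 ?_
        refine hμ _ ?_ (hT.1.card_eq hm)
        have := T.mono hm
        rwa [T.shape_last] at this
      have h1 := congrArg (fun Y : Module.End ℂ (A ⧸ I) => Y (Submodule.Quotient.mk 1)) hzero
      have h2 : π x • (Submodule.Quotient.mk 1 : A ⧸ I) = 0 := h1
      rw [← Submodule.Quotient.mk_smul, smul_eq_mul, mul_one] at h2
      exact (Submodule.Quotient.mk_eq_zero I).1 h2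
    have hid : π x * π x = π x := by rw [← map_mul, (hx0.isIdempotentElem hq).eq]
    -- As `π x` lies in every maximal left ideal, `1 - π x` lies in none and is left invertible; it
    -- annihilates the idempotent `π x`.
    have htop : Submodule.span A {1 - π x} = ⊤ := by
      by_contra hne
      obtain ⟨I, hI, hle⟩ := Ideal.exists_le_maximal (Submodule.span A {1 - π x}) hne
      have h1 : 1 - π x ∈ I := hle (Submodule.mem_span_singleton_self _)
      have h2 := I.add_mem h1 (hkill I hI.out)
      rw [sub_add_cancel] at h2
      exact hI.ne_top ((Ideal.eq_top_iff_one I).2 h2)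
    obtain ⟨y, hy⟩ := Submodule.mem_span_singleton.1
      (show (1 : A) ∈ Submodule.span A {1 - π x} by rw [htop]; trivial)
    rw [smul_eq_mul] at hy
    calc π x = (y * (1 - π x)) * π x := by rw [hy, one_mul]
      _ = y * (π x - π x * π x) := by rw [mul_assoc, sub_mul, one_mul]
      _ = 0 := by rw [hid, sub_self, mul_zero]

theorem map_list_prod_apply {V ι : Type*} [AddCommGroup V] [Module ℂ V]
    (ρ : HeckeAlgebra (N + 1) q →ₐ[ℂ] Module.End ℂ V) {v : V} {x : ι → HeckeAlgebra (N + 1) q}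
    {s : ι → ℂ} (L : List ι) (h : ∀ j ∈ L, ρ (x j) v = s j • v) :
    ρ (L.map x).prod v = (L.map s).prod • v := by
  induction L with
  | nil => simp
  | cons j L ih =>
    simp only [List.map_cons, List.prod_cons, map_mul, Module.End.mul_apply]
    rw [ih fun i hi => h i (by simp [hi]), map_smul, h j (by simp), smul_smul, mul_comm]

/-- If `c` is the content of the box of `j`, the `j`-th factor acts by `(q[c] + 1)/[j] = [c +
1]/[j]`, which is `0` at `c = -1` and `1` at `c = j - 1`. The content of the box of `j` is
`stepContent Γ (j - 1)`. -/
theorem rowProjector_isBoxProjector (hq : 0 < q) {l : ℕ} (hl : l ≤ N) :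
    IsBoxProjector (rowProjector (N + 1) q 1 (l + 1)) (l + 1) (1, 0) := by
  intro V _ _ ρ Γ v hΓ hv
  have key := map_list_prod_apply ρ (v := v)
    (x := fun j : ℕ => ((qInt q j : ℂ))⁻¹ • (murphy (N + 1) q 1 j + 1))
    (s := fun j : ℕ => ((qInt q j : ℂ))⁻¹ * (murphyEigenvalue q (stepContent Γ (j - 1)) + 1))
    (List.range' 2 l) (fun j hj => by
      have hj := List.mem_range'_1.1 hj
      obtain ⟨k, rfl⟩ := Nat.exists_eq_add_of_le' (show 1 ≤ j by omega)
      have := hv k (by omega)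
      rw [murphyElement, ← murphy_one_eq (by omega)] at this
      rw [map_smul, map_add, map_one, LinearMap.smul_apply, LinearMap.add_apply, this,
        Module.End.one_apply, Nat.add_sub_cancel]
      module)
  rw [rowProjector, Nat.add_sub_cancel, key]
  constructor
  · intro hz
    obtain ⟨k, h1, h2, h3⟩ := hΓ.exists_stepContent_eq_neg_one (by omega) hz
    have : ((List.range' 2 l).map fun j : ℕ =>
        ((qInt q j : ℂ))⁻¹ * (murphyEigenvalue q (stepContent Γ (j - 1)) + 1)).prod = 0 := by
      refine List.prod_eq_zero (List.mem_map.2 ⟨k + 1, List.mem_range'_1.2 (by omega), ?_⟩)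
      have e := murphyEigenvalue_add_one hq (-1)
      rw [neg_add_cancel, murphyEigenvalue_zero] at e
      have hq' : (q : ℂ) ≠ 0 := by exact_mod_cast hq.ne'
      have : murphyEigenvalue q (-1) + 1 = 0 := mul_left_cancel₀ hq' (by linear_combination -e)
      rw [Nat.add_sub_cancel, h3, this, mul_zero]
    rw [this, zero_smul]
  · intro hz
    rw [List.prod_eq_one, one_smul]
    intro c hc
    obtain ⟨j, hj, rfl⟩ := List.mem_map.1 hc
    have hj := List.mem_range'_1.1 hj
    obtain ⟨k, rfl⟩ := Nat.exists_eq_add_of_le' (show 1 ≤ j by omega)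
    rw [Nat.add_sub_cancel, hΓ.stepContent_of_row (by omega) hz (by omega)]
    have h1 : qInt q ((k + 1 : ℕ) : ℤ) ≠ 0 := (qInt_pos hq (by omega)).ne'
    have h2 : (qInt q ((k + 1 : ℕ) : ℤ))⁻¹ * (q * qInt q k + 1) = 1 := by
      rw [← qInt_add_one hq]
      exact inv_mul_cancel₀ h1
    rw [murphyEigenvalue]
    exact_mod_cast h2

theorem mul_qInt_neg (q : ℝ) (hq : 0 < q) (j : ℤ) : q * qInt q (-j) = -qInt q⁻¹ j := by
  unfold qInt
  by_cases h : q = 1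
  · subst h; simp
  · have h' : q⁻¹ ≠ 1 := fun e => h (inv_eq_one.1 e)
    have h1 := sub_ne_zero.2 h
    have h2 : (1 : ℝ) - q ≠ 0 := sub_ne_zero.2 (Ne.symm h)
    rw [if_neg h, if_neg h', inv_zpow', show q⁻¹ - 1 = (1 - q) / q by field_simp]
    field_simp
    ring

/-- The numerator `q[c] - q` vanishes at `c = 1`; at `c = 1 - j` it equals `q²[-j]`, which is the
denominator by `mul_qInt_neg`. -/
theorem colProjector_isBoxProjector (hq : 0 < q) {l : ℕ} (hl : l ≤ N) :
    IsBoxProjector (colProjector (N + 1) q 1 (l + 1)) (l + 1) (0, 1) := by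
  intro V _ _ ρ Γ v hΓ hv
  have key := map_list_prod_apply ρ (v := v)
    (x := fun j : ℕ => (-(q : ℂ) * (qInt q⁻¹ j : ℂ))⁻¹ •
      (murphy (N + 1) q 1 j - algebraMap ℂ _ (q : ℂ)))
    (s := fun j : ℕ => (-(q : ℂ) * (qInt q⁻¹ j : ℂ))⁻¹ *
      (murphyEigenvalue q (stepContent Γ (j - 1)) - q))
    (List.range' 2 l) (fun j hj => by
      have hj := List.mem_range'_1.1 hj
      obtain ⟨k, rfl⟩ := Nat.exists_eq_add_of_le' (show 1 ≤ j by omega)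
      have := hv k (by omega)
      rw [murphyElement, ← murphy_one_eq (by omega)] at this
      rw [map_smul, map_sub, AlgHom.commutes, LinearMap.smul_apply, LinearMap.sub_apply, this,
        Module.algebraMap_end_apply, Nat.add_sub_cancel]
      module)
  rw [colProjector, Nat.add_sub_cancel, key]
  constructor
  · intro hz
    obtain ⟨k, h1, h2, h3⟩ := hΓ.exists_stepContent_eq_one (by omega) hz
    have : ((List.range' 2 l).map fun j : ℕ => (-(q : ℂ) * (qInt q⁻¹ j : ℂ))⁻¹ *
        (murphyEigenvalue q (stepContent Γ (j - 1)) - q)).prod = 0 := by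
      refine List.prod_eq_zero (List.mem_map.2 ⟨k + 1, List.mem_range'_1.2 (by omega), ?_⟩)
      rw [Nat.add_sub_cancel, h3, murphyEigenvalue, qInt_one, mul_one, sub_self, mul_zero]
    rw [this, zero_smul]
  · intro hz
    rw [List.prod_eq_one, one_smul]
    intro c hc
    obtain ⟨j, hj, rfl⟩ := List.mem_map.1 hc
    have hj := List.mem_range'_1.1 hj
    obtain ⟨k, rfl⟩ := Nat.exists_eq_add_of_le' (show 1 ≤ j by omega)
    rw [Nat.add_sub_cancel, hΓ.stepContent_of_column (by omega) hz (by omega)]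
    have h1 : qInt q⁻¹ ((k + 1 : ℕ) : ℤ) ≠ 0 := (qInt_pos (inv_pos.2 hq) (by omega)).ne'
    have e1 := mul_qInt_neg q hq ((k + 1 : ℕ) : ℤ)
    have e2 := qInt_add_one hq (-((k + 1 : ℕ) : ℤ))
    rw [show -((k + 1 : ℕ) : ℤ) + 1 = -(k : ℤ) by push_cast; ring] at e2
    have h2 : (-q * qInt q⁻¹ ((k + 1 : ℕ) : ℤ))⁻¹ * (q * qInt q (-(k : ℤ)) - q) = 1 := by
      rw [e2, e1, show q * (-qInt q⁻¹ ((k + 1 : ℕ) : ℤ) + 1) - q =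
        -q * qInt q⁻¹ ((k + 1 : ℕ) : ℤ) by ring]
      exact inv_mul_cancel₀ (mul_ne_zero (neg_ne_zero.2 hq.ne') h1)
    rw [murphyEigenvalue]
    exact_mod_cast h2

theorem qIntSymm_ne_zero {r : ℝ} (hr : 0 < r) (l : ℕ) : (qIntSymm r (l + 1) : ℂ) ≠ 0 := by
  have : qIntSymm r (l + 1) ≠ 0 :=
    mul_ne_zero (Real.rpow_pos_of_pos hr _).ne' (qInt_pos hr (by omega)).ne'
  exact_mod_cast this

end HeckeAlgebra

open HeckeAlgebra in
theorem theorem1 (n l : ℕ) (hl : 1 ≤ l) (hln : l < n) (q : ℝ) (hq : 0 < q)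
    (A : Type*) [Ring A] [Algebra ℂ A]
    (π : HeckeAlgebra n q →ₐ[ℂ] A) (hπ : Function.Surjective π) :
    ((∀ i ∈ Finset.Icc 1 (n - l), π (HeckeAlgebra.e n q i l) = 0) ↔
      OnlyIrrepsLabelled π fun μ => μ.rowLen 0 ≤ l) ∧
    ((∀ i ∈ Finset.Icc 1 (n - l), π (HeckeAlgebra.f n q i l) = 0) ↔
      OnlyIrrepsLabelled π fun μ => μ.colLen 0 ≤ l) := by
  obtain ⟨N, rfl⟩ : ∃ N, n = N + 1 := ⟨n - 1, by omega⟩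
  simp only [rowLen_zero_le_iff, colLen_zero_le_iff]
  constructor
  -- The projector property is needed in two universes: that of the permutation module for
  -- idempotency, and that of `A` for its simple modules.
  · rw [← IsBoxProjector.map_eq_zero_iff hq (by omega)
      (rowProjector_isBoxProjector hq (show l ≤ N by omega))
      (rowProjector_isBoxProjector hq (show l ≤ N by omega)) π hπ]
    simp only [e, map_smul, smul_eq_zero, qIntSymm_ne_zero hq l, false_or]
    refine ⟨fun h => h 1 (Finset.mem_Icc.2 ⟨le_rfl, by omega⟩), fun h => ?_⟩
    exact map_shift_eq_zero π hq (x := fun i => rowProjector (N + 1) q i (l + 1))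
      (fun y hy i hi him => semiconj_rowProjector hy hi (by omega)) h
  · rw [← IsBoxProjector.map_eq_zero_iff hq (by omega)
      (colProjector_isBoxProjector hq (show l ≤ N by omega))
      (colProjector_isBoxProjector hq (show l ≤ N by omega)) π hπ]
    simp only [f, map_smul, smul_eq_zero, qIntSymm_ne_zero (Real.sqrt_pos.2 hq) l, false_or]
    refine ⟨fun h => h 1 (Finset.mem_Icc.2 ⟨le_rfl, by omega⟩), fun h => ?_⟩
    exact map_shift_eq_zero π hq (x := fun i => colProjector (N + 1) q i (l + 1))
      (fun y hy i hi him => semiconj_colProjector hy hi (by omega)) h
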